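/- Let $X$ be a separable real Hilbert space and $\Delta=\{(s,t)\in\mathbb R^2: s<t\}$. Assume the following. (1) $\{U(t,s)\}_{s\le t}\subset\mathcal L(X)$ satisfies $U(t,t)=I$ and $U(t,r)U(r,s)=U(t,s)$ for $s\le r\le t$; for every $x\in X$ the map $(s,t)\mapsto U(t,s)x$ is continuous on $\overline\Delta$; and $\|U(t,s)\|\le Me^{-\zeta(t-s)}$ for $s\le t$, for some $M>0$, $\zeta\in\mathbb R$. (2) $\{B(t)\}_{t\in\mathbb R}\subset\mathcal L(X)$ satisfies $\sup_t\|B(t)\|<\infty$, and $t\mapsto B(t)x$ is continuous for every $x\in X$. Set $Q(t)=B(t)B(t)^\star$. (3) For every $(s,t)\in\Delta$ the operator $Q(t,s)x=\int_s^tU(t,r)Q(r)U(t,r)^\star x\,dr$ has finite trace, and $\sup_{s<t}\operatorname{Tr}Q(t,s)<\infty$ for every $t\in\mathbb R$. (4) There are linear operators $A(r):D(A(r))\subseteq X\to X$, $r\in\mathbb R$, with $D(A(r))$ and $D(A(r)^\star)$ dense in $X$, such that for all $(s,t)\in\Delta$: $U(t,s)D(A(s))\subseteq D(A(t))$, $U(t,s)^\star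 D(A(t)^\star)\subseteq D(A(s)^\star)$, and $\partial_sU(t,s)x=-U(t,s)A(s)x$, $\partial_tU(t,s)x=A(t)U(t,s)x$ for $x\in D(A(s))$. (5) $\lim_{s\to-\infty}U(t,s)x=0$ for all $t\in\mathbb R$, $x\in X$. (6) Let $\mathrm H_r=Q(r)^{1/2}(X)$ with norm $\|y\|_{\mathrm H_r}=\|Q(r)^{-1/2}y\|$, where $Q(r)^{-1/2}y$ is the unique $x\in(\ker Q(r)^{1/2})^\perp$ with $Q(r)^{1/2}x=y$. For all $(s,t)\in\Delta$, $U(t,s)\mathrm H_s\subseteq\mathrm H_t$, and there are $C,\eta>0$ and $\alpha\in[0,\tfrac12)$ with $$\|U(t,s)\|_{\mathcal L(\mathrm H_s;\mathrm H_t)}\le C\,\frac{e^{-\eta(t-s)}}{(t-s)^\alpha},\qquad (s,t)\in\Delta.$$ Write $\mathcal N_{m,Q}$ for the Gaussian measure on $X$ with mean $m$ and covariance operator $Q$. Let $P_{s,t}f(x)=\int_Xf\,d\mathcal N_{U(t,s)x,\,Q(t,s)}$ for bounded Borel $f$ and $(s,t)\in\Delta$. Let $\gamma_t=\mathcal N_{0,Q(t,-\infty)}$,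 where $Q(t,-\infty)x=\int_{-\infty}^tU(t,r)Q(r)U(t,r)^\star x\,dr$, and put $$\kappa=C^2(2\eta)^{2\alpha-1}\,\Gamma(1-2\alpha).$$ Then for every $s<t$, $q>1$ and $0<p\le(q-1)e^{(t-s)/(2\kappa)}+1$, the operator $P_{s,t}$, defined on $C_b(X)$, has a unique extension to a bounded linear operator $P_{s,t}:L^q(X,\gamma_t)\to L^q(X,\gamma_s)$, and $$\|P_{s,t}\varphi\|_{L^p(X,\gamma_s)}\le\|\varphi\|_{L^q(X,\gamma_t)}\qquad\text{for all }\varphi\in L^q(X,\gamma_t),$$ where $\|f\|_{L^p}=(\int|f|^p)^{1/p}$ also for $p<1$. -/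

import Mathlib

open MeasureTheory Filter Topology
open scoped RealInnerProductSpace ENNReal BoundedContinuousFunction

namespace NonautOU

/-! ### Nonnegative square roots and pseudo-inverses -/

section SquareRoot

variable {X : Type*} [NormedAddCommGroup X] [InnerProductSpace ℝ X] [CompleteSpace X]

/-- The scalar sequence majorising the Newton-type iteration for the square root. -/
noncomputable def sqrtIterReal : ℕ → ℝ
  | 0 => 0
  | n + 1 => (1 + sqrtIterReal n ^ 2) / 2

/-- Iteration `Y ↦ (T + Y²) / 2`, whose limit `Y` satisfies `(1 - Y)² = 1 - T`. -/
noncomputable def sqrtIter (T : X →L[ℝ] X) : ℕ → X →L[ℝ] X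
  | 0 => 0
  | n + 1 => (2⁻¹ : ℝ) • (T + sqrtIter T n * sqrtIter T n)

theorem sqrtIterReal_bounds (n : ℕ) :
    0 ≤ sqrtIterReal n ∧ sqrtIterReal n ≤ 1 ∧ sqrtIterReal n ≤ sqrtIterReal (n + 1) := by
  have h : 0 ≤ sqrtIterReal n ∧ sqrtIterReal n ≤ 1 := by
    induction n with
    | zero => simp [sqrtIterReal]
    | succ k ih =>
      obtain ⟨h0, h1⟩ := ih
      constructor
      · simp only [sqrtIterReal]; positivity
      · simp only [sqrtIterReal]; nlinarith
  refine ⟨h.1, h.2, ?_⟩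
  simp only [sqrtIterReal]
  nlinarith [sq_nonneg (1 - sqrtIterReal n)]

theorem sqrtIter_norm_le {T : X →L[ℝ] X} (hT : ‖T‖ ≤ 1) (n : ℕ) :
    ‖sqrtIter T n‖ ≤ sqrtIterReal n := by
  induction n with
  | zero => simp [sqrtIter, sqrtIterReal]
  | succ k ih =>
    have h1 : ‖sqrtIter T k * sqrtIter T k‖ ≤ sqrtIterReal k ^ 2 := by
      refine (norm_mul_le _ _).trans ?_
      nlinarith [norm_nonneg (sqrtIter T k), (sqrtIterReal_bounds k).1]
    have h2 := norm_add_le T (sqrtIter T k * sqrtIter T k)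
    simp only [sqrtIter, sqrtIterReal, norm_smul, norm_inv, Real.norm_ofNat]
    linarith

theorem sqrtIter_sub_norm_le {T : X →L[ℝ] X} (hT : ‖T‖ ≤ 1) (n : ℕ) :
    ‖sqrtIter T (n + 1) - sqrtIter T n‖ ≤ sqrtIterReal (n + 1) - sqrtIterReal n := by
  induction n with
  | zero =>
    have h := sqrtIter_norm_le hT 1
    simpa [sqrtIter, sqrtIterReal] using h
  | succ k ih =>
    set a := sqrtIter T k with ha
    set b := sqrtIter T (k + 1) with hb
    set x := sqrtIterReal k with hx
    set y := sqrtIterReal (k + 1) with hy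
    have hbound : ‖b * (b - a) + (b - a) * a‖ ≤ y * (y - x) + (y - x) * x := by
      refine (norm_add_le _ _).trans (add_le_add ?_ ?_)
      · exact (norm_mul_le _ _).trans (mul_le_mul (sqrtIter_norm_le hT (k + 1)) ih
          (norm_nonneg _) (sqrtIterReal_bounds (k + 1)).1)
      · exact (norm_mul_le _ _).trans (mul_le_mul ih (sqrtIter_norm_le hT k)
          (norm_nonneg _) (by linarith [(sqrtIterReal_bounds k).2.2]))
    have e1 : sqrtIter T (k + 1 + 1) - b = (2⁻¹ : ℝ) • (b * (b - a) + (b - a) * a) := by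
      have h1 : sqrtIter T (k + 1 + 1) = (2⁻¹ : ℝ) • (T + b * b) := rfl
      have h2 : b = (2⁻¹ : ℝ) • (T + a * a) := rfl
      rw [h1]
      nth_rewrite 3 [h2]
      rw [← smul_sub]
      congr 1
      noncomm_ring
    have e2 : sqrtIterReal (k + 1 + 1) - y = 2⁻¹ * (y * (y - x) + (y - x) * x) := by
      have h1 : sqrtIterReal (k + 1 + 1) = (1 + y ^ 2) / 2 := rfl
      have h2 : y = (1 + x ^ 2) / 2 := rfl
      rw [h1]
      nth_rewrite 2 [h2]
      ring
    rw [e1, e2, norm_smul, norm_inv, Real.norm_ofNat]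
    linarith

theorem sqrtIter_isSelfAdjoint {T : X →L[ℝ] X} (hT : IsSelfAdjoint T) (n : ℕ) :
    star (sqrtIter T n) = sqrtIter T n := by
  induction n with
  | zero => exact star_zero _
  | succ k ih =>
    have h : sqrtIter T (k + 1) = (2⁻¹ : ℝ) • (T + sqrtIter T k * sqrtIter T k) := rfl
    have h2 : star ((2⁻¹ : ℝ) • (T + sqrtIter T k * sqrtIter T k)) =
        star (2⁻¹ : ℝ) • star (T + sqrtIter T k * sqrtIter T k) :=
      map_smulₛₗ ContinuousLinearMap.adjoint (2⁻¹ : ℝ) _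
    rw [h, h2, star_add, star_mul, ih, hT.star_eq, star_trivial]

/-- For `‖B‖ ≤ 1` the operator `B B⋆` has a nonnegative self-adjoint square root. -/
theorem exists_posSqrt_of_norm_le_one (B : X →L[ℝ] X) (hB : ‖B‖ ≤ 1) :
    ∃ R : X →L[ℝ] X, R.IsPositive ∧ R * R = B * ContinuousLinearMap.adjoint B := by
  set Q : X →L[ℝ] X := B * ContinuousLinearMap.adjoint B with hQ
  set T : X →L[ℝ] X := 1 - Q with hTdef
  have hQsa : IsSelfAdjoint Q := IsSelfAdjoint.mul_star_self B
  have hTsa : IsSelfAdjoint T := (IsSelfAdjoint.one _).sub hQsa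
  have hT : ‖T‖ ≤ 1 := by
    refine ContinuousLinearMap.opNorm_le_bound _ zero_le_one fun x => ?_
    have h1 : ⟪Q x, x⟫ = ‖ContinuousLinearMap.adjoint B x‖ ^ 2 := by
      rw [hQ, ← real_inner_self_eq_norm_sq, ContinuousLinearMap.adjoint_inner_right]
      rfl
    have h2 : ‖Q x‖ ≤ ‖ContinuousLinearMap.adjoint B x‖ := by
      have := B.le_opNorm (ContinuousLinearMap.adjoint B x)
      calc ‖Q x‖ = ‖B (ContinuousLinearMap.adjoint B x)‖ := rfl
        _ ≤ ‖B‖ * ‖ContinuousLinearMap.adjoint B x‖ := this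
        _ ≤ 1 * ‖ContinuousLinearMap.adjoint B x‖ := by gcongr
        _ = _ := one_mul _
    have h3 : ‖T x‖ ^ 2 = ‖x‖ ^ 2 - 2 * ⟪Q x, x⟫ + ‖Q x‖ ^ 2 := by
      have : T x = x - Q x := rfl
      rw [this, norm_sub_sq_real, real_inner_comm]
    have h4 : ‖T x‖ ^ 2 ≤ ‖x‖ ^ 2 := by
      rw [h3, h1]
      nlinarith [norm_nonneg (Q x), norm_nonneg (ContinuousLinearMap.adjoint B x)]
    rw [one_mul]
    exact abs_le_of_sq_le_sq' h4 (norm_nonneg _) |>.2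
  have hmono : Monotone sqrtIterReal := monotone_nat_of_le_succ fun n =>
    (sqrtIterReal_bounds n).2.2
  have hsum : Summable fun n => sqrtIterReal (n + 1) - sqrtIterReal n := by
    refine summable_of_sum_range_le (c := 1)
      (fun n => sub_nonneg.2 (sqrtIterReal_bounds n).2.2) fun n => ?_
    rw [Finset.sum_range_sub]
    simpa [sqrtIterReal] using (sqrtIterReal_bounds n).2.1
  have hcau : CauchySeq (sqrtIter T) := by
    refine cauchySeq_of_dist_le_of_summable _ (fun n => ?_) hsum
    rw [dist_comm, dist_eq_norm]
    exact sqrtIter_sub_norm_le hT n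
  obtain ⟨Y, hY⟩ := cauchySeq_tendsto_of_complete hcau
  have hYfix : Y = (2⁻¹ : ℝ) • (T + Y * Y) := by
    have h1 : Tendsto (fun n => sqrtIter T (n + 1)) atTop (𝓝 Y) := (tendsto_add_atTop_iff_nat 1).2 hY
    have h2 : Tendsto (fun n => (2⁻¹ : ℝ) • (T + sqrtIter T n * sqrtIter T n)) atTop
        (𝓝 ((2⁻¹ : ℝ) • (T + Y * Y))) := ((hY.mul hY).const_add T).const_smul _
    exact tendsto_nhds_unique h1 h2
  have hYnorm : ‖Y‖ ≤ 1 := le_of_tendsto hY.norm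
    (Eventually.of_forall fun n => (sqrtIter_norm_le hT n).trans (sqrtIterReal_bounds n).2.1)
  have hYsa : IsSelfAdjoint Y := by
    have h1 : Tendsto (fun n => star (sqrtIter T n)) atTop (𝓝 (star Y)) := hY.star
    have h2 : (fun n => star (sqrtIter T n)) = sqrtIter T :=
      funext fun n => sqrtIter_isSelfAdjoint hTsa n
    rw [h2] at h1
    exact tendsto_nhds_unique h1 hY
  refine ⟨1 - Y, ?_, ?_⟩
  · rw [ContinuousLinearMap.isPositive_iff]
    refine ⟨((IsSelfAdjoint.one _).sub hYsa).isSymmetric, fun x => ?_⟩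
    have h1 : (1 - Y) x = x - Y x := rfl
    have h2 : ⟪Y x, x⟫ ≤ ‖x‖ ^ 2 := by
      calc ⟪Y x, x⟫ ≤ ‖Y x‖ * ‖x‖ := real_inner_le_norm _ _
        _ ≤ (1 * ‖x‖) * ‖x‖ := by
            gcongr
            exact (Y.le_opNorm x).trans (by gcongr)
        _ = ‖x‖ ^ 2 := by ring
    rw [h1, inner_sub_left, real_inner_self_eq_norm_sq]
    linarith
  · have h2 : T + Y * Y = Y + Y := by
      have h3 : (2 : ℝ) • Y = T + Y * Y := by
        nth_rewrite 1 [hYfix]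
        rw [smul_smul]
        norm_num
      rw [← h3, two_smul]
    calc (1 - Y) * (1 - Y) = 1 - (Y + Y) + Y * Y := by noncomm_ring
      _ = 1 - (T + Y * Y) + Y * Y := by rw [h2]
      _ = Q := by rw [hTdef]; abel

/-- `B B⋆` has a nonnegative self-adjoint square root. -/
theorem exists_posSqrt (B : X →L[ℝ] X) :
    ∃ R : X →L[ℝ] X, R.IsPositive ∧ R * R = B * ContinuousLinearMap.adjoint B := by
  set c : ℝ := ‖B‖ + 1 with hc
  have hc0 : 0 < c := by positivity
  obtain ⟨R, hR, hRR⟩ := exists_posSqrt_of_norm_le_one (c⁻¹ • B) (by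
    rw [norm_smul, norm_inv, Real.norm_of_nonneg hc0.le, inv_mul_le_iff₀ hc0]
    linarith)
  refine ⟨c • R, ?_, ?_⟩
  · rw [ContinuousLinearMap.isPositive_iff] at hR ⊢
    refine ⟨fun x y => ?_, fun x => ?_⟩
    · have := hR.1 x y
      simp only [ContinuousLinearMap.coe_coe] at this
      simp [inner_smul_left, inner_smul_right, this]
    · simpa [inner_smul_left] using mul_nonneg hc0.le (hR.2 x)
  · rw [smul_mul_smul_comm, hRR, map_smulₛₗ, smul_mul_smul_comm, smul_smul]
    have : c * c * (c⁻¹ * (starRingEnd ℝ) c⁻¹) = 1 := by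
      simp only [conj_trivial]
      field_simp
    rw [this, one_smul]

/-- The nonnegative self-adjoint square root `Q^{1/2}` of `Q = B B⋆`. -/
noncomputable def sqrtMulAdjoint (B : X →L[ℝ] X) : X →L[ℝ] X := (exists_posSqrt B).choose

theorem sqrtMulAdjoint_isPositive (B : X →L[ℝ] X) : (sqrtMulAdjoint B).IsPositive :=
  (exists_posSqrt B).choose_spec.1

theorem sqrtMulAdjoint_mul_self (B : X →L[ℝ] X) :
    sqrtMulAdjoint B * sqrtMulAdjoint B = B * ContinuousLinearMap.adjoint B :=
  (exists_posSqrt B).choose_spec.2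

theorem exists_pseudoInv (R : X →L[ℝ] X) (y : R.range) :
    ∃ x ∈ R.kerᗮ, R x = y := by
  obtain ⟨y, x, rfl⟩ := y
  have hcl : IsClosed (R.ker : Set X) := R.isClosed_ker
  have : CompleteSpace R.ker := hcl.completeSpace_coe
  refine ⟨x - R.ker.starProjection x, Submodule.sub_starProjection_mem_orthogonal x, ?_⟩
  have h : R (R.ker.starProjection x) = 0 := by
    exact LinearMap.mem_ker.1 (Submodule.starProjection_apply_mem R.ker x)
  simp [h]

/-- The pseudo-inverse of `R`: for `y` in the range of `R`, the unique `x ∈ (ker R)^⊥` with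
`R x = y`. -/
noncomputable def pseudoInv (R : X →L[ℝ] X) (y : R.range) : X :=
  (exists_pseudoInv R y).choose

/-- The norm `‖y‖_{H_R} = ‖R⁻¹ y‖` of the Hilbert space `H_R = R(X)`. -/
noncomputable def rangeNorm (R : X →L[ℝ] X) (y : R.range) : ℝ := ‖pseudoInv R y‖

end SquareRoot

/-! ### Gaussian measures and traces -/

section Gaussian

variable {X : Type*} [NormedAddCommGroup X] [InnerProductSpace ℝ X]

/-- The trace `∑ₙ ⟪Q eₙ, eₙ⟫` (possibly infinite) of a nonnegative operator, computed in an
orthonormal basis of `X`. -/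
noncomputable def opTrace [CompleteSpace X] (Q : X → X) : ℝ≥0∞ :=
  ∑' e : (exists_hilbertBasis ℝ X).choose, ENNReal.ofReal ⟪Q (e : X), (e : X)⟫

variable [MeasurableSpace X]

/-- `μ` is a Borel probability measure with the characteristic function
`x ↦ exp (i⟪m, x⟫ - ⟪Q x, x⟫ / 2)`. -/
def IsGaussianWith (m : X) (Q : X → X) (μ : Measure X) : Prop :=
  IsProbabilityMeasure μ ∧
    ∀ x : X, charFun μ x = Complex.exp ((⟪m, x⟫ : ℝ) * Complex.I - ((⟪Q x, x⟫ : ℝ) : ℂ) / 2)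

open Classical in
/-- The Gaussian measure `𝒩(m, Q)` with mean `m` and covariance operator `Q` (the zero measure
if there is none, which does not happen for a nonnegative self-adjoint trace class `Q`). -/
noncomputable def gaussianMeasure (m : X) (Q : X → X) : Measure X :=
  if h : ∃ μ : Measure X, IsGaussianWith m Q μ then h.choose else 0

theorem gaussianMeasure_eq [CompleteSpace X] [SecondCountableTopology X] [BorelSpace X]
    {m : X} {Q : X → X} {μ : Measure X} (h : IsGaussianWith m Q μ) :
    gaussianMeasure m Q = μ := by
  have hex : ∃ μ : Measure X, IsGaussianWith m Q μ := ⟨μ, h⟩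
  have h1 : IsGaussianWith m Q (gaussianMeasure m Q) := by
    rw [gaussianMeasure, dif_pos hex]
    exact hex.choose_spec
  have := h.1
  have := h1.1
  exact Measure.ext_of_charFun (funext fun x => by rw [h1.2 x, h.2 x])

end Gaussian

/-! ### The nonautonomous Ornstein-Uhlenbeck evolution operator -/

section Evolution

variable {X : Type*} [NormedAddCommGroup X] [InnerProductSpace ℝ X] [CompleteSpace X]

/-- `Q(t,s) x = ∫ₛᵗ U(t,r) B(r) B(r)⋆ U(t,r)⋆ x dr`. -/
noncomputable def covOp (U : ℝ → ℝ → X →L[ℝ] X) (B : ℝ → X →L[ℝ] X) (t s : ℝ) (x : X) : X :=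
  ∫ r in s..t, U t r (B r (ContinuousLinearMap.adjoint (B r)
    (ContinuousLinearMap.adjoint (U t r) x)))

/-- `Q(t,-∞) x = ∫_{-∞}^t U(t,r) B(r) B(r)⋆ U(t,r)⋆ x dr`. -/
noncomputable def covOpInfty (U : ℝ → ℝ → X →L[ℝ] X) (B : ℝ → X →L[ℝ] X) (t : ℝ) (x : X) : X :=
  ∫ r in Set.Iic t, U t r (B r (ContinuousLinearMap.adjoint (B r)
    (ContinuousLinearMap.adjoint (U t r) x)))

/-- `U(t,s)`, `s ≤ t`, is a strongly continuous evolution operator with exponential growth bound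
(the values `U t s` with `t < s` play no role). -/
structure IsEvolutionOperator (U : ℝ → ℝ → X →L[ℝ] X) : Prop where
  continuousOn : ∀ x : X, ContinuousOn (fun p : ℝ × ℝ => U p.2 p.1 x) {p | p.1 ≤ p.2}
  self : ∀ t, U t t = ContinuousLinearMap.id ℝ X
  comp : ∀ s r t, s ≤ r → r ≤ t → (U t r).comp (U r s) = U t s
  growth : ∃ M > 0, ∃ ζ : ℝ, ∀ s t, s ≤ t → ‖U t s‖ ≤ M * Real.exp (-ζ * (t - s))

/-- `B(t)`, `t ∈ ℝ`, is a bounded strongly continuous family of bounded operators. -/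
structure IsNoiseFamily (B : ℝ → X →L[ℝ] X) : Prop where
  bounded : ∃ K > 0, ∀ t, ‖B t‖ ≤ K
  continuous : ∀ x : X, Continuous fun t => B t x

/-- The (possibly unbounded) operators `A(r)` are associated with the evolution operator `U`. -/
structure IsGeneratingFamily (U : ℝ → ℝ → X →L[ℝ] X) (A : ℝ → X →ₗ.[ℝ] X) : Prop where
  dense_domain : ∀ r, Dense ((A r).domain : Set X)
  dense_adjoint_domain : ∀ r, Dense ((A r).adjoint.domain : Set X)
  maps_domain : ∀ s t, s < t → ∀ x ∈ (A s).domain, U t s x ∈ (A t).domain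
  maps_adjoint_domain : ∀ s t, s < t → ∀ x ∈ (A t).adjoint.domain,
    ContinuousLinearMap.adjoint (U t s) x ∈ (A s).adjoint.domain
  hasDerivAt_left : ∀ s t, s < t → ∀ x : (A s).domain,
    HasDerivAt (fun σ => U t σ x) (-(U t s (A s x))) s
  hasDerivAt_right : ∀ s t (h : s < t) (x : (A s).domain),
    HasDerivAt (fun τ => U τ s x) (A t ⟨U t s x, maps_domain s t h x x.2⟩) t

/-- `P_{s,t} f (x) = ∫ f(y) 𝒩(U(t,s)x, Q(t,s))(dy)`, for `s < t`. -/
noncomputable def evolP [MeasurableSpace X] (U : ℝ → ℝ → X →L[ℝ] X) (B : ℝ → X →L[ℝ] X)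
    (s t : ℝ) (f : X → ℝ) (x : X) : ℝ :=
  ∫ y, f y ∂(gaussianMeasure (U t s x) (covOp U B t s))

/-- The evolution system of measures `γ_t = 𝒩(0, Q(t,-∞))`. -/
noncomputable def gammaMeasure [MeasurableSpace X] (U : ℝ → ℝ → X →L[ℝ] X)
    (B : ℝ → X →L[ℝ] X) (t : ℝ) : Measure X :=
  gaussianMeasure 0 (covOpInfty U B t)

/-- The bounded linear operator `T : L^q(X, γ_t) → L^q(X, γ_s)` extends `P_{s,t}`, i.e. it
coincides with `P_{s,t}` on (the classes of) bounded continuous functions. -/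
def ExtendsEvolP [MeasurableSpace X] (U : ℝ → ℝ → X →L[ℝ] X) (B : ℝ → X →L[ℝ] X)
    (s t : ℝ) (q : ℝ≥0∞) [Fact (1 ≤ q)]
    (T : Lp ℝ q (gammaMeasure U B t) →L[ℝ] Lp ℝ q (gammaMeasure U B s)) : Prop :=
  ∀ (φ : Lp ℝ q (gammaMeasure U B t)) (f : X →ᵇ ℝ),
    (φ : X → ℝ) =ᵐ[gammaMeasure U B t] f →
      (T φ : X → ℝ) =ᵐ[gammaMeasure U B s] evolP U B s t f

end Evolution

end NonautOU

/-!
The operator `P_{s,t}` averages `f (U(t,s) x + z)` over `z ∼ 𝒩(0, Q(t,s))`, and the identity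
`Q(t,-∞) = Q(t,s) + U(t,s) Q(s,-∞) U(t,s)⋆` says that `U(t,s) x + z` has law `γ_t` when `x ∼ γ_s` is
independent of `z` (`inner_covOpInfty_eq_add`, `IsGaussianWith.map_add`). So the theorem compares
two jointly Gaussian vectors `Y = U(t,s) x + z` and `x`, and rests on two facts.

Decay of correlation. By duality the bound on `U(t,r) : H_r → H_t` becomes
`‖B(r)⋆ U(t,r)⋆ h‖ ≤ C e^{-η(t-r)} (t-r)^{-α} ‖B(t)⋆ h‖`; squaring and integrating over `r < t`
gives `⟪Q(t,-∞) h, h⟫ ≤ κ ‖B(t)⋆ h‖²` (`inner_covOpInfty_le`). For fixed `h`, the function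
`G(r) = ⟪Q(r,-∞) U(t,r)⋆ h, U(t,r)⋆ h⟫ = ∫_{-∞}^r ‖B(σ)⋆ U(t,σ)⋆ h‖² dσ` therefore satisfies
`G ≤ κ G'`, whence `e^{(t-s)/κ} G(s) ≤ G(t)` (`exp_mul_inner_covOpInfty_le`).

A Gaussian Hölder inequality. If `X`, `Y` are jointly Gaussian and centred and the quadratic form
`a b 𝔼[ℓ(X) m(Y)] - a(1-a)/2 𝔼 ℓ(X)² - b(1-b)/2 𝔼 m(Y)²` is nonpositive for all functionals
`ℓ`, `m`, then `𝔼[f(X)^a g(Y)^b] ≤ (𝔼 f(X))^a (𝔼 g(Y))^b` (`integral_rpow_mul_rpow_le`). The pair is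
split into `n` independent Gaussian increments of size `n^{-1/2}`; along one increment a second order
Taylor expansion shows that the inequality holds up to `O(n^{-3/2})`, the second order term being the
quadratic form, and the errors add up to `O(n^{-1/2})`. With `a = 1/q`, `b = 1 - 1/p`, the decay of
correlation makes the form nonpositive, and the choice of `φ^q` and `(P_{s,t} φ)^p` for `f` and `g`
yields `‖P_{s,t} φ‖_p ≤ ‖φ‖_q` for smooth `φ ≥ ε > 0`.

The inequality passes to bounded continuous functions through bounded pointwise limits of
cylindrical functions, then to `L^q` by density and Fatou's lemma (`exists_extension`). The Gaussian
measures involved exist because a positive operator of finite trace has a Hilbert-Schmidt square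
root, which maps white noise to the required measure (`exists_isGaussianWith`).
-/

namespace NonautOU

/-! ### Taylor estimates -/

section Taylor

theorem abs_sub_le_of_deriv_le {φ φ' : ℝ → ℝ} {a b C : ℝ}
    (h : ∀ x ∈ Set.Icc a b, HasDerivAt φ (φ' x) x) (hC : ∀ x ∈ Set.Icc a b, |φ' x| ≤ C)
    {x y : ℝ} (hx : x ∈ Set.Icc a b) (hy : y ∈ Set.Icc a b) : |φ y - φ x| ≤ C * |y - x| :=
  Convex.norm_image_sub_le_of_norm_hasDerivWithin_le (f := φ) (f' := φ')
    (fun z hz => (h z hz).hasDerivWithinAt) hC (convex_Icc a b) hx hy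

theorem abs_taylor_one_le {φ φ' : ℝ → ℝ} {a b L : ℝ}
    (h : ∀ x ∈ Set.Icc a b, HasDerivAt φ (φ' x) x)
    (hL : ∀ x ∈ Set.Icc a b, ∀ y ∈ Set.Icc a b, |φ' y - φ' x| ≤ L * |y - x|)
    {x y : ℝ} (hx : x ∈ Set.Icc a b) (hy : y ∈ Set.Icc a b) :
    |φ y - φ x - φ' x * (y - x)| ≤ L * |y - x| ^ 2 := by
  have hsub : Set.uIcc x y ⊆ Set.Icc a b := (Set.ordConnected_Icc).uIcc_subset hx hy
  have key := Convex.norm_image_sub_le_of_norm_hasDerivWithin_le (s := Set.uIcc x y)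
    (f := fun z => φ z - φ' x * z) (f' := fun z => φ' z - φ' x * 1) (C := L * |y - x|) (x := x)
    (y := y) (fun z hz => ((h z (hsub hz)).sub
      ((hasDerivAt_id z).const_mul (φ' x))).hasDerivWithinAt) (fun z hz => ?_)
    (convex_uIcc x y) Set.left_mem_uIcc Set.right_mem_uIcc
  · simp only [Real.norm_eq_abs] at key
    calc _ = |φ y - φ' x * y - (φ x - φ' x * x)| := by congr 1; ring
      _ ≤ _ := key
      _ = _ := by ring
  · have h0 : 0 ≤ L ∨ y = x := by
      by_cases hxy : y = x
      · exact Or.inr hxy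
      · left
        have := (abs_nonneg _).trans (hL x hx y hy)
        exact nonneg_of_mul_nonneg_left this (abs_pos.2 (sub_ne_zero.2 hxy))
    rw [mul_one]
    refine (hL x hx z (hsub hz)).trans ?_
    rcases h0 with h0 | rfl
    · exact mul_le_mul_of_nonneg_left (Set.abs_sub_left_of_mem_uIcc hz) h0
    · simp at hz; simp [hz]

theorem abs_taylor_two_le {φ φ' φ'' : ℝ → ℝ} {a b L : ℝ}
    (h : ∀ x ∈ Set.Icc a b, HasDerivAt φ (φ' x) x)
    (h' : ∀ x ∈ Set.Icc a b, HasDerivAt φ' (φ'' x) x)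
    (hL : ∀ x ∈ Set.Icc a b, ∀ y ∈ Set.Icc a b, |φ'' y - φ'' x| ≤ L * |y - x|) (hL0 : 0 ≤ L)
    {x y : ℝ} (hx : x ∈ Set.Icc a b) (hy : y ∈ Set.Icc a b) :
    |φ y - φ x - φ' x * (y - x) - φ'' x / 2 * (y - x) ^ 2| ≤ L * |y - x| ^ 3 := by
  have hsub : Set.uIcc x y ⊆ Set.Icc a b := (Set.ordConnected_Icc).uIcc_subset hx hy
  have key := Convex.norm_image_sub_le_of_norm_hasDerivWithin_le (s := Set.uIcc x y)
    (f := fun z => φ z - (φ' x * (z - x) + φ'' x / 2 * (z - x) ^ 2))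
    (f' := fun z => φ' z - (φ' x * 1 + φ'' x / 2 * (2 * (z - x)))) (C := L * |y - x| ^ 2)
    (x := x) (y := y) (fun z hz => ((h z (hsub hz)).sub
      ((((hasDerivAt_id z).sub_const x).const_mul (φ' x)).add
        ((by simpa using! (((hasDerivAt_id z).sub_const x).pow 2) :
          HasDerivAt (fun z => (z - x) ^ 2) (2 * (z - x)) z).const_mul
            (φ'' x / 2)))).hasDerivWithinAt) (fun z hz => ?_)
    (convex_uIcc x y) Set.left_mem_uIcc Set.right_mem_uIcc
  · simp only [Real.norm_eq_abs] at key
    calc _ = |φ y - (φ' x * (y - x) + φ'' x / 2 * (y - x) ^ 2) -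
          (φ x - (φ' x * (x - x) + φ'' x / 2 * (x - x) ^ 2))| := by congr 1; ring
      _ ≤ _ := key
      _ = _ := by ring
  · have h1 := abs_taylor_one_le h' hL hx (hsub hz)
    have h2 : |z - x| ^ 2 ≤ |y - x| ^ 2 :=
      pow_le_pow_left₀ (abs_nonneg _) (Set.abs_sub_left_of_mem_uIcc hz) 2
    rw [Real.norm_eq_abs]
    calc _ = |φ' z - φ' x - φ'' x * (z - x)| := by congr 1; ring
      _ ≤ _ := h1
      _ ≤ _ := mul_le_mul_of_nonneg_left h2 hL0

theorem exists_rpow_bound (r : ℝ) {a b : ℝ} (ha : 0 < a) :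
    ∃ M, 0 ≤ M ∧ ∀ x ∈ Set.Icc a b, |x ^ r| ≤ M := by
  have hc : ContinuousOn (fun x : ℝ => x ^ r) (Set.Icc a b) := fun x hx =>
    (Real.continuousAt_rpow_const x r (Or.inl (ha.trans_le hx.1).ne')).continuousWithinAt
  obtain ⟨M, hM⟩ := isCompact_Icc.exists_bound_of_continuousOn hc
  exact ⟨max M 0, le_max_right _ _, fun x hx => (hM x hx).trans (le_max_left _ _)⟩

theorem hasDerivAt_const_mul_rpow (c r : ℝ) {a b x : ℝ} (ha : 0 < a) (hx : x ∈ Set.Icc a b) :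
    HasDerivAt (fun x : ℝ => c * x ^ r) (c * r * x ^ (r - 1)) x := by
  have := (Real.hasDerivAt_rpow_const (p := r) (Or.inl (ha.trans_le hx.1).ne')).const_mul c
  rwa [← mul_assoc] at this

theorem exists_rpow_lipschitz (c r : ℝ) {a b : ℝ} (ha : 0 < a) :
    ∃ L, 0 ≤ L ∧ ∀ x ∈ Set.Icc a b, ∀ y ∈ Set.Icc a b,
      |c * y ^ r - c * x ^ r| ≤ L * |y - x| := by
  obtain ⟨M, hM0, hM⟩ := exists_rpow_bound (r - 1) (b := b) ha
  refine ⟨|c * r| * M, by positivity, fun x hx y hy => ?_⟩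
  refine abs_sub_le_of_deriv_le (φ := fun x => c * x ^ r) (φ' := fun x => c * r * x ^ (r - 1))
    (fun z hz => hasDerivAt_const_mul_rpow c r ha hz) (fun z hz => ?_) hx hy
  rw [abs_mul]
  exact mul_le_mul_of_nonneg_left (hM z hz) (abs_nonneg _)

/-- Second order Taylor formula for `x ↦ x ^ r`, uniformly on `[a, b] ⊆ (0, ∞)`. -/
theorem exists_rpow_taylor (r : ℝ) {a b : ℝ} (ha : 0 < a) :
    ∃ L, 0 ≤ L ∧ ∀ x ∈ Set.Icc a b, ∀ y ∈ Set.Icc a b,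
      |y ^ r - x ^ r * (1 + r * ((y - x) / x) - r * (1 - r) / 2 * ((y - x) / x) ^ 2)|
        ≤ L * |y - x| ^ 3 := by
  obtain ⟨L, hL0, hL⟩ := exists_rpow_lipschitz (1 * r * (r - 1)) (r - 1 - 1) (b := b) ha
  refine ⟨L, hL0, fun x hx y hy => ?_⟩
  have key := abs_taylor_two_le (φ := fun x => 1 * x ^ r) (φ' := fun x => 1 * r * x ^ (r - 1))
    (φ'' := fun x => 1 * r * (r - 1) * x ^ (r - 1 - 1))
    (fun z hz => hasDerivAt_const_mul_rpow 1 r ha hz)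
    (fun z hz => hasDerivAt_const_mul_rpow (1 * r) (r - 1) ha hz) hL hL0 hx hy
  have hx0 : 0 < x := ha.trans_le hx.1
  have e1 : x ^ (r - 1) = x ^ r / x := Real.rpow_sub_one hx0.ne' r
  have e2 : x ^ (r - 1 - 1) = x ^ r / x / x := by rw [Real.rpow_sub_one hx0.ne', e1]
  refine le_trans (le_of_eq ?_) key
  congr 1
  simp only [e1, e2]
  field_simp
  ring

end Taylor

/-! ### Bounded functions with bounded Lipschitz derivative -/

section COneOne

variable {E F : Type*} [NormedAddCommGroup E] [NormedSpace ℝ E] [NormedAddCommGroup F]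
  [NormedSpace ℝ F]

/-- `f` is a bounded `C^{1,1}` function with derivative `f'`: one constant `K` bounds `f`, its
Lipschitz constant, the Lipschitz constant of `f'` and the first order Taylor remainder.
The remainder estimate stands in for differentiability, as it passes to averages of translates. -/
structure IsC11 (f : E → ℝ) (f' : E → E →L[ℝ] ℝ) (K : ℝ) : Prop where
  bound : ∀ x, |f x| ≤ K
  lip : ∀ x y, |f y - f x| ≤ K * ‖y - x‖
  deriv_bound : ∀ x, ‖f' x‖ ≤ K
  deriv_lip : ∀ x y, ‖f' y - f' x‖ ≤ K * ‖y - x‖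
  taylor : ∀ x h, |f (x + h) - f x - f' x h| ≤ K * ‖h‖ ^ 2

namespace IsC11

variable {f : E → ℝ} {f' : E → E →L[ℝ] ℝ} {K : ℝ}

theorem nonneg (h : IsC11 f f' K) : 0 ≤ K := (abs_nonneg _).trans (h.bound 0)

theorem mono (h : IsC11 f f' K) {K' : ℝ} (hK : K ≤ K') : IsC11 f f' K' where
  bound x := (h.bound x).trans hK
  lip x y := (h.lip x y).trans (by gcongr)
  deriv_bound x := (h.deriv_bound x).trans hK
  deriv_lip x y := (h.deriv_lip x y).trans (by gcongr)
  taylor x k := (h.taylor x k).trans (by gcongr)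

theorem continuous (h : IsC11 f f' K) : Continuous f :=
  (LipschitzWith.of_dist_le_mul (K := ⟨K, h.nonneg⟩) fun x y => by
    rw [Real.dist_eq, dist_eq_norm]; exact h.lip y x).continuous

theorem continuous_deriv (h : IsC11 f f' K) : Continuous f' :=
  (LipschitzWith.of_dist_le_mul (K := ⟨K, h.nonneg⟩) fun x y => by
    rw [dist_eq_norm, dist_eq_norm]; exact h.deriv_lip y x).continuous

theorem comp_clm {g : F → ℝ} {g' : F → F →L[ℝ] ℝ} (h : IsC11 g g' K) (A : E →L[ℝ] F) :
    IsC11 (fun x => g (A x)) (fun x => (g' (A x)).comp A) (K * (1 + ‖A‖) ^ 2) := by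
  have hK := h.nonneg
  have hA := norm_nonneg A
  have h1 : K ≤ K * (1 + ‖A‖) ^ 2 := by nlinarith [mul_nonneg hK hA, mul_nonneg hK (sq_nonneg ‖A‖)]
  have h2 : K * ‖A‖ ≤ K * (1 + ‖A‖) ^ 2 := by
    nlinarith [mul_nonneg hK hA, mul_nonneg hK (sq_nonneg ‖A‖)]
  have h3 : K * ‖A‖ ^ 2 ≤ K * (1 + ‖A‖) ^ 2 := by
    nlinarith [mul_nonneg hK hA, mul_nonneg hK (sq_nonneg ‖A‖)]
  refine ⟨fun x => (h.bound _).trans h1, fun x y => ?_, fun x => ?_, fun x y => ?_, fun x k => ?_⟩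
  · refine (h.lip _ _).trans ?_
    rw [← map_sub]
    calc K * ‖A (y - x)‖ ≤ K * (‖A‖ * ‖y - x‖) := by gcongr; exact A.le_opNorm _
      _ = K * ‖A‖ * ‖y - x‖ := by ring
      _ ≤ _ := by gcongr
  · refine (ContinuousLinearMap.opNorm_comp_le _ _).trans (le_trans ?_ h2)
    gcongr
    exact h.deriv_bound _
  · rw [← ContinuousLinearMap.sub_comp]
    refine (ContinuousLinearMap.opNorm_comp_le _ _).trans ?_
    calc _ ≤ K * ‖A y - A x‖ * ‖A‖ := by gcongr; exact h.deriv_lip _ _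
      _ ≤ K * (‖A‖ * ‖y - x‖) * ‖A‖ := by rw [← map_sub]; gcongr; exact A.le_opNorm _
      _ = K * ‖A‖ ^ 2 * ‖y - x‖ := by ring
      _ ≤ _ := by gcongr
  · rw [map_add]
    refine (h.taylor _ _).trans ?_
    calc K * ‖A k‖ ^ 2 ≤ K * (‖A‖ * ‖k‖) ^ 2 := by gcongr; exact A.le_opNorm _
      _ = K * ‖A‖ ^ 2 * ‖k‖ ^ 2 := by ring
      _ ≤ _ := by gcongr

/-- Powers stay in the class because `f` takes values in the compact interval `[ε, K]` of
`(0, ∞)`, on which `z ↦ z ^ r` is smooth. -/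
theorem rpow (h : IsC11 f f' K) {ε : ℝ} (hε : 0 < ε) (hf : ∀ x, ε ≤ f x) (r : ℝ) :
    ∃ g' K', IsC11 (fun x => f x ^ r) g' K' := by
  have hK := h.nonneg
  have hmem : ∀ x, f x ∈ Set.Icc ε K := fun x => ⟨hf x, (le_abs_self _).trans (h.bound x)⟩
  obtain ⟨M0, hM0, hb0⟩ := exists_rpow_bound r (b := K) hε
  obtain ⟨M1, hM1, hb1⟩ := exists_rpow_bound (r - 1) (b := K) hε
  obtain ⟨L, hL, hlip⟩ := exists_rpow_lipschitz r (r - 1) (b := K) hε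
  set M := M0 + |r| * M1 + L with hM
  have hM' : 0 ≤ M := by positivity
  have hLM : L ≤ M := by have : 0 ≤ |r| * M1 := by positivity
                         linarith
  have hφ1 : ∀ z ∈ Set.Icc ε K, |r * z ^ (r - 1)| ≤ M := fun z hz => by
    rw [abs_mul]
    have := mul_le_mul_of_nonneg_left (hb1 z hz) (abs_nonneg r)
    linarith
  have hd : ∀ z ∈ Set.Icc ε K, HasDerivAt (fun z : ℝ => z ^ r) (r * z ^ (r - 1)) z :=
    fun z hz => by simpa using hasDerivAt_const_mul_rpow 1 r hε hz
  have hd0 : ∀ x y, |f y ^ r - f x ^ r| ≤ M * |f y - f x| := fun x y =>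
    abs_sub_le_of_deriv_le hd hφ1 (hmem x) (hmem y)
  have hd1 : ∀ x y, |r * f y ^ (r - 1) - r * f x ^ (r - 1)| ≤ M * |f y - f x| := fun x y =>
    (hlip _ (hmem x) _ (hmem y)).trans (by gcongr)
  have hd2 : ∀ x y, |f y ^ r - f x ^ r - r * f x ^ (r - 1) * (f y - f x)| ≤
      M * |f y - f x| ^ 2 := fun x y =>
    (abs_taylor_one_le hd hlip (hmem x) (hmem y)).trans (by gcongr)
  have hA : M ≤ M * (1 + K) ^ 2 := by nlinarith [mul_nonneg hM' hK, mul_nonneg hM' (sq_nonneg K)]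
  have hB : M * K ≤ M * (1 + K) ^ 2 := by
    nlinarith [mul_nonneg hM' hK, mul_nonneg hM' (sq_nonneg K)]
  have hD : M * K + M * K ^ 2 ≤ M * (1 + K) ^ 2 := by
    nlinarith [mul_nonneg hM' hK, mul_nonneg hM' (sq_nonneg K)]
  refine ⟨fun x => (r * f x ^ (r - 1)) • f' x, M * (1 + K) ^ 2, fun x => ?_, fun x y => ?_,
    fun x => ?_, fun x y => ?_, fun x k => ?_⟩
  · refine (hb0 _ (hmem x)).trans (le_trans ?_ hA)
    have : 0 ≤ |r| * M1 := by positivity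
    linarith
  · calc _ ≤ M * |f y - f x| := hd0 x y
      _ ≤ M * (K * ‖y - x‖) := by gcongr; exact h.lip x y
      _ = M * K * ‖y - x‖ := by ring
      _ ≤ _ := by gcongr
  · rw [norm_smul]
    refine le_trans ?_ hB
    exact mul_le_mul (hφ1 _ (hmem x)) (h.deriv_bound x) (norm_nonneg _) hM'
  · have e : (r * f y ^ (r - 1)) • f' y - (r * f x ^ (r - 1)) • f' x =
        (r * f y ^ (r - 1)) • (f' y - f' x) + (r * f y ^ (r - 1) - r * f x ^ (r - 1)) • f' x := by
      module
    rw [e]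
    refine (norm_add_le _ _).trans ?_
    rw [norm_smul, norm_smul]
    calc _ ≤ M * (K * ‖y - x‖) + (M * (K * ‖y - x‖)) * K := by
          refine add_le_add (mul_le_mul (hφ1 _ (hmem y)) (h.deriv_lip x y) (norm_nonneg _) hM')
            (mul_le_mul ((hd1 x y).trans ?_) (h.deriv_bound x) (norm_nonneg _) (by positivity))
          gcongr
          exact h.lip x y
      _ = (M * K + M * K ^ 2) * ‖y - x‖ := by ring
      _ ≤ _ := by gcongr
  · have e : f (x + k) ^ r - f x ^ r - ((r * f x ^ (r - 1)) • f' x) k =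
        (f (x + k) ^ r - f x ^ r - r * f x ^ (r - 1) * (f (x + k) - f x)) +
          r * f x ^ (r - 1) * (f (x + k) - f x - f' x k) := by
      simp only [_root_.smul_apply, smul_eq_mul]
      ring
    rw [e]
    have hl : |f (x + k) - f x| ≤ K * ‖k‖ := by simpa using h.lip x (x + k)
    refine (abs_add_le _ _).trans ?_
    rw [abs_mul (r * f x ^ (r - 1))]
    calc _ ≤ M * (K * ‖k‖) ^ 2 + M * (K * ‖k‖ ^ 2) := by
          refine add_le_add ((hd2 x (x + k)).trans ?_)
            (mul_le_mul (hφ1 _ (hmem x)) (h.taylor x k) (abs_nonneg _) hM')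
          gcongr
      _ = (M * K + M * K ^ 2) * ‖k‖ ^ 2 := by ring
      _ ≤ _ := by gcongr

theorem norm_integral_le_of_forall {G W : Type*} [NormedAddCommGroup G] [NormedSpace ℝ G]
    [MeasurableSpace W] {ν : Measure W} [IsProbabilityMeasure ν] (u : W → G) (C : ℝ)
    (hu : ∀ w, ‖u w‖ ≤ C) : ‖∫ w, u w ∂ν‖ ≤ C := by
  simpa using norm_integral_le_of_norm_le_const (μ := ν) (Eventually.of_forall hu)

/-- The class is stable under averaging of translates, with the same constant: this keeps the
error of the one-step estimate uniform along the iteration. -/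
theorem average {W : Type*} [MeasurableSpace W] [TopologicalSpace W]
    [OpensMeasurableSpace W] [SecondCountableTopology W] {ν : Measure W} [IsProbabilityMeasure ν]
    (h : IsC11 f f' K) {A : W → E} (hA : Continuous A) :
    IsC11 (fun x => ∫ w, f (x + A w) ∂ν) (fun x => ∫ w, f' (x + A w) ∂ν) K := by
  have hK := h.nonneg
  have hi : ∀ x, Integrable (fun w => f (x + A w)) ν := fun x =>
    Integrable.of_bound (h.continuous.comp (continuous_const.add hA)).aestronglyMeasurable K
      (Eventually.of_forall fun w => h.bound _)
  have hi' : ∀ x, Integrable (fun w => f' (x + A w)) ν := fun x =>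
    Integrable.of_bound (h.continuous_deriv.comp (continuous_const.add hA)).aestronglyMeasurable K
      (Eventually.of_forall fun w => h.deriv_bound _)
  refine ⟨fun x => norm_integral_le_of_forall (fun w => f (x + A w)) K fun w => h.bound _,
    fun x y => ?_, fun x => norm_integral_le_of_forall _ _ fun w => h.deriv_bound _,
    fun x y => ?_, fun x k => ?_⟩
  · rw [← integral_sub (hi y) (hi x)]
    refine norm_integral_le_of_forall (fun w => f (y + A w) - f (x + A w)) _ fun w =>
      (h.lip _ _).trans (by rw [add_sub_add_right_eq_sub])
  · rw [← integral_sub (hi' y) (hi' x)]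
    refine norm_integral_le_of_forall _ _ fun w =>
      (h.deriv_lip _ _).trans (by rw [add_sub_add_right_eq_sub])
  · rw [ContinuousLinearMap.integral_apply (hi' x), ← integral_sub (hi _) (hi x),
      ← integral_sub (f := fun w => f (x + k + A w) - f (x + A w)) ((hi _).sub (hi x))
        ((hi' x).apply_continuousLinearMap k)]
    refine norm_integral_le_of_forall (fun w => f (x + k + A w) - f (x + A w) - f' (x + A w) k) _
      fun w => ?_
    rw [add_right_comm]
    exact h.taylor _ _

theorem add_const (h : IsC11 f f' K) (c : ℝ) : IsC11 (fun x => f x + c) f' (K + |c|) where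
  bound x := (abs_add_le _ _).trans (by gcongr; exact h.bound x)
  lip x y := by simpa using (h.mono (le_add_of_nonneg_right (abs_nonneg c))).lip x y
  deriv_bound x := (h.mono (le_add_of_nonneg_right (abs_nonneg c))).deriv_bound x
  deriv_lip x y := (h.mono (le_add_of_nonneg_right (abs_nonneg c))).deriv_lip x y
  taylor x k := by simpa using (h.mono (le_add_of_nonneg_right (abs_nonneg c))).taylor x k

theorem exists_norm_bound {G H : Type*} [NormedAddCommGroup G] [NormedAddCommGroup H] {u : G → H}
    (hu : Continuous u) (hs : HasCompactSupport u) : ∃ C, ∀ x, ‖u x‖ ≤ C :=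
  hs.exists_bound_of_continuous hu

theorem of_fderiv_bound {g : F → ℝ} {K : ℝ} (hd : Differentiable ℝ g)
    (hd1 : Differentiable ℝ (fderiv ℝ g)) (h0 : ∀ x, ‖g x‖ ≤ K) (h1 : ∀ x, ‖fderiv ℝ g x‖ ≤ K)
    (h2 : ∀ x, ‖fderiv ℝ (fderiv ℝ g) x‖ ≤ K) : IsC11 g (fderiv ℝ g) K := by
  have hlip : ∀ x y, ‖fderiv ℝ g y - fderiv ℝ g x‖ ≤ K * ‖y - x‖ := fun x y =>
    Convex.norm_image_sub_le_of_norm_hasFDerivWithin_le (f := fderiv ℝ g)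
      (f' := fderiv ℝ (fderiv ℝ g)) (s := Set.univ)
      (fun z _ => (hd1 z).hasFDerivAt.hasFDerivWithinAt)
      (fun z _ => h2 z) convex_univ (Set.mem_univ x) (Set.mem_univ y)
  have hKn : 0 ≤ K := (norm_nonneg _).trans (h0 0)
  refine ⟨h0, fun x y => ?_, h1, hlip, fun x k => ?_⟩
  · exact Convex.norm_image_sub_le_of_norm_hasFDerivWithin_le (f := g)
      (f' := fderiv ℝ g) (s := Set.univ)
      (fun z _ => (hd z).hasFDerivAt.hasFDerivWithinAt)
      (fun z _ => h1 z) convex_univ (Set.mem_univ x) (Set.mem_univ y)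
  · have := Convex.norm_image_sub_le_of_norm_hasFDerivWithin_le' (f := g) (f' := fderiv ℝ g)
      (φ := fderiv ℝ g x) (C := K * ‖k‖) (s := segment ℝ x (x + k))
      (fun z _ => (hd z).hasFDerivAt.hasFDerivWithinAt) (fun z hz => (hlip x z).trans ?_)
      (convex_segment x (x + k)) (left_mem_segment ℝ x (x + k)) (right_mem_segment ℝ x (x + k))
    · simpa [pow_two, mul_assoc] using this
    · gcongr
      have := norm_sub_le_of_mem_segment hz
      simpa using this

theorem exists_fderiv_fderiv_bound {g : F → ℝ} (hg1 : ContDiff ℝ 1 (fderiv ℝ g))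
    (hs : HasCompactSupport (fderiv ℝ (fderiv ℝ g))) :
    ∃ K, ∀ x, ‖fderiv ℝ (fderiv ℝ g) x‖ ≤ K := by
  have hc := hg1.continuous_fderiv one_ne_zero
  exact exists_norm_bound hc hs

/-- Compactly supported `C^2` functions belong to the class. -/
theorem of_contDiff_of_hasCompactSupport {g : F → ℝ} (hg : ContDiff ℝ 2 g)
    (hs : HasCompactSupport g) : ∃ K, IsC11 g (fderiv ℝ g) K := by
  have hg1 : ContDiff ℝ 1 (fderiv ℝ g) := hg.fderiv_right (by norm_num)
  have hs1 : HasCompactSupport (fderiv ℝ g) := hs.fderiv (𝕜 := ℝ)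
  have hs2 : HasCompactSupport (fderiv ℝ (fderiv ℝ g)) := hs1.fderiv (𝕜 := ℝ)
  obtain ⟨K0, hK0⟩ := exists_norm_bound hg.continuous hs
  obtain ⟨K1, hK1⟩ := exists_norm_bound hg1.continuous hs1
  have hK2 := exists_fderiv_fderiv_bound hg1 hs2
  exact ⟨max K0 (max K1 hK2.choose), of_fderiv_bound (hg.differentiable (by norm_num))
    (hg1.differentiable (by norm_num)) (fun x => (hK0 x).trans (le_max_left _ _))
    (fun x => (hK1 x).trans ((le_max_left _ _).trans (le_max_right _ _)))
    (fun x => (hK2.choose_spec x).trans ((le_max_right _ _).trans (le_max_right _ _)))⟩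

end IsC11

end COneOne

/-! ### Correlated Gaussian pairs: a Hölder inequality beyond duality -/

section Hyper

open ProbabilityTheory

theorem abs_mul_sub_mul_le {p q A B c h n : ℝ} (hh0 : 0 ≤ h) (hh1 : h ≤ 1) (hc : 0 ≤ c) (hn : 0 ≤ n)
    (hp : |p| ≤ c * h * n) (hB : |q| ≤ c * h * n) (hA : |A - p| ≤ c * h ^ 2 * n)
    (hBq : |B - q| ≤ c * h ^ 2 * n) : |A * B - p * q| ≤ 3 * c ^ 2 * h ^ 3 * n ^ 2 := by
  have e : A * B - p * q = (A - p) * (B - q) + (A - p) * q + p * (B - q) := by ring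
  have h43 : h ^ 4 ≤ h ^ 3 := pow_le_pow_of_le_one hh0 hh1 (by norm_num)
  rw [e]
  calc _ ≤ |A - p| * |B - q| + |A - p| * |q| + |p| * |B - q| := by
        refine (abs_add_le _ _).trans ?_
        rw [← abs_mul, ← abs_mul, ← abs_mul]
        gcongr
        exact abs_add_le _ _
    _ ≤ (c * h ^ 2 * n) * (c * h ^ 2 * n) + (c * h ^ 2 * n) * (c * h * n) +
        (c * h * n) * (c * h ^ 2 * n) := by gcongr
    _ = c ^ 2 * n ^ 2 * h ^ 4 + 2 * c ^ 2 * h ^ 3 * n ^ 2 := by ring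
    _ ≤ c ^ 2 * n ^ 2 * h ^ 3 + 2 * c ^ 2 * h ^ 3 * n ^ 2 := by gcongr
    _ = _ := by ring

theorem abs_taylor_mul_sub_le (a b p q : ℝ) {s t k : ℝ} (hs : |s| ≤ k) :
    |(1 + a * s - p * s ^ 2) * (1 + b * t - q * t ^ 2) -
      (1 + a * s + b * t + (a * b * (s * t) - p * s ^ 2 - q * t ^ 2))| ≤
        (|a| * |q| + |b| * |p| + |p| * |q| * k) * (|s| + |t|) ^ 3 := by
  have hs0 : 0 ≤ |s| := abs_nonneg _
  have hk0 : 0 ≤ k := hs0.trans hs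
  have ht0 : 0 ≤ |t| := abs_nonneg _
  have h1 : |s| * |t| ^ 2 ≤ (|s| + |t|) ^ 3 := by
    calc _ ≤ (|s| + |t|) * (|s| + |t|) ^ 2 := by gcongr <;> linarith
      _ = _ := by ring
  have h2 : |s| ^ 2 * |t| ≤ (|s| + |t|) ^ 3 := by
    calc _ ≤ (|s| + |t|) ^ 2 * (|s| + |t|) := by gcongr <;> linarith
      _ = _ := by ring
  have e : (1 + a * s - p * s ^ 2) * (1 + b * t - q * t ^ 2) -
      (1 + a * s + b * t + (a * b * (s * t) - p * s ^ 2 - q * t ^ 2)) =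
        -(a * q * (s * t ^ 2)) + -(b * p * (s ^ 2 * t)) + p * q * (s * (s * t ^ 2)) := by ring
  rw [e]
  calc _ ≤ |a * q * (s * t ^ 2)| + |b * p * (s ^ 2 * t)| + |p * q * (s * (s * t ^ 2))| := by
        refine (abs_add_le _ _).trans ?_
        gcongr
        refine (abs_add_le _ _).trans ?_
        rw [abs_neg, abs_neg]
    _ = |a| * |q| * (|s| * |t| ^ 2) + |b| * |p| * (|s| ^ 2 * |t|) +
          |p| * |q| * (|s| * (|s| * |t| ^ 2)) := by
        simp only [abs_mul, abs_pow]
    _ ≤ |a| * |q| * (|s| + |t|) ^ 3 + |b| * |p| * (|s| + |t|) ^ 3 +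
          |p| * |q| * (k * (|s| + |t|) ^ 3) := by gcongr
    _ = _ := by ring

theorem mul_le_of_abs_sub_le {X Y P R S T Q L1 L2 L3 M1 M2 w : ℝ} (h1 : |X - P * S| ≤ L1 * w)
    (h2 : |Y - R * T| ≤ L2 * w) (h3 : |S * T - Q| ≤ L3 * w) (hY : 0 ≤ Y) (hYM : Y ≤ M2)
    (hPS : |P * S| ≤ M1) {M3 : ℝ} (hPR : 0 ≤ P * R) (hPRM : P * R ≤ M3) :
    X * Y ≤ P * R * Q + (L1 * M2 + L2 * M1 + M3 * L3) * w := by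
  have f1 : X * Y - P * S * Y ≤ L1 * w * M2 := by
    calc _ = (X - P * S) * Y := by ring
      _ ≤ (L1 * w) * M2 :=
        mul_le_mul ((le_abs_self _).trans h1) hYM hY ((abs_nonneg _).trans h1)
  have f2 : P * S * Y - P * S * (R * T) ≤ M1 * (L2 * w) := by
    calc _ = P * S * (Y - R * T) := by ring
      _ ≤ |P * S| * |Y - R * T| := by rw [← abs_mul]; exact le_abs_self _
      _ ≤ M1 * (L2 * w) :=
        mul_le_mul hPS h2 (abs_nonneg _) ((abs_nonneg _).trans hPS)
  have f3 : P * R * (S * T - Q) ≤ M3 * (L3 * w) := by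
    calc _ ≤ P * R * (L3 * w) := mul_le_mul_of_nonneg_left ((le_abs_self _).trans h3) hPR
      _ ≤ M3 * (L3 * w) := mul_le_mul_of_nonneg_right hPRM ((abs_nonneg _).trans h3)
  linear_combination f1 + f2 + f3

/-- Second order Taylor estimate of `u ^ a * v ^ b`, in relative increments. -/
theorem exists_rpow_mul_rpow_le (a b : ℝ) {ε K : ℝ} (hε : 0 < ε) :
    ∃ M, 0 ≤ M ∧ ∀ u ∈ Set.Icc ε K, ∀ v ∈ Set.Icc ε K, ∀ u' ∈ Set.Icc ε K, ∀ v' ∈ Set.Icc ε K,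
      u' ^ a * v' ^ b ≤ u ^ a * v ^ b * (1 + a * ((u' - u) / u) + b * ((v' - v) / v) +
        (a * b * (((u' - u) / u) * ((v' - v) / v)) - a * (1 - a) / 2 * ((u' - u) / u) ^ 2
          - b * (1 - b) / 2 * ((v' - v) / v) ^ 2)) + M * (|u' - u| + |v' - v|) ^ 3 := by
  obtain ⟨L1, hL1, hT1⟩ := exists_rpow_taylor a (b := K) hε
  obtain ⟨L2, hL2, hT2⟩ := exists_rpow_taylor b (b := K) hε
  obtain ⟨M1, hM1, hB1⟩ := exists_rpow_bound a (b := K) hε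
  obtain ⟨M2, hM2, hB2⟩ := exists_rpow_bound b (b := K) hε
  obtain ⟨p, hp⟩ : ∃ p, p = a * (1 - a) / 2 := ⟨_, rfl⟩
  obtain ⟨q, hq⟩ : ∃ q, q = b * (1 - b) / 2 := ⟨_, rfl⟩
  obtain ⟨k, hk⟩ : ∃ k, k = |K| / ε := ⟨_, rfl⟩
  have hk0 : 0 ≤ k := by rw [hk]; positivity
  obtain ⟨D, hD⟩ : ∃ D, D = (|a| * |q| + |b| * |p| + |p| * |q| * k) / ε ^ 3 := ⟨_, rfl⟩
  have hD0 : 0 ≤ D := by rw [hD]; positivity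
  refine ⟨L1 * M2 + L2 * (M1 * (1 + |a| * k + |p| * k ^ 2)) + M1 * M2 * D, by positivity,
    fun u hu v hv u' hu' v' hv' => ?_⟩
  rw [← hp, ← hq]
  have hu0 : 0 < u := hε.trans_le hu.1
  have hv0 : 0 < v := hε.trans_le hv.1
  have hsx : |(u' - u) / u| ≤ |u' - u| / ε := by
    rw [abs_div, abs_of_pos hu0]
    gcongr; exact hu.1
  have hty : |(v' - v) / v| ≤ |v' - v| / ε := by
    rw [abs_div, abs_of_pos hv0]
    gcongr; exact hv.1
  have hsk : |(u' - u) / u| ≤ k := hsx.trans (by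
    rw [hk]
    have : |u' - u| ≤ K := abs_le.2
      ⟨by linarith [hu.1, hu.2, hu'.1, hu'.2], by linarith [hu.1, hu.2, hu'.1, hu'.2]⟩
    exact div_le_div_of_nonneg_right (this.trans (le_abs_self K)) hε.le)
  have h1 := hT1 u hu u' hu'
  have h2 := hT2 v hv v' hv'
  rw [← hp] at h1
  rw [← hq] at h2
  generalize (u' - u) / u = s at *
  generalize (v' - v) / v = t at *
  have hPM : u ^ a ≤ M1 := (le_abs_self _).trans (hB1 u hu)
  have hx3 : |u' - u| ^ 3 ≤ (|u' - u| + |v' - v|) ^ 3 := by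
    gcongr; linarith [abs_nonneg (v' - v)]
  have hy3 : |v' - v| ^ 3 ≤ (|u' - u| + |v' - v|) ^ 3 := by
    gcongr; linarith [abs_nonneg (u' - u)]
  refine mul_le_of_abs_sub_le (h1.trans (by gcongr)) (h2.trans (by gcongr))
    ((abs_taylor_mul_sub_le a b p q hsk).trans ?_) (Real.rpow_nonneg (hε.le.trans hv'.1) _)
    ((le_abs_self _).trans (hB2 v' hv')) ?_ (by positivity)
    (mul_le_mul hPM ((le_abs_self _).trans (hB2 v hv)) (by positivity) hM1)
  · calc _ ≤ (|a| * |q| + |b| * |p| + |p| * |q| * k) * (|u' - u| / ε + |v' - v| / ε) ^ 3 := by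
          gcongr
      _ = D * (|u' - u| + |v' - v|) ^ 3 := by rw [hD]; field_simp
  · rw [abs_mul, abs_of_nonneg (by positivity : 0 ≤ u ^ a)]
    refine mul_le_mul hPM ?_ (abs_nonneg _) hM1
    calc |1 + a * s - p * s ^ 2| ≤ |1 + a * s| + |p * s ^ 2| := abs_sub _ _
      _ ≤ (|1| + |a * s|) + |p * s ^ 2| := by gcongr; exact abs_add_le _ _
      _ = 1 + |a| * |s| + |p| * |s| ^ 2 := by rw [abs_one, abs_mul, abs_mul, abs_pow]
      _ ≤ _ := by gcongr

variable {W E F : Type*} [NormedAddCommGroup W] [NormedSpace ℝ W] [MeasurableSpace W]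
  [BorelSpace W] [SecondCountableTopology W] [NormedAddCommGroup E] [NormedSpace ℝ E]
  [NormedAddCommGroup F] [NormedSpace ℝ F] {ν : Measure W} [IsProbabilityMeasure ν]

omit [NormedSpace ℝ W] [SecondCountableTopology W] in
theorem IsC11.integrable_comp {f : E → ℝ} {f' : E → E →L[ℝ] ℝ} {K : ℝ} (hf : IsC11 f f' K)
    {A : W → E} (hA : Continuous A) : Integrable (fun w => f (A w)) ν :=
  Integrable.of_bound (hf.continuous.comp hA).aestronglyMeasurable K
    (Eventually.of_forall fun _ => hf.bound _)

/-- A centred increment `f (x + h X) - 𝔼 f (x + h X)` equals `h f'(x) X` up to order `h²`. -/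
theorem IsC11.abs_increment_sub_le {f : E → ℝ} {f' : E → E →L[ℝ] ℝ} {K : ℝ} (hf : IsC11 f f' K)
    (hmom : ∀ n : ℕ, Integrable (fun w => (1 + ‖w‖) ^ n) ν)
    (hmean : ∀ L : W →L[ℝ] ℝ, ∫ w, L w ∂ν = 0) (X : W →L[ℝ] E) (x : E) (h : ℝ) (w : W) :
    |f (x + h • X w) - ∫ w, f (x + h • X w) ∂ν - h * f' x (X w)| ≤
      K * (1 + ‖X‖) ^ 2 * (1 + ∫ w, (1 + ‖w‖) ^ 2 ∂ν) * h ^ 2 * (1 + ‖w‖) ^ 2 := by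
  have hK := hf.nonneg
  have hX := norm_nonneg X
  have hR : ∀ w, |f (x + h • X w) - f x - h * f' x (X w)| ≤
      K * (1 + ‖X‖) ^ 2 * h ^ 2 * (1 + ‖w‖) ^ 2 := fun w => by
    have h1 := hf.taylor x (h • X w)
    rw [map_smul, smul_eq_mul, norm_smul, mul_pow, Real.norm_eq_abs, sq_abs] at h1
    refine h1.trans ?_
    calc K * (h ^ 2 * ‖X w‖ ^ 2) ≤ K * (h ^ 2 * ((1 + ‖X‖) * (1 + ‖w‖)) ^ 2) := by
          gcongr
          refine (X.le_opNorm w).trans ?_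
          gcongr <;> linarith
      _ = _ := by ring
  have hcont : Continuous fun w => x + h • X w := by fun_prop
  have hi : Integrable (fun w => f (x + h • X w)) ν := hf.integrable_comp hcont
  have hiL : Integrable (fun w => h * f' x (X w)) ν := by
    refine Integrable.mono' ((hmom 1).const_mul (|h| * (‖f' x‖ * ‖X‖)))
      (by fun_prop) (Eventually.of_forall fun w => ?_)
    rw [norm_mul, Real.norm_eq_abs, mul_assoc, pow_one]
    gcongr
    calc ‖f' x (X w)‖ ≤ ‖f' x‖ * (‖X‖ * ‖w‖) :=
          (ContinuousLinearMap.le_opNorm _ _).trans (by gcongr; exact X.le_opNorm w)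
      _ ≤ ‖f' x‖ * ‖X‖ * (1 + ‖w‖) := by rw [mul_assoc]; gcongr; linarith
  have hL0 : ∫ w, h * f' x (X w) ∂ν = 0 := by
    rw [integral_const_mul, show ∫ w, f' x (X w) ∂ν = 0 from hmean ((f' x).comp X), mul_zero]
  have hu : ∫ w, f (x + h • X w) ∂ν - f x = ∫ w, (f (x + h • X w) - f x - h * f' x (X w)) ∂ν := by
    rw [integral_sub (f := fun w => f (x + h • X w) - f x) (hi.sub (integrable_const _)) hiL, hL0,
      integral_sub hi (integrable_const _)]
    simp
  have hub : |∫ w, f (x + h • X w) ∂ν - f x| ≤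
      K * (1 + ‖X‖) ^ 2 * h ^ 2 * ∫ w, (1 + ‖w‖) ^ 2 ∂ν := by
    rw [hu, ← integral_const_mul]
    exact norm_integral_le_of_norm_le (f := fun w => f (x + h • X w) - f x - h * f' x (X w))
      ((hmom 2).const_mul _) (Eventually.of_forall hR)
  have hm : 0 ≤ ∫ w, (1 + ‖w‖) ^ 2 ∂ν := integral_nonneg fun w => by positivity
  have hn : 1 ≤ (1 + ‖w‖) ^ 2 := one_le_pow₀ (by linarith [norm_nonneg w])
  generalize (∫ w, (1 + ‖w‖) ^ 2 ∂ν) = m at *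
  calc _ = |(f (x + h • X w) - f x - h * f' x (X w)) - (∫ w, f (x + h • X w) ∂ν - f x)| := by
        congr 1; ring
    _ ≤ K * (1 + ‖X‖) ^ 2 * h ^ 2 * (1 + ‖w‖) ^ 2 + K * (1 + ‖X‖) ^ 2 * h ^ 2 * m :=
        (abs_sub _ _).trans (add_le_add (hR w) hub)
    _ ≤ K * (1 + ‖X‖) ^ 2 * h ^ 2 * (1 + ‖w‖) ^ 2 +
        K * (1 + ‖X‖) ^ 2 * h ^ 2 * (m * (1 + ‖w‖) ^ 2) := by
        gcongr
        exact le_mul_of_one_le_right hm hn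
    _ = _ := by ring

/-- The quadratic form `Q(s,t)` changes by `O(h³)` when `s, t = O(h)` are perturbed by `O(h²)`. -/
theorem quad_le_of_abs_sub_le (k p q : ℝ) {s t s' t' c h n : ℝ} (hh0 : 0 ≤ h) (hh1 : h ≤ 1)
    (hc : 0 ≤ c) (hn : 0 ≤ n) (hs' : |s'| ≤ c * h * n) (ht' : |t'| ≤ c * h * n)
    (hs : |s - s'| ≤ c * h ^ 2 * n) (ht : |t - t'| ≤ c * h ^ 2 * n) :
    k * (s * t) - p * s ^ 2 - q * t ^ 2 ≤ k * (s' * t') - p * s' ^ 2 - q * t' ^ 2 +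
      (|k| + |p| + |q|) * (3 * c ^ 2 * h ^ 3 * n ^ 2) := by
  have h1 := abs_mul_sub_mul_le hh0 hh1 hc hn hs' ht' hs ht
  have h2 := abs_mul_sub_mul_le hh0 hh1 hc hn hs' hs' hs hs
  have h3 := abs_mul_sub_mul_le hh0 hh1 hc hn ht' ht' ht ht
  generalize 3 * c ^ 2 * h ^ 3 * n ^ 2 = e at *
  have g1 : k * (s * t - s' * t') ≤ |k| * e :=
    (le_abs_self _).trans (by rw [abs_mul]; gcongr)
  have g2 : -(p * (s * s - s' * s')) ≤ |p| * e :=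
    (neg_le_abs _).trans (by rw [abs_mul]; gcongr)
  have g3 : -(q * (t * t - t' * t')) ≤ |q| * e :=
    (neg_le_abs _).trans (by rw [abs_mul]; gcongr)
  linear_combination g1 + g2 + g3

/-- One centred step of size `h`: the integral of `f ^ a * g ^ b` exceeds the product of the
powers of the averages only by `O(h³)`, uniformly in the class, as the second order term is
nonpositive by the correlation hypothesis `hab`. -/
theorem exists_one_step_le (hmom : ∀ n : ℕ, Integrable (fun w => (1 + ‖w‖) ^ n) ν)
    (hmean : ∀ L : W →L[ℝ] ℝ, ∫ w, L w ∂ν = 0) (X : W →L[ℝ] E) (Y : W →L[ℝ] F) (a b : ℝ)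
    (hab : ∀ (L : E →L[ℝ] ℝ) (M : F →L[ℝ] ℝ), ∫ w, (a * b * (L (X w) * M (Y w)) -
      a * (1 - a) / 2 * L (X w) ^ 2 - b * (1 - b) / 2 * M (Y w) ^ 2) ∂ν ≤ 0)
    {ε : ℝ} (hε : 0 < ε) (K : ℝ) :
    ∃ D, 0 ≤ D ∧ ∀ (f : E → ℝ) (f' : E → E →L[ℝ] ℝ) (g : F → ℝ) (g' : F → F →L[ℝ] ℝ),
      IsC11 f f' K → (∀ x, ε ≤ f x) → IsC11 g g' K → (∀ x, ε ≤ g x) →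
      ∀ h : ℝ, 0 ≤ h → h ≤ 1 → ∀ (x : E) (y : F),
        ∫ w, f (x + h • X w) ^ a * g (y + h • Y w) ^ b ∂ν ≤
          (∫ w, f (x + h • X w) ∂ν) ^ a * (∫ w, g (y + h • Y w) ∂ν) ^ b + D * h ^ 3 := by
  obtain ⟨M, hM0, hM⟩ := exists_rpow_mul_rpow_le a b (K := K) hε
  obtain ⟨M1, hM1, hB1⟩ := exists_rpow_bound a (b := K) hε
  obtain ⟨M2, hM2, hB2⟩ := exists_rpow_bound b (b := K) hε
  obtain ⟨S, hS⟩ : ∃ S, S = 1 + ‖X‖ + ‖Y‖ := ⟨_, rfl⟩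
  obtain ⟨c, hc⟩ : ∃ c, c = |K| * S ^ 2 * (1 + ∫ w, (1 + ‖w‖) ^ 2 ∂ν) := ⟨_, rfl⟩
  have hm : 0 ≤ ∫ w, (1 + ‖w‖) ^ 2 ∂ν := integral_nonneg fun w => by positivity
  have hX := norm_nonneg X
  have hY := norm_nonneg Y
  have hSX : 1 + ‖X‖ ≤ S := by linarith
  have hSY : 1 + ‖Y‖ ≤ S := by linarith
  have hS1 : 1 ≤ S := by linarith
  have hc0 : 0 ≤ c := by rw [hc]; positivity
  obtain ⟨D, hD⟩ : ∃ D, D = M1 * M2 * ((|a * b| + |a * (1 - a) / 2| + |b * (1 - b) / 2|) *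
    (3 * (c / ε) ^ 2)) + M * (4 * c) ^ 3 := ⟨_, rfl⟩
  have hD0 : 0 ≤ D := by rw [hD]; positivity
  refine ⟨D * ∫ w, (1 + ‖w‖) ^ 6 ∂ν, mul_nonneg hD0 (integral_nonneg fun w => by positivity),
    fun f f' g g' hf hfε hg hgε h hh0 hh1 x y => ?_⟩
  have hK := hf.nonneg
  rw [abs_of_nonneg hK] at hc
  have hXc : Continuous fun w => x + h • X w := by fun_prop
  have hYc : Continuous fun w => y + h • Y w := by fun_prop
  have hfi : Integrable (fun w => f (x + h • X w)) ν := hf.integrable_comp hXc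
  have hgi : Integrable (fun w => g (y + h • Y w)) ν := hg.integrable_comp hYc
  have hA : ∀ w, |f (x + h • X w) - ∫ w, f (x + h • X w) ∂ν - h * f' x (X w)| ≤
      c * h ^ 2 * (1 + ‖w‖) ^ 2 := fun w => by
    refine (hf.abs_increment_sub_le hmom hmean X x h w).trans ?_
    rw [hc]; gcongr
  have hB : ∀ w, |g (y + h • Y w) - ∫ w, g (y + h • Y w) ∂ν - h * g' y (Y w)| ≤
      c * h ^ 2 * (1 + ‖w‖) ^ 2 := fun w => by
    refine (hg.abs_increment_sub_le hmom hmean Y y h w).trans ?_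
    rw [hc]; gcongr
  have hlin : ∀ (Z w : ℝ), Z ≤ S → 0 ≤ w → K * (Z * w) ≤ c * (1 + w) ^ 2 :=
    fun Z w hZ hw => by
      rw [hc]
      calc K * (Z * w) ≤ K * (S * (1 + w)) := by gcongr; linarith
        _ = K * S ^ 1 * 1 * (1 + w) ^ 1 := by ring
        _ ≤ _ := by gcongr <;> linarith
  have hp : ∀ w, |h * f' x (X w)| ≤ c * h * (1 + ‖w‖) ^ 2 := fun w => by
    rw [abs_mul, abs_of_nonneg hh0]
    calc h * |f' x (X w)| ≤ h * (K * (‖X‖ * ‖w‖)) := by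
          gcongr
          exact (ContinuousLinearMap.le_opNorm _ _).trans
            (mul_le_mul (hf.deriv_bound x) (X.le_opNorm w) (norm_nonneg _) hK)
      _ ≤ h * (c * (1 + ‖w‖) ^ 2) :=
        mul_le_mul_of_nonneg_left (hlin _ _ (by linarith) (norm_nonneg w)) hh0
      _ = _ := by ring
  have hq : ∀ w, |h * g' y (Y w)| ≤ c * h * (1 + ‖w‖) ^ 2 := fun w => by
    rw [abs_mul, abs_of_nonneg hh0]
    calc h * |g' y (Y w)| ≤ h * (K * (‖Y‖ * ‖w‖)) := by
          gcongr
          exact (ContinuousLinearMap.le_opNorm _ _).trans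
            (mul_le_mul (hg.deriv_bound y) (Y.le_opNorm w) (norm_nonneg _) hK)
      _ ≤ h * (c * (1 + ‖w‖) ^ 2) :=
        mul_le_mul_of_nonneg_left (hlin _ _ (by linarith) (norm_nonneg w)) hh0
      _ = _ := by ring
  have hfmem : ∀ z, f z ∈ Set.Icc ε K := fun z => ⟨hfε z, (le_abs_self _).trans (hf.bound z)⟩
  have hgmem : ∀ z, g z ∈ Set.Icc ε K := fun z => ⟨hgε z, (le_abs_self _).trans (hg.bound z)⟩
  have hmean_mem : ∀ {φ : W → ℝ}, Integrable φ ν → (∀ w, φ w ∈ Set.Icc ε K) →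
      ∫ w, φ w ∂ν ∈ Set.Icc ε K := fun {φ} hφ hm => by
    constructor
    · simpa using integral_mono (μ := ν) (integrable_const ε) hφ fun w => (hm w).1
    · simpa using integral_mono (μ := ν) hφ (integrable_const K) fun w => (hm w).2
  have hu := hmean_mem hfi fun w => hfmem _
  have hv := hmean_mem hgi fun w => hgmem _
  obtain ⟨u, hudef⟩ : ∃ u, u = ∫ w, f (x + h • X w) ∂ν := ⟨_, rfl⟩
  obtain ⟨v, hvdef⟩ : ∃ v, v = ∫ w, g (y + h • Y w) ∂ν := ⟨_, rfl⟩
  rw [← hudef] at hu hA ⊢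
  rw [← hvdef] at hv hB ⊢
  have hu0 : 0 < u := hε.trans_le hu.1
  have hv0 : 0 < v := hε.trans_le hv.1
  -- the second order term in the relative increments, whose mean is nonpositive by `hab` applied to
  -- the functionals `f' x / u` and `g' y / v`
  set Q : W → ℝ := fun w => a * b * ((u⁻¹ • f' x) (X w) * (v⁻¹ • g' y) (Y w)) -
      a * (1 - a) / 2 * ((u⁻¹ • f' x) (X w)) ^ 2 - b * (1 - b) / 2 * ((v⁻¹ • g' y) (Y w)) ^ 2
    with hQ
  have hQint : Integrable Q ν := by
    have hL : ∀ (L1 L2 : W →L[ℝ] ℝ), Integrable (fun w => L1 w * L2 w) ν := fun L1 L2 => by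
      refine Integrable.mono' ((hmom 2).const_mul (‖L1‖ * ‖L2‖)) (by fun_prop)
        (Eventually.of_forall fun w => ?_)
      rw [norm_mul]
      calc _ ≤ (‖L1‖ * ‖w‖) * (‖L2‖ * ‖w‖) := by
            gcongr <;> exact ContinuousLinearMap.le_opNorm _ _
        _ = ‖L1‖ * ‖L2‖ * ‖w‖ ^ 2 := by ring
        _ ≤ _ := by gcongr; linarith
    have e : Q = fun w => a * b * (((u⁻¹ • f' x).comp X) w * ((v⁻¹ • g' y).comp Y) w) -
      a * (1 - a) / 2 * (((u⁻¹ • f' x).comp X) w * ((u⁻¹ • f' x).comp X) w) -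
      b * (1 - b) / 2 * (((v⁻¹ • g' y).comp Y) w * ((v⁻¹ • g' y).comp Y) w) := by
      funext w; simp only [hQ, pow_two]; rfl
    rw [e]
    exact (((hL _ _).const_mul _).sub ((hL _ _).const_mul _)).sub ((hL _ _).const_mul _)
  -- the pointwise Taylor estimate; its first order terms have mean zero
  have hpt : ∀ w, f (x + h • X w) ^ a * g (y + h • Y w) ^ b ≤
      u ^ a * v ^ b * (1 + a * u⁻¹ * (f (x + h • X w) - u) + b * v⁻¹ * (g (y + h • Y w) - v) +
        h ^ 2 * Q w) + D * h ^ 3 * (1 + ‖w‖) ^ 6 := fun w => by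
    have hn : 1 ≤ (1 + ‖w‖) ^ 2 := one_le_pow₀ (by linarith [norm_nonneg w])
    have hA := hA w
    have hB := hB w
    have hp := hp w
    have hq := hq w
    have hdiv : ∀ {z u r : ℝ}, ε ≤ u → |z| ≤ c * r → |z / u| ≤ c / ε * r := fun {z u r} hεu hz => by
      rw [abs_div, abs_of_pos (hε.trans_le hεu), div_mul_eq_mul_div]
      exact div_le_div₀ ((abs_nonneg _).trans hz) hz hε hεu
    have key := hM u hu v hv _ (hfmem (x + h • X w)) _ (hgmem (y + h • Y w))
    have hQ' : h ^ 2 * Q w = a * b * ((h * f' x (X w) / u) * (h * g' y (Y w) / v)) -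
        a * (1 - a) / 2 * (h * f' x (X w) / u) ^ 2 -
        b * (1 - b) / 2 * (h * g' y (Y w) / v) ^ 2 := by
      simp only [hQ, _root_.smul_apply, smul_eq_mul]
      field_simp
    have e6 : (1 + ‖w‖) ^ 6 = ((1 + ‖w‖) ^ 2) ^ 3 := by ring
    rw [hQ', e6]
    generalize (1 + ‖w‖) ^ 2 = n at *
    generalize f (x + h • X w) = u' at *
    generalize g (y + h • Y w) = v' at *
    generalize h * f' x (X w) = p' at *
    generalize h * g' y (Y w) = q' at *
    have hn0 : 0 ≤ n := zero_le_one.trans hn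
    have hquad := quad_le_of_abs_sub_le (a * b) (a * (1 - a) / 2) (b * (1 - b) / 2)
      (s := (u' - u) / u) (t := (v' - v) / v) (s' := p' / u) (t' := q' / v) (c := c / ε) (h := h)
      (n := n) hh0 hh1 (by positivity) hn0
      (by rw [mul_assoc]; exact hdiv hu.1 (by rwa [← mul_assoc]))
      (by rw [mul_assoc]; exact hdiv hv.1 (by rwa [← mul_assoc]))
      (by rw [mul_assoc, ← sub_div]; exact hdiv hu.1 (by rwa [← mul_assoc]))
      (by rw [mul_assoc, ← sub_div]; exact hdiv hv.1 (by rwa [← mul_assoc]))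
    have h21 : c * h ^ 2 * n ≤ c * h * n := by
      gcongr
      exact pow_le_of_le_one hh0 hh1 (by norm_num)
    have hAa : |u' - u| ≤ 2 * (c * h * n) := by
      have := abs_add_le (u' - u - p') p'
      rw [sub_add_cancel] at this
      linarith
    have hBa : |v' - v| ≤ 2 * (c * h * n) := by
      have := abs_add_le (v' - v - q') q'
      rw [sub_add_cancel] at this
      linarith
    have hcub : M * (|u' - u| + |v' - v|) ^ 3 ≤ M * (4 * c) ^ 3 * (h ^ 3 * n ^ 3) := by
      calc _ ≤ M * (2 * (c * h * n) + 2 * (c * h * n)) ^ 3 := by gcongr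
        _ = _ := by ring
    have huv : u ^ a * v ^ b ≤ M1 * M2 := mul_le_mul ((le_abs_self _).trans (hB1 u hu))
      ((le_abs_self _).trans (hB2 v hv)) (by positivity) hM1
    have huv0 : 0 ≤ u ^ a * v ^ b := by positivity
    generalize u ^ a * v ^ b = P at *
    refine key.trans ?_
    obtain ⟨e, he⟩ : ∃ e, e = |a * b| + |a * (1 - a) / 2| + |b * (1 - b) / 2| := ⟨_, rfl⟩
    have he0 : 0 ≤ e := by rw [he]; positivity
    rw [← he] at hD hquad
    have hn23 : n ^ 2 ≤ n ^ 3 := pow_le_pow_right₀ hn (by norm_num)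
    have hquad' : P * (e * (3 * (c / ε) ^ 2 * h ^ 3 * n ^ 2)) ≤
        M1 * M2 * (e * (3 * (c / ε) ^ 2 * h ^ 3 * n ^ 3)) := by gcongr
    have hquad'' := mul_le_mul_of_nonneg_left hquad huv0
    rw [hD, div_eq_mul_inv (u' - u), div_eq_mul_inv (v' - v)] at *
    linear_combination hquad'' + hquad' + hcub
  have hmain := integral_mono (μ := ν) ?_ ?_ hpt
  · refine hmain.trans ?_
    have i1 : Integrable (fun w => a * u⁻¹ * (f (x + h • X w) - u)) ν :=
      (hfi.sub (integrable_const u)).const_mul _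
    have i2 : Integrable (fun w => b * v⁻¹ * (g (y + h • Y w) - v)) ν :=
      (hgi.sub (integrable_const v)).const_mul _
    have i0 : Integrable (fun _ : W => (1 : ℝ)) ν := integrable_const _
    have j1 := i0.add i1
    have j2 := j1.add i2
    have j3 := j2.add (hQint.const_mul (h ^ 2))
    have e1 : ∫ w, (f (x + h • X w) - u) ∂ν = 0 := by
      rw [integral_sub hfi (integrable_const u), ← hudef]; simp
    have e2 : ∫ w, (g (y + h • Y w) - v) ∂ν = 0 := by
      rw [integral_sub hgi (integrable_const v), ← hvdef]; simp
    have e3 : ∫ w, (1 + a * u⁻¹ * (f (x + h • X w) - u) + b * v⁻¹ * (g (y + h • Y w) - v) +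
        h ^ 2 * Q w) ∂ν = 1 + h ^ 2 * ∫ w, Q w ∂ν := by
      refine (integral_add j2 (hQint.const_mul (h ^ 2))).trans ?_
      rw [integral_const_mul]
      congr 1
      refine (integral_add j1 i2).trans ?_
      rw [integral_const_mul, e2, mul_zero, add_zero]
      refine (integral_add i0 i1).trans ?_
      rw [integral_const_mul, e1]
      simp
    refine le_of_eq_of_le (integral_add (j3.const_mul _) ((hmom 6).const_mul _)) ?_
    rw [integral_const_mul, integral_const_mul]
    refine add_le_add ?_ (by ring_nf; exact le_rfl)
    refine le_of_eq_of_le (congrArg _ e3) ?_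
    refine mul_le_of_le_one_right (by positivity) ?_
    have := mul_nonpos_of_nonneg_of_nonpos (sq_nonneg h) (hab (u⁻¹ • f' x) (v⁻¹ • g' y))
    linarith
  · obtain ⟨f'', K', hfa⟩ := hf.rpow hε hfε a
    obtain ⟨g'', K'', hgb⟩ := hg.rpow hε hgε b
    refine Integrable.of_bound ((hfa.continuous.comp hXc).mul
      (hgb.continuous.comp hYc)).aestronglyMeasurable (K' * K'')
      (Eventually.of_forall fun w => ?_)
    rw [norm_mul]
    exact mul_le_mul (hfa.bound _) (hgb.bound _) (norm_nonneg _) hfa.nonneg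
  · exact ((((integrable_const _).add ((hfi.sub (integrable_const u)).const_mul _)).add
      ((hgi.sub (integrable_const v)).const_mul _)).add (hQint.const_mul _)).const_mul _ |>.add
      ((hmom 6).const_mul _)

end Hyper

section HyperGaussian

open ProbabilityTheory

variable {W E F : Type*} [NormedAddCommGroup W] [NormedSpace ℝ W] [MeasurableSpace W]
  [BorelSpace W] [SecondCountableTopology W] [NormedAddCommGroup E] [NormedSpace ℝ E]
  [NormedAddCommGroup F] [NormedSpace ℝ F] {ν : Measure W}

/-- A centred Gaussian vector of size `r` is the sum of independent ones of sizes `r'` and `h`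
when `r² = r'² + h²`. -/
theorem integral_smul_eq_integral_integral [CompleteSpace W] [IsGaussian ν] (h0 : ν[id] = 0)
    {φ : W → ℝ} (hφ : Continuous φ) {C : ℝ} (hC : ∀ w, |φ w| ≤ C) {r r' h : ℝ} (hr : 0 ≤ r)
    (hr' : 0 ≤ r') (hh : 0 ≤ h) (hsq : r ^ 2 = r' ^ 2 + h ^ 2) :
    ∫ w, φ (r • w) ∂ν = ∫ w, ∫ w', φ (r' • w + h • w') ∂ν ∂ν := by
  rcases hr.eq_or_lt with rfl | hr
  · have h1 : r' = 0 := by nlinarith [sq_nonneg r', sq_nonneg h]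
    have h2 : h = 0 := by nlinarith [sq_nonneg r', sq_nonneg h]
    simp [h1, h2]
  have hd : (h / r) ^ 2 + (r' / r) ^ 2 = 1 := by
    field_simp; linarith
  have hsin : Real.sin (Real.arcsin (h / r)) = h / r :=
    Real.sin_arcsin (by linarith [div_nonneg hh hr.le])
      (by nlinarith [sq_nonneg (r' / r), div_nonneg hh hr.le])
  have hcos : Real.cos (Real.arcsin (h / r)) = r' / r := by
    rw [Real.cos_arcsin, show 1 - (h / r) ^ 2 = (r' / r) ^ 2 by linarith]
    exact Real.sqrt_sq (by positivity)
  have hint : Integrable (fun z : W × W => φ (r' • z.1 + h • z.2)) (ν.prod ν) :=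
    Integrable.of_bound (by fun_prop) C (Eventually.of_forall fun z => hC _)
  calc ∫ w, φ (r • w) ∂ν = ∫ z, φ (r • z.1) ∂(ν.prod ν) := by
        rw [integral_fun_fst (fun w => φ (r • w))]; simp
    _ = ∫ z, φ (r • z.1)
          ∂((ν.prod ν).map (ContinuousLinearMap.rotation (Real.arcsin (h / r)))) := by
        rw [IsGaussian.map_rotation_eq_self h0]
    _ = ∫ z, φ (r' • z.1 + h • z.2) ∂(ν.prod ν) := by
        rw [integral_map (by fun_prop) (by fun_prop)]
        congr 1 with z
        simp only [ContinuousLinearMap.rotation_apply, hsin, hcos, smul_add, smul_smul,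
          mul_div_cancel₀ _ hr.ne']
    _ = _ := integral_prod _ hint

theorem IsC11.exists_rpow_bound {f : E → ℝ} {f' : E → E →L[ℝ] ℝ} {K ε : ℝ} (hf : IsC11 f f' K)
    (hε : 0 < ε) (hfε : ∀ x, ε ≤ f x) (a : ℝ) :
    ∃ C, Continuous (fun x => f x ^ a) ∧ ∀ x, |f x ^ a| ≤ C := by
  obtain ⟨f'', C, hfa⟩ := hf.rpow hε hfε a
  exact ⟨C, hfa.continuous, hfa.bound⟩

/-- Iteration of the one-step estimate along `k` Gaussian steps of size `h`. -/
theorem integral_rpow_mul_rpow_le_add [CompleteSpace W] [IsGaussian ν] (h0 : ν[id] = 0)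
    (X : W →L[ℝ] E) (Y : W →L[ℝ] F) (a b : ℝ) {ε K D h : ℝ} (hε : 0 < ε) (hh : 0 ≤ h)
    (hD : ∀ (f : E → ℝ) (f' : E → E →L[ℝ] ℝ) (g : F → ℝ) (g' : F → F →L[ℝ] ℝ),
      IsC11 f f' K → (∀ x, ε ≤ f x) → IsC11 g g' K → (∀ x, ε ≤ g x) → ∀ (x : E) (y : F),
        ∫ w, f (x + h • X w) ^ a * g (y + h • Y w) ^ b ∂ν ≤
          (∫ w, f (x + h • X w) ∂ν) ^ a * (∫ w, g (y + h • Y w) ∂ν) ^ b + D) (k : ℕ) :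
    ∀ (f : E → ℝ) (f' : E → E →L[ℝ] ℝ) (g : F → ℝ) (g' : F → F →L[ℝ] ℝ),
      IsC11 f f' K → (∀ x, ε ≤ f x) → IsC11 g g' K → (∀ x, ε ≤ g x) →
      ∀ r : ℝ, 0 ≤ r → r ^ 2 = k * h ^ 2 →
        ∫ w, f (X (r • w)) ^ a * g (Y (r • w)) ^ b ∂ν ≤
          (∫ w, f (X (r • w)) ∂ν) ^ a * (∫ w, g (Y (r • w)) ∂ν) ^ b + k * D := by
  induction k with
  | zero =>
    intro f f' g g' hf hfε hg hgε r hr hrk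
    have : r = 0 := by simpa using hrk
    simp [this]
  | succ k ih =>
    intro f f' g g' hf hfε hg hgε r hr hrk
    set r' := Real.sqrt k * h with hr'def
    have hr' : 0 ≤ r' := by positivity
    have hr'k : r' ^ 2 = k * h ^ 2 := by rw [mul_pow, Real.sq_sqrt (Nat.cast_nonneg k)]
    have hsq : r ^ 2 = r' ^ 2 + h ^ 2 := by rw [hrk, hr'k]; push_cast; ring
    set f₁ : E → ℝ := fun x => ∫ w, f (x + h • X w) ∂ν with hf₁
    set g₁ : F → ℝ := fun x => ∫ w, g (x + h • Y w) ∂ν with hg₁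
    have hXc : Continuous fun w => h • X w := by fun_prop
    have hYc : Continuous fun w => h • Y w := by fun_prop
    have hf1 := hf.average (ν := ν) hXc
    have hg1 := hg.average (ν := ν) hYc
    have hfε1 : ∀ x, ε ≤ f₁ x := fun x => by
      simpa using integral_mono (μ := ν) (integrable_const ε)
        (hf.integrable_comp (ν := ν) (continuous_const.add hXc)) fun w => hfε (x + h • X w)
    have hgε1 : ∀ x, ε ≤ g₁ x := fun x => by
      simpa using integral_mono (μ := ν) (integrable_const ε)
        (hg.integrable_comp (ν := ν) (continuous_const.add hYc)) fun w => hgε (x + h • Y w)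
    obtain ⟨C1, hc1, hC1⟩ := hf.exists_rpow_bound hε hfε a
    obtain ⟨C2, hc2, hC2⟩ := hg.exists_rpow_bound hε hgε b
    obtain ⟨C3, hc3, hC3⟩ := hf1.exists_rpow_bound hε hfε1 a
    obtain ⟨C4, hc4, hC4⟩ := hg1.exists_rpow_bound hε hgε1 b
    have hprod : ∀ {u v C C' : ℝ}, |u| ≤ C → |v| ≤ C' → |u * v| ≤ C * C' := fun hu hv => by
      rw [abs_mul]; exact mul_le_mul hu hv (abs_nonneg _) ((abs_nonneg _).trans hu)
    have ef : ∫ w, f (X (r • w)) ∂ν = ∫ w, f₁ (X (r' • w)) ∂ν := by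
      rw [integral_smul_eq_integral_integral h0 (φ := fun w => f (X w))
        (hf.continuous.comp X.continuous) (fun w => hf.bound _) hr hr' hh hsq]
      simp only [hf₁, map_add, map_smul]
    have eg : ∫ w, g (Y (r • w)) ∂ν = ∫ w, g₁ (Y (r' • w)) ∂ν := by
      rw [integral_smul_eq_integral_integral h0 (φ := fun w => g (Y w))
        (hg.continuous.comp Y.continuous) (fun w => hg.bound _) hr hr' hh hsq]
      simp only [hg₁, map_add, map_smul]
    have hcont : Continuous fun w => f (X w) ^ a * g (Y w) ^ b :=
      (hc1.comp X.continuous).mul (hc2.comp Y.continuous)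
    have hint : Integrable (fun z : W × W => f (X (r' • z.1 + h • z.2)) ^ a *
        g (Y (r' • z.1 + h • z.2)) ^ b) (ν.prod ν) :=
      Integrable.of_bound (hcont.comp (by fun_prop : Continuous fun z : W × W =>
        r' • z.1 + h • z.2)).aestronglyMeasurable (C1 * C2)
        (Eventually.of_forall fun z => hprod (hC1 _) (hC2 _))
    have hint1 : Integrable (fun w => f₁ (X (r' • w)) ^ a * g₁ (Y (r' • w)) ^ b) ν :=
      Integrable.of_bound ((hc3.comp (by fun_prop : Continuous fun w => X (r' • w))).mul
        (hc4.comp (by fun_prop : Continuous fun w => Y (r' • w)))).aestronglyMeasurable (C3 * C4)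
        (Eventually.of_forall fun z => hprod (hC3 _) (hC4 _))
    calc ∫ w, f (X (r • w)) ^ a * g (Y (r • w)) ^ b ∂ν
        = ∫ w, ∫ w', f (X (r' • w + h • w')) ^ a * g (Y (r' • w + h • w')) ^ b ∂ν ∂ν :=
          integral_smul_eq_integral_integral h0 (φ := fun w => f (X w) ^ a * g (Y w) ^ b) hcont
            (fun w => hprod (hC1 _) (hC2 _)) hr hr' hh hsq
      _ ≤ ∫ w, (f₁ (X (r' • w)) ^ a * g₁ (Y (r' • w)) ^ b + D) ∂ν := by
          refine integral_mono hint.integral_prod_left (hint1.add (integrable_const D))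
            fun w => ?_
          simp only [map_add, map_smul X h, map_smul Y h]
          exact hD f f' g g' hf hfε hg hgε _ _
      _ = ∫ w, f₁ (X (r' • w)) ^ a * g₁ (Y (r' • w)) ^ b ∂ν + D := by
          rw [integral_add hint1 (integrable_const D)]; simp
      _ ≤ (∫ w, f₁ (X (r' • w)) ∂ν) ^ a * (∫ w, g₁ (Y (r' • w)) ∂ν) ^ b + k * D + D := by
          gcongr
          exact ih _ _ _ _ hf1 hfε1 hg1 hgε1 r' hr' hr'k
      _ = _ := by rw [ef, eg]; push_cast; ring

/-- Hypercontractive Hölder inequality for a pair `(X, Y)` of jointly Gaussian centred vectors: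
if the quadratic form attached to the exponents `a`, `b` is nonpositive on pairs of linear
functionals, then `𝔼 [f(X)^a g(Y)^b] ≤ (𝔼 f(X))^a (𝔼 g(Y))^b`. -/
theorem integral_rpow_mul_rpow_le [CompleteSpace W] [IsGaussian ν] (h0 : ν[id] = 0)
    (X : W →L[ℝ] E) (Y : W →L[ℝ] F) (a b : ℝ)
    (hab : ∀ (L : E →L[ℝ] ℝ) (M : F →L[ℝ] ℝ), ∫ w, (a * b * (L (X w) * M (Y w)) -
      a * (1 - a) / 2 * L (X w) ^ 2 - b * (1 - b) / 2 * M (Y w) ^ 2) ∂ν ≤ 0)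
    {f : E → ℝ} {f' : E → E →L[ℝ] ℝ} {g : F → ℝ} {g' : F → F →L[ℝ] ℝ} {K K' ε : ℝ} (hε : 0 < ε)
    (hf : IsC11 f f' K) (hfε : ∀ x, ε ≤ f x) (hg : IsC11 g g' K') (hgε : ∀ x, ε ≤ g x) :
    ∫ w, f (X w) ^ a * g (Y w) ^ b ∂ν ≤ (∫ w, f (X w) ∂ν) ^ a * (∫ w, g (Y w) ∂ν) ^ b := by
  have hmom : ∀ n : ℕ, Integrable (fun w => (1 + ‖w‖) ^ n) ν := fun n => by
    have h1 : MemLp (fun w : W => w) (n : ℝ≥0∞) ν := IsGaussian.memLp_id ν n (by simp)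
    have h2 : MemLp (fun w : W => ‖w‖) (n : ℝ≥0∞) ν := h1.norm
    have h3 : MemLp (fun w : W => 1 + ‖w‖) (n : ℝ≥0∞) ν :=
      MemLp.add (f := fun _ : W => (1 : ℝ)) (memLp_const 1) h2
    have h4 : Integrable (fun w : W => ‖1 + ‖w‖‖ ^ n) ν := h3.integrable_norm_pow'
    refine h4.congr (Eventually.of_forall fun w => ?_)
    have : ‖1 + ‖w‖‖ = 1 + ‖w‖ := Real.norm_of_nonneg (by positivity)
    simp only [this]
  have hmean : ∀ L : W →L[ℝ] ℝ, ∫ w, L w ∂ν = 0 := fun L => by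
    have h0' : ∫ w, w ∂ν = 0 := h0
    rw [IsGaussian.integral_dual, h0', map_zero]
  -- `n + 1` steps of size `h = (n + 1) ^ (-1/2)` lose `(n + 1) * D * h ^ 3 = D * h` in total
  obtain ⟨D, hD0, hD⟩ := exists_one_step_le hmom hmean X Y a b hab hε (max K K')
  have key : ∀ n : ℕ, ∫ w, f (X w) ^ a * g (Y w) ^ b ∂ν ≤
      (∫ w, f (X w) ∂ν) ^ a * (∫ w, g (Y w) ∂ν) ^ b + D * √(1 / ((n : ℝ) + 1)) := fun n => by
    set h := √(1 / ((n : ℝ) + 1)) with hh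
    have hh0 : 0 ≤ h := Real.sqrt_nonneg _
    have hsq : h ^ 2 = 1 / ((n : ℝ) + 1) := Real.sq_sqrt (by positivity)
    have hh1 : h ≤ 1 := Real.sqrt_le_one.2 (by
      rw [div_le_one (by positivity)]; linarith [(Nat.cast_nonneg n : (0 : ℝ) ≤ n)])
    have := integral_rpow_mul_rpow_le_add h0 X Y a b hε hh0
      (fun f f' g g' hf hfε hg hgε => hD f f' g g' hf hfε hg hgε h hh0 hh1) (n + 1)
      f f' g g' (hf.mono (le_max_left _ _)) hfε (hg.mono (le_max_right _ _)) hgε 1 zero_le_one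
      (by rw [hsq]; push_cast; field_simp)
    simp only [one_smul] at this
    refine this.trans (le_of_eq ?_)
    congr 1
    calc ((n + 1 : ℕ) : ℝ) * (D * h ^ 3) = D * h * (((n : ℝ) + 1) * h ^ 2) := by
          push_cast; ring
      _ = D * h := by rw [hsq]; field_simp
  have hlim : Tendsto (fun n : ℕ => (∫ w, f (X w) ∂ν) ^ a * (∫ w, g (Y w) ∂ν) ^ b +
      D * √(1 / ((n : ℝ) + 1))) atTop
      (𝓝 ((∫ w, f (X w) ∂ν) ^ a * (∫ w, g (Y w) ∂ν) ^ b + D * √0)) :=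
    ((tendsto_one_div_add_atTop_nhds_zero_nat.sqrt).const_mul D).const_add _
  rw [Real.sqrt_zero, mul_zero, add_zero] at hlim
  exact ge_of_tendsto' hlim key

end HyperGaussian

/-! ### Existence of Gaussian measures with trace class covariance -/

section PositiveSqrt

variable {X : Type*} [NormedAddCommGroup X] [InnerProductSpace ℝ X] [CompleteSpace X]

omit [CompleteSpace X] in
theorem norm_one_sub_le_one {Q : X →L[ℝ] X} (hQ : Q.IsPositive) (hQ1 : ‖Q‖ ≤ 1) :
    ‖1 - Q‖ ≤ 1 := by
  rw [ContinuousLinearMap.isPositive_iff] at hQ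
  obtain ⟨hsym, hpos⟩ := hQ
  refine ContinuousLinearMap.opNorm_le_bound _ zero_le_one fun x => ?_
  have h0 := hpos (x - Q x)
  have hs1 : ⟪Q (Q x), x⟫ = ‖Q x‖ ^ 2 := by
    rw [← real_inner_self_eq_norm_sq]; exact hsym (Q x) x
  have h1 : ⟪Q (Q x), Q x⟫ ≤ ‖Q x‖ ^ 2 := by
    calc _ ≤ ‖Q (Q x)‖ * ‖Q x‖ := real_inner_le_norm _ _
      _ ≤ (1 * ‖Q x‖) * ‖Q x‖ := by gcongr; exact (Q.le_opNorm _).trans (by gcongr)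
      _ = _ := by ring
  rw [map_sub, inner_sub_left, inner_sub_right, inner_sub_right, hs1,
    real_inner_self_eq_norm_sq] at h0
  have h3 : ‖(1 - Q) x‖ ^ 2 = ‖x‖ ^ 2 - 2 * ⟪Q x, x⟫ + ‖Q x‖ ^ 2 := by
    rw [show (1 - Q) x = x - Q x from rfl, norm_sub_sq_real, real_inner_comm]
  rw [one_mul]
  refine (abs_le_of_sq_le_sq' ?_ (norm_nonneg _)).2
  rw [h3]
  nlinarith [hpos x]

/-- A positive contraction has a self-adjoint square root. -/
theorem exists_selfAdjoint_sqrt_of_norm_le_one {Q : X →L[ℝ] X} (hQ : Q.IsPositive)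
    (hQ1 : ‖Q‖ ≤ 1) : ∃ S : X →L[ℝ] X, IsSelfAdjoint S ∧ S * S = Q := by
  set T : X →L[ℝ] X := 1 - Q with hTdef
  have hTsa : IsSelfAdjoint T := (IsSelfAdjoint.one _).sub hQ.isSelfAdjoint
  have hT : ‖T‖ ≤ 1 := norm_one_sub_le_one hQ hQ1
  have hsum : Summable fun n => sqrtIterReal (n + 1) - sqrtIterReal n := by
    refine summable_of_sum_range_le (c := 1)
      (fun n => sub_nonneg.2 (sqrtIterReal_bounds n).2.2) fun n => ?_
    rw [Finset.sum_range_sub]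
    simpa [sqrtIterReal] using (sqrtIterReal_bounds n).2.1
  have hcau : CauchySeq (sqrtIter T) := by
    refine cauchySeq_of_dist_le_of_summable _ (fun n => ?_) hsum
    rw [dist_comm, dist_eq_norm]
    exact sqrtIter_sub_norm_le hT n
  obtain ⟨Y, hY⟩ := cauchySeq_tendsto_of_complete hcau
  have hYfix : Y = (2⁻¹ : ℝ) • (T + Y * Y) := by
    have h1 : Tendsto (fun n => sqrtIter T (n + 1)) atTop (𝓝 Y) :=
      (tendsto_add_atTop_iff_nat 1).2 hY
    have h2 : Tendsto (fun n => (2⁻¹ : ℝ) • (T + sqrtIter T n * sqrtIter T n)) atTop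
        (𝓝 ((2⁻¹ : ℝ) • (T + Y * Y))) := ((hY.mul hY).const_add T).const_smul _
    exact tendsto_nhds_unique h1 h2
  have hYsa : IsSelfAdjoint Y := by
    have h1 : Tendsto (fun n => star (sqrtIter T n)) atTop (𝓝 (star Y)) := hY.star
    rw [funext fun n => sqrtIter_isSelfAdjoint hTsa n] at h1
    exact tendsto_nhds_unique h1 hY
  have h2 : T + Y * Y = Y + Y := by
    have h3 : (2 : ℝ) • Y = T + Y * Y := by
      nth_rewrite 1 [hYfix]
      rw [smul_smul]
      norm_num
    rw [← h3, two_smul]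
  refine ⟨1 - Y, (IsSelfAdjoint.one _).sub hYsa, ?_⟩
  calc (1 - Y) * (1 - Y) = 1 - (Y + Y) + Y * Y := by noncomm_ring
    _ = 1 - (T + Y * Y) + Y * Y := by rw [h2]
    _ = Q := by rw [hTdef]; abel

theorem exists_selfAdjoint_sqrt {Q : X →L[ℝ] X} (hQ : Q.IsPositive) :
    ∃ S : X →L[ℝ] X, IsSelfAdjoint S ∧ S * S = Q := by
  set c : ℝ := ‖Q‖ + 1 with hc
  have hc0 : 0 < c := by positivity
  have hpos : (c⁻¹ • Q).IsPositive := by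
    rw [ContinuousLinearMap.isPositive_iff] at hQ ⊢
    refine ⟨fun x y => ?_, fun x => ?_⟩
    · have := hQ.1 x y
      simp only [ContinuousLinearMap.coe_coe] at this
      simp [inner_smul_left, inner_smul_right, this]
    · simpa [inner_smul_left] using mul_nonneg (inv_nonneg.2 hc0.le) (hQ.2 x)
  obtain ⟨S, hS, hSS⟩ := exists_selfAdjoint_sqrt_of_norm_le_one hpos (by
    rw [norm_smul, norm_inv, Real.norm_of_nonneg hc0.le, inv_mul_le_iff₀ hc0]
    linarith)
  refine ⟨√c • S, (IsSelfAdjoint.all (√c)).smul hS, ?_⟩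
  rw [smul_mul_smul_comm, hSS, smul_smul, Real.mul_self_sqrt hc0.le, mul_inv_cancel₀ hc0.ne',
    one_smul]

end PositiveSqrt

section GaussianSeries

open ProbabilityTheory

variable {X : Type*} [NormedAddCommGroup X] [InnerProductSpace ℝ X]

/-- The law of a family, indexed by `ι`, of independent standard Gaussian variables. -/
noncomputable def iidGaussian (ι : Type*) : Measure (ι → ℝ) :=
  Measure.infinitePi fun _ : ι => gaussianReal 0 1

variable {ι : Type*}

instance : IsProbabilityMeasure (iidGaussian ι) := by unfold iidGaussian; infer_instance

theorem iidGaussian_map_eval (i : ι) :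
    (iidGaussian ι).map (fun ω => ω i) = gaussianReal 0 1 :=
  (measurePreserving_eval_infinitePi (fun _ : ι => gaussianReal 0 1) i).map_eq

theorem memLp_eval_iidGaussian (i : ι) : MemLp (fun ω : ι → ℝ => ω i) 2 (iidGaussian ι) := by
  have h := IsGaussian.memLp_two_id (μ := gaussianReal 0 1)
  rw [← iidGaussian_map_eval i] at h
  exact (memLp_map_measure_iff (g := id) (by fun_prop) (measurable_pi_apply i).aemeasurable).1 h

theorem iIndepFun_eval_iidGaussian :
    iIndepFun (fun (i : ι) (ω : ι → ℝ) => ω i) (iidGaussian ι) :=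
  iIndepFun_infinitePi (P := fun _ : ι => gaussianReal 0 1) (X := fun _ x => x)
    fun _ => measurable_id

theorem integral_eval_iidGaussian (i : ι) : ∫ ω, ω i ∂(iidGaussian ι) = 0 := by
  have := integral_map (μ := iidGaussian ι) (φ := fun ω => ω i) (f := fun x : ℝ => x)
    (measurable_pi_apply i).aemeasurable (by fun_prop)
  rw [← this, iidGaussian_map_eval, integral_id_gaussianReal]

theorem integral_eval_mul_self_iidGaussian (i : ι) : ∫ ω, ω i * ω i ∂(iidGaussian ι) = 1 := by
  have h1 := integral_map (μ := iidGaussian ι) (φ := fun ω => ω i) (f := fun x : ℝ => x * x)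
    (measurable_pi_apply i).aemeasurable (by fun_prop)
  rw [← h1, iidGaussian_map_eval]
  have h2 := variance_eq_integral (μ := gaussianReal 0 1) (X := id) (by fun_prop)
  simp only [variance_id_gaussianReal, id, integral_id_gaussianReal, sub_zero] at h2
  simp only [← pow_two, ← h2]; rfl

theorem integral_eval_mul_eval_iidGaussian {i j : ι} (h : i ≠ j) :
    ∫ ω, ω i * ω j ∂(iidGaussian ι) = 0 := by
  have := (iIndepFun_eval_iidGaussian (ι := ι)).indepFun h
  have h2 := this.integral_mul_eq_mul_integral (measurable_pi_apply i).aestronglyMeasurable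
    (measurable_pi_apply j).aestronglyMeasurable
  simp only [integral_eval_iidGaussian, mul_zero] at h2
  exact h2

theorem memLp_eval_smul (i : ι) (x : X) :
    MemLp (fun ω : ι → ℝ => ω i • x) 2 (iidGaussian ι) := by
  refine (memLp_eval_iidGaussian i).of_le_mul (c := ‖x‖)
    ((measurable_pi_apply i).aestronglyMeasurable.smul_const x)
    (Eventually.of_forall fun ω => ?_)
  rw [norm_smul, mul_comm]

theorem inner_toLp_eval_smul (i j : ι) (x y : X) :
    ⟪(memLp_eval_smul i x).toLp _, (memLp_eval_smul j y).toLp _⟫ =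
      (∫ ω, ω i * ω j ∂(iidGaussian ι)) * ⟪x, y⟫ := by
  rw [L2.inner_def, ← integral_mul_const]
  refine integral_congr_ae ?_
  filter_upwards [(memLp_eval_smul i x).coeFn_toLp, (memLp_eval_smul j y).coeFn_toLp] with ω h1 h2
  rw [h1, h2, inner_smul_left, inner_smul_right]
  simp [mul_assoc]

/-- The isometry `x ↦ ξᵢ x` into the square integrable `X`-valued random variables. -/
noncomputable def gaussianCoord (i : ι) : X →ₗᵢ[ℝ] Lp X 2 (iidGaussian ι) :=
  LinearMap.isometryOfInner
    { toFun x := (memLp_eval_smul i x).toLp _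
      map_add' x y := by
        rw [← MemLp.toLp_add]
        exact MemLp.toLp_congr _ _ (Eventually.of_forall fun ω => smul_add _ _ _)
      map_smul' c x := by
        rw [RingHom.id_apply, ← MemLp.toLp_const_smul]
        exact MemLp.toLp_congr _ _ (Eventually.of_forall fun ω => smul_comm _ _ _) }
    fun x y => by
      simp only [LinearMap.coe_mk, AddHom.coe_mk]
      rw [inner_toLp_eval_smul, integral_eval_mul_self_iidGaussian, one_mul]

theorem gaussianCoord_apply (i : ι) (x : X) :
    gaussianCoord i x = (memLp_eval_smul i x).toLp _ := rfl

theorem orthogonalFamily_gaussianCoord :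
    OrthogonalFamily ℝ (fun _ : ι => X) (gaussianCoord (X := X)) := fun i j hij x y => by
  rw [gaussianCoord_apply, gaussianCoord_apply, inner_toLp_eval_smul,
    integral_eval_mul_eval_iidGaussian hij, zero_mul]

variable [SecondCountableTopology X] [MeasurableSpace X] [BorelSpace X]

/-- The characteristic function of a finite Gaussian sum `∑ ξᵢ vᵢ`. -/
theorem charFun_map_sum_eval_smul (s : Finset ι) (v : ι → X) (h : X) :
    ∫ ω, Complex.exp (⟪∑ i ∈ s, ω i • v i, h⟫ * Complex.I) ∂(iidGaussian ι) =
      Complex.exp (-(((∑ i ∈ s, ⟪v i, h⟫ ^ 2 : ℝ) : ℂ) / 2)) := by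
  have hm : ∀ i, Measurable fun ω : ι → ℝ => ω i • v i := fun i =>
    (measurable_pi_apply i).smul_const _
  have hind : iIndepFun (s.restrict fun (i : ι) (ω : ι → ℝ) => ω i • v i) (iidGaussian ι) :=
    ((iIndepFun_eval_iidGaussian (ι := ι)).comp (fun i (x : ℝ) => x • v i)
      fun i => by fun_prop).restrict _
  have key := congrFun (hind.charFun_map_fun_finsetSum_eq_prod fun i _ => (hm i).aemeasurable) h
  rw [charFun_apply, integral_map (Finset.measurable_sum _ fun i _ => hm i).aemeasurable
    (by fun_prop)] at key
  rw [key, Finset.prod_apply, Complex.ofReal_sum, Finset.sum_div, ← Finset.sum_neg_distrib,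
    Complex.exp_sum]
  refine Finset.prod_congr rfl fun i _ => ?_
  rw [charFun_apply, integral_map (hm i).aemeasurable (by fun_prop)]
  have h1 := charFun_gaussianReal (μ := 0) (v := 1) ⟪v i, h⟫
  rw [← iidGaussian_map_eval (ι := ι) i, charFun_apply_real,
    integral_map (measurable_pi_apply i).aemeasurable (by fun_prop)] at h1
  refine Eq.trans ?_ (h1.trans ?_)
  · refine integral_congr_ae (Eventually.of_forall fun ω => ?_)
    simp only [real_inner_smul_left]
    push_cast
    ring_nf
  · push_cast
    congr 1
    ring

omit [SecondCountableTopology X] in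
theorem lipschitz_integral_exp_inner {Ω : Type*} [MeasurableSpace Ω] (P : Measure Ω)
    [IsProbabilityMeasure P] (h : X) (f g : Lp X 2 P) :
    ‖∫ ω, Complex.exp (⟪f ω, h⟫ * Complex.I) ∂P - ∫ ω, Complex.exp (⟪g ω, h⟫ * Complex.I) ∂P‖ ≤
      ‖h‖ * ‖f - g‖ := by
  have hi : ∀ f : Lp X 2 P, Integrable (fun ω => Complex.exp (⟪f ω, h⟫ * Complex.I)) P := fun f =>
    Integrable.of_bound (by
      have := (Lp.aestronglyMeasurable f).aemeasurable
      fun_prop) 1 (Eventually.of_forall fun ω => by rw [Complex.norm_exp_ofReal_mul_I])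
  have hfg : Integrable (fun ω => ‖(f - g) ω‖) P :=
    ((Lp.memLp (f - g)).integrable (by norm_num)).norm
  have hL : ∫ ω, ‖(f - g) ω‖ ∂P ≤ ‖f - g‖ := by
    rw [integral_norm_eq_lintegral_enorm (Lp.aestronglyMeasurable _), Lp.norm_def]
    refine ENNReal.toReal_mono (Lp.eLpNorm_ne_top _) ?_
    rw [← eLpNorm_one_eq_lintegral_enorm]
    exact eLpNorm_le_eLpNorm_of_exponent_le (by norm_num) (Lp.aestronglyMeasurable _)
  rw [← integral_sub (hi f) (hi g)]
  calc _ ≤ ∫ ω, ‖h‖ * ‖(f - g) ω‖ ∂P := by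
        refine norm_integral_le_of_norm_le (hfg.const_mul _) ?_
        filter_upwards [Lp.coeFn_sub f g] with ω hω
        rw [hω, Pi.sub_apply]
        have e : Complex.exp (⟪f ω, h⟫ * Complex.I) - Complex.exp (⟪g ω, h⟫ * Complex.I) =
            Complex.exp (⟪g ω, h⟫ * Complex.I) *
              (Complex.exp (Complex.I * ((⟪f ω - g ω, h⟫ : ℝ) : ℂ)) - 1) := by
          rw [mul_sub, ← Complex.exp_add, inner_sub_left, mul_one]
          push_cast
          ring_nf
        rw [e, norm_mul, Complex.norm_exp_ofReal_mul_I, one_mul]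
        refine Real.norm_exp_I_mul_ofReal_sub_one_le.trans ?_
        rw [mul_comm]
        exact norm_inner_le_norm _ _
    _ ≤ _ := by rw [integral_const_mul]; gcongr

/-- A Hilbert-Schmidt operator `S` (with `S = S⋆`) maps white noise to a Gaussian measure with
covariance `S²`: the law of the `L²`-convergent series `∑ ξᵢ S eᵢ`. -/
theorem exists_isGaussianWith_of_summable [CompleteSpace X] (b : HilbertBasis ι ℝ X)
    {S : X →L[ℝ] X} (hS : IsSelfAdjoint S) (hsum : Summable fun i => ‖S (b i)‖ ^ 2) :
    ∃ μ : Measure X, IsGaussianWith 0 (fun x => S (S x)) μ := by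
  have hsym : ∀ x y, ⟪S x, y⟫ = ⟪x, S y⟫ := fun x y => hS.isSymmetric x y
  obtain ⟨Z, hZ⟩ := (orthogonalFamily_gaussianCoord (X := X).summable_iff_norm_sq_summable
    (fun i => S (b i))).2 hsum
  have hZm : AEMeasurable Z (iidGaussian ι) := (Lp.aestronglyMeasurable Z).aemeasurable
  refine ⟨(iidGaussian ι).map Z, Measure.isProbabilityMeasure_map hZm, fun h => ?_⟩
  rw [charFun_apply, integral_map hZm (by fun_prop)]
  have hlim1 : Tendsto (fun s : Finset ι => ∫ ω, Complex.exp
      (⟪(∑ i ∈ s, gaussianCoord i (S (b i)) : Lp X 2 (iidGaussian ι)) ω, h⟫ * Complex.I)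
        ∂(iidGaussian ι)) atTop
      (𝓝 (∫ ω, Complex.exp (⟪Z ω, h⟫ * Complex.I) ∂(iidGaussian ι))) := by
    rw [tendsto_iff_norm_sub_tendsto_zero]
    refine squeeze_zero (fun _ => norm_nonneg _)
      (fun s => lipschitz_integral_exp_inner (iidGaussian ι) h _ Z) ?_
    simpa using (tendsto_iff_norm_sub_tendsto_zero.1 hZ).const_mul ‖h‖
  have hlim2 : Tendsto (fun s : Finset ι =>
      Complex.exp (-(((∑ i ∈ s, ⟪S (b i), h⟫ ^ 2 : ℝ) : ℂ) / 2))) atTop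
      (𝓝 (Complex.exp (-(((⟪S (S h), h⟫ : ℝ) : ℂ) / 2)))) := by
    have h1 := b.hasSum_inner_mul_inner (S h) (S h)
    have h2 : HasSum (fun i => ⟪S (b i), h⟫ ^ 2) ⟪S (S h), h⟫ := by
      convert! h1 using 1
      · funext i
        rw [hsym, pow_two, real_inner_comm (b i) (S h)]
      · rw [hsym]
    exact (Complex.continuous_exp.tendsto _).comp
      (((Complex.continuous_ofReal.tendsto _).comp h2).div_const 2).neg
  have heq : ∀ s : Finset ι, ∫ ω, Complex.exp
      (⟪(∑ i ∈ s, gaussianCoord i (S (b i)) : Lp X 2 (iidGaussian ι)) ω, h⟫ * Complex.I)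
        ∂(iidGaussian ι) = Complex.exp (-(((∑ i ∈ s, ⟪S (b i), h⟫ ^ 2 : ℝ) : ℂ) / 2)) := fun s => by
    rw [← charFun_map_sum_eval_smul]
    refine integral_congr_ae ?_
    have hall : ∀ᵐ ω ∂(iidGaussian ι), ∀ i ∈ s,
        gaussianCoord i (S (b i)) ω = ω i • S (b i) :=
      (Filter.eventually_all_finset s).2 fun i _ => (memLp_eval_smul i (S (b i))).coeFn_toLp
    filter_upwards [hall, Lp.coeFn_finsetSum s fun i => gaussianCoord i (S (b i))] with ω h1 h2
    rw [h2, Finset.sum_apply, Finset.sum_congr rfl h1]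
  rw [tendsto_nhds_unique hlim1 (hlim2.congr fun s => (heq s).symm)]
  simp

/-- A positive operator of finite trace is the covariance of a centred Gaussian measure. -/
theorem exists_isGaussianWith [CompleteSpace X] {Q : X →L[ℝ] X} (hQ : Q.IsPositive)
    (htr : opTrace Q < ∞) : ∃ μ : Measure X, IsGaussianWith 0 Q μ := by
  obtain ⟨S, hS, hSS⟩ := exists_selfAdjoint_sqrt hQ
  obtain ⟨b, hb⟩ := (exists_hilbertBasis ℝ X).choose_spec
  have hSSx : ∀ x, S (S x) = Q x := fun x => by rw [← hSS]; rfl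
  have e : ∀ i, ⟪Q (b i), b i⟫ = ‖S (b i)‖ ^ 2 := fun i => by
    rw [← hSSx, ← real_inner_self_eq_norm_sq]
    exact hS.isSymmetric _ _
  have hsum : Summable fun i => ‖S (b i)‖ ^ 2 := by
    have h1 : ∑' i, ENNReal.ofReal (‖S (b i)‖ ^ 2) ≠ ∞ := by
      refine ne_of_lt (lt_of_eq_of_lt ?_ htr)
      rw [opTrace]
      exact tsum_congr fun i => by rw [← e, hb]
    have := ENNReal.summable_toReal h1
    refine this.congr fun i => ?_
    rw [ENNReal.toReal_ofReal (by positivity)]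
  obtain ⟨μ, hμ⟩ := exists_isGaussianWith_of_summable b hS hsum
  exact ⟨μ, by simpa only [hSSx] using hμ⟩

end GaussianSeries

/-! ### Operator-valued integrals -/

section OperatorIntegral

variable {X : Type*} [NormedAddCommGroup X] [InnerProductSpace ℝ X] [CompleteSpace X]
  {Ω : Type*} [MeasurableSpace Ω] {μ : Measure Ω}

/-- Pettis' theorem in a separable Hilbert space: weak measurability implies strong
measurability. -/
theorem aestronglyMeasurable_of_inner [TopologicalSpace.SeparableSpace X] {f : Ω → X}
    (hf : ∀ e, AEStronglyMeasurable (fun r => ⟪e, f r⟫) μ) : AEStronglyMeasurable f μ := by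
  obtain ⟨w, b, hb⟩ := exists_hilbertBasis ℝ X
  -- the balls of radius `1/2` around the basis vectors are pairwise disjoint
  have hw : Countable w := by
    have hd : (Set.univ : Set w).PairwiseDisjoint fun i => Metric.ball (b i) (1 / 2) := by
      intro i _ j _ hij
      refine Metric.ball_disjoint_ball ?_
      have h1 : dist (b i) (b j) ^ 2 = 2 := by
        rw [dist_eq_norm, norm_sub_sq_real, b.orthonormal.1 i, b.orthonormal.1 j,
          b.orthonormal.2 hij]
        norm_num
      nlinarith [dist_nonneg (x := b i) (y := b j)]
    exact Set.countable_univ_iff.1 (hd.countable_of_isOpen (fun _ _ => Metric.isOpen_ball)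
      fun i _ => Metric.nonempty_ball.2 (by norm_num))
  refine aestronglyMeasurable_of_tendsto_ae (atTop : Filter (Finset w))
    (f := fun s r => ∑ i ∈ s, ⟪(b i : X), f r⟫ • (b i : X)) (fun s => ?_)
    (Eventually.of_forall fun r => ?_)
  · exact Finset.aestronglyMeasurable_fun_sum _ fun i _ => (hf _).smul_const _
  · have := b.hasSum_repr (f r)
    simp only [b.repr_apply_apply] at this
    exact this

theorem exists_clm_integral {N : Ω → X →L[ℝ] X} {g : Ω → ℝ}
    (hm : ∀ x, AEStronglyMeasurable (fun r => N r x) μ) (hg : Integrable g μ)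
    (hN : ∀ᵐ r ∂μ, ∀ x, ‖N r x‖ ≤ g r * ‖x‖) (hpos : ∀ r, (N r).IsPositive) :
    ∃ Q : X →L[ℝ] X, Q.IsPositive ∧ (∀ x, Q x = ∫ r, N r x ∂μ) ∧
      ∀ x y, Integrable (fun r => ⟪N r x, y⟫) μ ∧ ⟪Q x, y⟫ = ∫ r, ⟪N r x, y⟫ ∂μ := by
  have hi : ∀ x, Integrable (fun r => N r x) μ := fun x =>
    (hg.mul_const ‖x‖).mono' (hm x) (hN.mono fun r hr => hr x)
  have hb : ∀ x, ‖∫ r, N r x ∂μ‖ ≤ (∫ r, g r ∂μ) * ‖x‖ := fun x => by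
    rw [← integral_mul_const]
    exact norm_integral_le_of_norm_le (hg.mul_const ‖x‖) (hN.mono fun r hr => hr x)
  obtain ⟨Q, hQ⟩ : ∃ Q : X →L[ℝ] X, ∀ x, Q x = ∫ r, N r x ∂μ :=
    ⟨LinearMap.mkContinuous
      { toFun x := ∫ r, N r x ∂μ
        map_add' x y := by simp only [map_add]; exact integral_add (hi x) (hi y)
        map_smul' c x := by simp only [map_smul, integral_smul, RingHom.id_apply] }
      (∫ r, g r ∂μ) hb, fun x => rfl⟩
  have hin : ∀ x y, ⟪Q x, y⟫ = ∫ r, ⟪N r x, y⟫ ∂μ := fun x y => by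
    rw [hQ, real_inner_comm, ← integral_inner (hi x)]
    simp only [real_inner_comm]
  refine ⟨Q, ?_, hQ, fun x y => ⟨(hi x).inner_const y, hin x y⟩⟩
  rw [ContinuousLinearMap.isPositive_iff]
  refine ⟨fun x y => ?_, fun x => ?_⟩
  · simp only [ContinuousLinearMap.coe_coe]
    rw [← real_inner_comm x, hin, hin]
    refine integral_congr_ae (Eventually.of_forall fun r => ?_)
    have := (ContinuousLinearMap.isPositive_iff _).1 (hpos r) |>.1 x y
    simp only [ContinuousLinearMap.coe_coe] at this
    simp only
    rw [this, real_inner_comm]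
  · rw [hin]
    exact integral_nonneg fun r => ((ContinuousLinearMap.isPositive_iff _).1 (hpos r)).2 x

end OperatorIntegral

/-! ### Growth of the accumulated noise -/

section Growth

/-- If `G(r) = ∫_{-∞}^r g` satisfies `G ≤ κ g`, then `G` grows at least like `exp (r / κ)`. -/
theorem exp_mul_setIntegral_Iic_le {g : ℝ → ℝ} {κ s t : ℝ} (hκ : 0 < κ) (hst : s ≤ t)
    (hg0 : ∀ r, 0 ≤ g r) (hgi : IntegrableOn g (Set.Iic t))
    (hg : ∀ r ≤ t, ∫ σ in Set.Iic r, g σ ≤ κ * g r) :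
    Real.exp ((t - s) / κ) * ∫ σ in Set.Iic s, g σ ≤ ∫ σ in Set.Iic t, g σ := by
  set G : ℝ → ℝ := fun r => ∫ σ in Set.Iic r, g σ with hG
  have hmono : ∀ r r', r ≤ r' → r' ≤ t → G r ≤ G r' := fun r r' h h' =>
    setIntegral_mono_set (hgi.mono_set (Set.Iic_subset_Iic.2 h')) (Eventually.of_forall hg0)
      (Set.Iic_subset_Iic.2 h).eventuallyLE
  have hstep : ∀ r r', r ≤ r' → r' ≤ t → (1 + (r' - r) / κ) * G r ≤ G r' := fun r r' h h' => by
    have h1 : G r' = G r + ∫ σ in Set.Ioc r r', g σ := by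
      simp only [hG]
      rw [← Set.Iic_union_Ioc_eq_Iic h, setIntegral_union (Set.Iic_disjoint_Ioc le_rfl)
        measurableSet_Ioc (hgi.mono_set (Set.Iic_subset_Iic.2 (h.trans h')))
        (hgi.mono_set fun x hx => hx.2.trans h')]
    have h2 : ∫ _ in Set.Ioc r r', G r / κ ≤ ∫ σ in Set.Ioc r r', g σ := by
      refine setIntegral_mono_on (integrableOn_const (by simp))
        (hgi.mono_set fun x hx => hx.2.trans h') measurableSet_Ioc fun σ hσ => ?_
      rw [div_le_iff₀' hκ]
      exact (hmono r σ hσ.1.le (hσ.2.trans h')).trans (hg σ (hσ.2.trans h'))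
    rw [setIntegral_const, Real.volume_real_Ioc_of_le h, smul_eq_mul] at h2
    rw [h1]
    calc _ = G r + (r' - r) * (G r / κ) := by ring
      _ ≤ _ := by gcongr
  -- Euler steps in place of a differential inequality, as `g` is only integrable
  have hiter : ∀ n : ℕ, 0 < n → (1 + (t - s) / κ / n) ^ n * G s ≤ G t := fun n hn => by
    have hn0 : (0 : ℝ) < n := Nat.cast_pos.2 hn
    have hk : ∀ k : ℕ, k ≤ n → (1 + (t - s) / κ / n) ^ k * G s ≤ G (s + k * ((t - s) / n)) := by
      intro k
      induction k with
      | zero => intro _; simp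
      | succ k ih =>
        intro hkn
        have h1 := ih (Nat.le_of_succ_le hkn)
        have hd : 0 ≤ (t - s) / n := div_nonneg (sub_nonneg.2 hst) hn0.le
        have h2 := hstep (s + k * ((t - s) / n)) (s + (k + 1 : ℕ) * ((t - s) / n))
          (by push_cast; linarith) (by
            have : ((k + 1 : ℕ) : ℝ) * ((t - s) / n) ≤ n * ((t - s) / n) := by gcongr
            rw [mul_div_cancel₀ _ hn0.ne'] at this
            linarith)
        have e : 1 + (s + ((k + 1 : ℕ) : ℝ) * ((t - s) / n) - (s + k * ((t - s) / n))) / κ =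
            1 + (t - s) / κ / n := by push_cast; field_simp; ring
        rw [e] at h2
        refine le_trans ?_ h2
        rw [pow_succ', mul_assoc]
        have : 0 ≤ (t - s) / κ / n := by
          have := sub_nonneg.2 hst
          positivity
        gcongr
    have := hk n le_rfl
    rwa [mul_div_cancel₀ _ hn0.ne', add_sub_cancel] at this
  exact le_of_tendsto ((Real.tendsto_one_add_div_pow_exp ((t - s) / κ)).mul_const (G s))
    (eventually_atTop.2 ⟨1, fun n hn => hiter n hn⟩)

theorem integrableOn_decay {C η α : ℝ} (hη : 0 < η) (hα : α < 1 / 2) :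
    IntegrableOn (fun u : ℝ => (C * (Real.exp (-η * u) / u ^ α)) ^ 2) (Set.Ioi 0) ∧
    ∫ u in Set.Ioi (0 : ℝ), (C * (Real.exp (-η * u) / u ^ α)) ^ 2 =
      C ^ 2 * (2 * η) ^ (2 * α - 1) * Real.Gamma (1 - 2 * α) := by
  have e : ∀ u ∈ Set.Ioi (0 : ℝ), C ^ 2 * (u ^ (1 - 2 * α - 1) * Real.exp (-(2 * η * u))) =
      (C * (Real.exp (-η * u) / u ^ α)) ^ 2 := fun u hu => by
    have h1 : u ^ (1 - 2 * α - 1) = (u ^ α * u ^ α)⁻¹ := by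
      rw [← Real.rpow_add hu, ← Real.rpow_neg (le_of_lt hu)]; ring_nf
    have h2 : Real.exp (-(2 * η * u)) = Real.exp (-η * u) * Real.exp (-η * u) := by
      rw [← Real.exp_add]; ring_nf
    rw [h1, h2]
    ring
  constructor
  · have h := integrableOn_rpow_mul_exp_neg_mul_rpow (s := 1 - 2 * α - 1) (p := 1) (b := 2 * η)
      (by linarith) one_pos (by linarith)
    have h' : IntegrableOn (fun u : ℝ => C ^ 2 * (u ^ (1 - 2 * α - 1) *
        Real.exp (-(2 * η) * u ^ (1 : ℝ)))) (Set.Ioi 0) := h.const_mul (C ^ 2)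
    refine h'.congr_fun (fun u hu => ?_) measurableSet_Ioi
    simp only
    rw [← e u hu, Real.rpow_one, neg_mul]
  · rw [← setIntegral_congr_fun measurableSet_Ioi e, integral_const_mul,
      Real.integral_rpow_mul_exp_neg_mul_Ioi (by linarith) (by linarith), ← mul_assoc, one_div,
      Real.inv_rpow (by linarith), ← Real.rpow_neg (by linarith)]
    ring_nf

theorem integrableOn_comp_sub_left {c : ℝ → ℝ} (hc : IntegrableOn c (Set.Ioi 0)) (t : ℝ) :
    IntegrableOn (fun r => c (t - r)) (Set.Iic t) ∧
      ∫ r in Set.Iic t, c (t - r) = ∫ u in Set.Ioi 0, c u := by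
  have e : (fun r => (Set.Ioi (0 : ℝ)).indicator c (t - r)) =
      (Set.Iio t).indicator fun r => c (t - r) := by
    funext r
    simp [Set.indicator_apply]
  have h1 := ((integrable_indicator_iff measurableSet_Ioi).2 hc).comp_sub_left t
  rw [e, integrable_indicator_iff measurableSet_Iio] at h1
  refine ⟨(integrableOn_Iic_iff_integrableOn_Iio (by simp)).2 h1, ?_⟩
  rw [integral_Iic_eq_integral_Iio, ← integral_indicator measurableSet_Iio, ← e,
    integral_sub_left_eq_self ((Set.Ioi (0 : ℝ)).indicator c) volume t,
    integral_indicator measurableSet_Ioi]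

end Growth

/-! ### Covariance operators of the evolution -/

section Covariance

variable {X : Type*} [NormedAddCommGroup X] [InnerProductSpace ℝ X] [CompleteSpace X]

theorem norm_sqrtMulAdjoint_apply (B : X →L[ℝ] X) (h : X) :
    ‖sqrtMulAdjoint B h‖ = ‖ContinuousLinearMap.adjoint B h‖ := by
  have h1 : ‖sqrtMulAdjoint B h‖ ^ 2 = ⟪(sqrtMulAdjoint B * sqrtMulAdjoint B) h, h⟫ := by
    rw [← real_inner_self_eq_norm_sq]
    exact ((sqrtMulAdjoint_isPositive B).isSelfAdjoint.isSymmetric (sqrtMulAdjoint B h) h).symm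
  have h2 : ‖ContinuousLinearMap.adjoint B h‖ ^ 2 =
      ⟪(B * ContinuousLinearMap.adjoint B) h, h⟫ := by
    rw [← real_inner_self_eq_norm_sq, ContinuousLinearMap.adjoint_inner_right]; rfl
  rw [sqrtMulAdjoint_mul_self, ← h2] at h1
  exact (sq_eq_sq₀ (norm_nonneg _) (norm_nonneg _)).1 h1

theorem rangeNorm_apply_le (R : X →L[ℝ] X) (x : X) (hx : R x ∈ R.range) :
    rangeNorm R ⟨R x, hx⟩ ≤ ‖x‖ := by
  obtain ⟨hker, hR⟩ := (exists_pseudoInv R ⟨R x, hx⟩).choose_spec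
  change pseudoInv R ⟨R x, hx⟩ ∈ _ at hker
  change R (pseudoInv R ⟨R x, hx⟩) = _ at hR
  rw [rangeNorm]
  generalize pseudoInv R ⟨R x, hx⟩ = p at *
  have h0 : ⟪x - p, p⟫ = 0 := by
    refine hker _ ?_
    rw [LinearMap.mem_ker]
    simp [hR]
  rw [inner_sub_left, real_inner_self_eq_norm_sq, sub_eq_zero] at h0
  have h1 := real_inner_le_norm x p
  rw [h0, pow_two] at h1
  by_contra! hlt
  nlinarith [norm_nonneg x]

/-- Dual form of a bound for `A : H_R → H_S`. -/
theorem norm_adjoint_le_of_rangeNorm_le {A R S : X →L[ℝ] X} (hR : R.IsPositive)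
    (hS : S.IsPositive) {c : ℝ} (hc : 0 ≤ c) (hrange : ∀ y ∈ R.range, A y ∈ S.range)
    (hbound : ∀ y : R.range, rangeNorm S ⟨A y, hrange y y.2⟩ ≤ c * rangeNorm R y) (h : X) :
    ‖R (ContinuousLinearMap.adjoint A h)‖ ≤ c * ‖S h‖ := by
  set v := R (ContinuousLinearMap.adjoint A h) with hv
  have hmem : R v ∈ R.range := ⟨v, rfl⟩
  obtain ⟨hker, hSp⟩ := (exists_pseudoInv S ⟨A (R v), hrange _ hmem⟩).choose_spec
  change S (pseudoInv S ⟨A (R v), hrange _ hmem⟩) = A (R v) at hSp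
  have h1 : ‖pseudoInv S ⟨A (R v), hrange _ hmem⟩‖ ≤ c * ‖v‖ :=
    (hbound ⟨R v, hmem⟩).trans (mul_le_mul_of_nonneg_left (rangeNorm_apply_le R v hmem) hc)
  have h2 : ‖v‖ ^ 2 = ⟪S h, pseudoInv S ⟨A (R v), hrange _ hmem⟩⟫ := by
    have e1 : ⟪S h, pseudoInv S ⟨A (R v), hrange _ hmem⟩⟫ = ⟪h, A (R v)⟫ := by
      exact (hS.isSelfAdjoint.isSymmetric _ _).trans (congrArg (fun z => ⟪h, z⟫) hSp)
    rw [e1, ← ContinuousLinearMap.adjoint_inner_left, ← real_inner_self_eq_norm_sq]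
    exact hR.isSelfAdjoint.isSymmetric _ _
  have h3 : ‖v‖ ^ 2 ≤ ‖S h‖ * (c * ‖v‖) := by
    rw [h2]
    exact (real_inner_le_norm _ _).trans (mul_le_mul_of_nonneg_left h1 (norm_nonneg _))
  by_contra! hlt
  nlinarith [norm_nonneg v, mul_nonneg hc (norm_nonneg (S h))]

end Covariance

section EvolutionCovariance

variable {X : Type*} [NormedAddCommGroup X] [InnerProductSpace ℝ X] [CompleteSpace X]

/-- The operator `U(t,r) B(r)` by which the noise acting at time `r` enters the state at
time `t`. -/
noncomputable def noiseOp (U : ℝ → ℝ → X →L[ℝ] X) (B : ℝ → X →L[ℝ] X) (t r : ℝ) : X →L[ℝ] X :=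
  (U t r).comp (B r)

/-- The adjoint of `noiseOp`. -/
noncomputable def noiseAdj (U : ℝ → ℝ → X →L[ℝ] X) (B : ℝ → X →L[ℝ] X) (t r : ℝ) : X →L[ℝ] X :=
  ContinuousLinearMap.adjoint (noiseOp U B t r)

variable {U : ℝ → ℝ → X →L[ℝ] X} {B : ℝ → X →L[ℝ] X}

theorem noiseOp_noiseAdj (t r : ℝ) (x : X) : noiseOp U B t r (noiseAdj U B t r x) =
    U t r (B r (ContinuousLinearMap.adjoint (B r) (ContinuousLinearMap.adjoint (U t r) x))) := by
  rw [noiseAdj, noiseOp, ContinuousLinearMap.adjoint_comp]; rfl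

theorem inner_noiseOp_noiseAdj (t r : ℝ) (x y : X) :
    ⟪noiseOp U B t r (noiseAdj U B t r x), y⟫ = ⟪noiseAdj U B t r x, noiseAdj U B t r y⟫ :=
  (ContinuousLinearMap.adjoint_inner_right _ _ _).symm

theorem noiseAdj_eq_of_le (hU : IsEvolutionOperator U) {r s t : ℝ} (hrs : r ≤ s) (hst : s ≤ t)
    (h : X) : noiseAdj U B t r h = noiseAdj U B s r (ContinuousLinearMap.adjoint (U t s) h) := by
  rw [noiseAdj, noiseOp, ← hU.comp r s t hrs hst, ContinuousLinearMap.comp_assoc,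
    ContinuousLinearMap.adjoint_comp]; rfl

theorem noiseAdj_self (hU : IsEvolutionOperator U) (t : ℝ) (h : X) :
    noiseAdj U B t t h = ContinuousLinearMap.adjoint (B t) h := by
  rw [noiseAdj, noiseOp, hU.self, ContinuousLinearMap.id_comp]

omit [CompleteSpace X] in
theorem continuousOn_noiseOp (hU : IsEvolutionOperator U) (hB : IsNoiseFamily B) (t : ℝ) (e : X) :
    ContinuousOn (fun r => noiseOp U B t r e) (Set.Iic t) := by
  intro r₀ hr₀
  obtain ⟨M, hM, ζ, hg⟩ := hU.growth
  have h1 : Tendsto (fun r => U t r (B r₀ e)) (𝓝[Set.Iic t] r₀) (𝓝 (U t r₀ (B r₀ e))) := by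
    have hc : ContinuousOn (fun r => U t r (B r₀ e)) (Set.Iic t) :=
      (hU.continuousOn (B r₀ e)).comp (f := fun r : ℝ => (r, t)) (by fun_prop) fun r hr => hr
    exact hc r₀ hr₀
  have h2 : Tendsto (fun r => U t r (B r e - B r₀ e)) (𝓝[Set.Iic t] r₀) (𝓝 0) := by
    have h3 : Tendsto (fun r => M * Real.exp (-ζ * (t - r)) * ‖B r e - B r₀ e‖)
        (𝓝[Set.Iic t] r₀) (𝓝 (M * Real.exp (-ζ * (t - r₀)) * ‖B r₀ e - B r₀ e‖)) := by
      have hBe := hB.continuous e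
      have : Continuous fun r => M * Real.exp (-ζ * (t - r)) * ‖B r e - B r₀ e‖ := by fun_prop
      exact (this.tendsto r₀).mono_left nhdsWithin_le_nhds
    rw [sub_self, norm_zero, mul_zero] at h3
    refine squeeze_zero_norm' ?_ h3
    filter_upwards [self_mem_nhdsWithin] with r hr
    exact ((U t r).le_opNorm _).trans (by gcongr; exact hg r t hr)
  have h3 := h2.add h1
  rw [zero_add] at h3
  refine h3.congr fun r => ?_
  rw [map_sub, sub_add_cancel]; rfl

variable [TopologicalSpace.SeparableSpace X]

theorem aestronglyMeasurable_noiseAdj (hU : IsEvolutionOperator U) (hB : IsNoiseFamily B)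
    (t : ℝ) (x : X) :
    AEStronglyMeasurable (fun r => noiseAdj U B t r x) (volume.restrict (Set.Iic t)) := by
  refine aestronglyMeasurable_of_inner fun e => ?_
  have : ContinuousOn (fun r => ⟪e, noiseAdj U B t r x⟫) (Set.Iic t) := by
    have h1 : ∀ r, ⟪e, noiseAdj U B t r x⟫ = ⟪noiseOp U B t r e, x⟫ := fun r =>
      ContinuousLinearMap.adjoint_inner_right _ _ _
    simp only [h1]
    exact (continuousOn_noiseOp hU hB t e).inner continuousOn_const
  exact this.aestronglyMeasurable measurableSet_Iic

theorem aestronglyMeasurable_noiseOp_noiseAdj (hU : IsEvolutionOperator U)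
    (hB : IsNoiseFamily B) (t : ℝ) (x : X) :
    AEStronglyMeasurable (fun r => noiseOp U B t r (noiseAdj U B t r x))
      (volume.restrict (Set.Iic t)) := by
  refine aestronglyMeasurable_of_inner fun e => ?_
  simp only [real_inner_comm _ e, inner_noiseOp_noiseAdj]
  exact (aestronglyMeasurable_noiseAdj hU hB t x).inner (aestronglyMeasurable_noiseAdj hU hB t e)

/-- The dual form of the hypothesis on `‖U(t,r)‖` as an operator from `H_r` to `H_t`. -/
def DecayBound (U : ℝ → ℝ → X →L[ℝ] X) (B : ℝ → X →L[ℝ] X) (C η α : ℝ) : Prop :=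
  ∀ r t, r < t → ∀ h, ‖noiseAdj U B t r h‖ ≤
    C * (Real.exp (-η * (t - r)) / (t - r) ^ α) * ‖ContinuousLinearMap.adjoint (B t) h‖

omit [TopologicalSpace.SeparableSpace X] in
theorem decayBound_of_rangeNorm_le (hrange : ∀ s t, s < t → ∀ y ∈ (sqrtMulAdjoint (B s)).range,
      U t s y ∈ (sqrtMulAdjoint (B t)).range) {C η α : ℝ} (hC : 0 < C)
    (hbound : ∀ s t (h : s < t) (y : (sqrtMulAdjoint (B s)).range),
      rangeNorm (sqrtMulAdjoint (B t)) ⟨U t s y, hrange s t h y y.2⟩ ≤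
        C * (Real.exp (-η * (t - s)) / (t - s) ^ α) * rangeNorm (sqrtMulAdjoint (B s)) y) :
    DecayBound U B C η α := fun r t hrt h => by
  have hpos : 0 < t - r := sub_pos.2 hrt
  have := norm_adjoint_le_of_rangeNorm_le (sqrtMulAdjoint_isPositive (B r))
    (sqrtMulAdjoint_isPositive (B t)) (by positivity) (hrange r t hrt) (hbound r t hrt) h
  rw [norm_sqrtMulAdjoint_apply, norm_sqrtMulAdjoint_apply] at this
  rwa [noiseAdj, noiseOp, ContinuousLinearMap.adjoint_comp]

variable {C η α : ℝ}

/-- The covariance integral over a set of times before `t` defines a positive bounded operator. -/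
theorem exists_clm_covariance (hU : IsEvolutionOperator U) (hB : IsNoiseFamily B) (hη : 0 < η)
    (hα : α < 1 / 2) (hd : DecayBound U B C η α) (t : ℝ) {S : Set ℝ} (hSt : S ⊆ Set.Iic t) :
    ∃ Q : X →L[ℝ] X, Q.IsPositive ∧
      (∀ x, Q x = ∫ r in S, U t r (B r (ContinuousLinearMap.adjoint (B r)
        (ContinuousLinearMap.adjoint (U t r) x)))) ∧
      ∀ x, IntegrableOn (fun r => ‖noiseAdj U B t r x‖ ^ 2) S ∧
        ⟪Q x, x⟫ = ∫ r in S, ‖noiseAdj U B t r x‖ ^ 2 := by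
  obtain ⟨K, hK, hBK⟩ := hB.bounded
  have hc := (integrableOn_comp_sub_left (integrableOn_decay (C := C) hη hα).1 t).1
  have hmeas : volume.restrict S ≤ volume.restrict (Set.Iic t) := Measure.restrict_mono_set _ hSt
  have hN : ∀ᵐ r ∂(volume.restrict S), ∀ x, ‖(noiseOp U B t r).comp (noiseAdj U B t r) x‖ ≤
      K ^ 2 * (C * (Real.exp (-η * (t - r)) / (t - r) ^ α)) ^ 2 * ‖x‖ := by
    -- the bound holds off the null set `{t}`
    have hlt : ∀ᵐ r ∂(volume.restrict S), r < t := by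
      refine ae_mono hmeas ?_
      rw [← restrict_Iio_eq_restrict_Iic]
      exact ae_restrict_mem measurableSet_Iio
    filter_upwards [hlt] with r hr x
    have hadj : ∀ h, ‖ContinuousLinearMap.adjoint (B t) h‖ ≤ K * ‖h‖ := fun h =>
      (ContinuousLinearMap.le_opNorm _ _).trans (by
        rw [LinearIsometryEquiv.norm_map]; gcongr; exact hBK t)
    set c := C * (Real.exp (-η * (t - r)) / (t - r) ^ α) with hcdef
    have hn : ‖noiseAdj U B t r‖ ≤ |c| * K :=
      ContinuousLinearMap.opNorm_le_bound _ (by positivity) fun h => (hd r t hr h).trans (by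
        rw [mul_assoc |c|]
        exact mul_le_mul (le_abs_self c) (hadj h) (norm_nonneg _) (abs_nonneg _))
    have hn' : ‖noiseOp U B t r‖ ≤ |c| * K := by
      rwa [noiseAdj, LinearIsometryEquiv.norm_map] at hn
    calc ‖noiseOp U B t r (noiseAdj U B t r x)‖ ≤ (|c| * K) * ((|c| * K) * ‖x‖) :=
          (ContinuousLinearMap.le_of_opNorm_le _ hn' _).trans
            (by gcongr; exact ContinuousLinearMap.le_of_opNorm_le _ hn _)
      _ = K ^ 2 * |c| ^ 2 * ‖x‖ := by ring
      _ = _ := by rw [sq_abs]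
  have hpos : ∀ r, ((noiseOp U B t r).comp (noiseAdj U B t r)).IsPositive := fun r => by
    rw [ContinuousLinearMap.isPositive_iff]
    refine ⟨fun x y => ?_, fun x => ?_⟩
    · simp only [ContinuousLinearMap.coe_coe, ContinuousLinearMap.comp_apply]
      rw [inner_noiseOp_noiseAdj, real_inner_comm _ x, inner_noiseOp_noiseAdj, real_inner_comm]
    · simp only [ContinuousLinearMap.comp_apply]
      rw [inner_noiseOp_noiseAdj]
      exact real_inner_self_nonneg
  obtain ⟨Q, hQ, hQx, hQi⟩ := exists_clm_integral (μ := volume.restrict S)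
    (N := fun r => (noiseOp U B t r).comp (noiseAdj U B t r))
    (g := fun r => K ^ 2 * (C * (Real.exp (-η * (t - r)) / (t - r) ^ α)) ^ 2)
    (fun x => (aestronglyMeasurable_noiseOp_noiseAdj hU hB t x).mono_measure hmeas)
    ((hc.mono_set hSt).const_mul _) hN hpos
  refine ⟨Q, hQ, fun x => ?_, fun x => ?_⟩
  · rw [hQx]
    simp only [← noiseOp_noiseAdj]; rfl
  · have := hQi x x
    simp only [ContinuousLinearMap.comp_apply, inner_noiseOp_noiseAdj,
      real_inner_self_eq_norm_sq] at this
    exact this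

theorem exists_clm_covOpInfty (hU : IsEvolutionOperator U) (hB : IsNoiseFamily B) (hη : 0 < η)
    (hα : α < 1 / 2) (hd : DecayBound U B C η α) (t : ℝ) :
    ∃ Q : X →L[ℝ] X, Q.IsPositive ∧ covOpInfty U B t = Q ∧
      ∀ x, IntegrableOn (fun r => ‖noiseAdj U B t r x‖ ^ 2) (Set.Iic t) ∧
        ⟪covOpInfty U B t x, x⟫ = ∫ r in Set.Iic t, ‖noiseAdj U B t r x‖ ^ 2 := by
  obtain ⟨Q, hQ, hQx, hQi⟩ := exists_clm_covariance hU hB hη hα hd t subset_rfl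
  have e : covOpInfty U B t = Q := funext fun x => (hQx x).symm
  exact ⟨Q, hQ, e, fun x => by rw [e]; exact hQi x⟩

theorem exists_clm_covOp (hU : IsEvolutionOperator U) (hB : IsNoiseFamily B) (hη : 0 < η)
    (hα : α < 1 / 2) (hd : DecayBound U B C η α) {s t : ℝ} (hst : s ≤ t) :
    ∃ Q : X →L[ℝ] X, Q.IsPositive ∧ covOp U B t s = Q ∧
      ∀ x, ⟪covOp U B t s x, x⟫ = ∫ r in Set.Ioc s t, ‖noiseAdj U B t r x‖ ^ 2 := by
  obtain ⟨Q, hQ, hQx, hQi⟩ := exists_clm_covariance hU hB hη hα hd t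
    (S := Set.Ioc s t) fun r hr => hr.2
  have e : covOp U B t s = Q := funext fun x => by
    rw [hQx, covOp, intervalIntegral.integral_of_le hst]
  exact ⟨Q, hQ, e, fun x => by rw [e]; exact (hQi x).2⟩

/-- The accumulated noise is controlled by the instantaneous one:
`⟪Q(t,-∞) h, h⟫ ≤ κ ‖B(t)⋆ h‖²`, the constant `κ` being the integral of the squared decay rate. -/
theorem inner_covOpInfty_le (hU : IsEvolutionOperator U) (hB : IsNoiseFamily B) (hη : 0 < η)
    (hα : α < 1 / 2) (hd : DecayBound U B C η α) (t : ℝ) (h : X) :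
    ⟪covOpInfty U B t h, h⟫ ≤ C ^ 2 * (2 * η) ^ (2 * α - 1) * Real.Gamma (1 - 2 * α) *
      ‖ContinuousLinearMap.adjoint (B t) h‖ ^ 2 := by
  obtain ⟨Q, hQ, -, hQi⟩ := exists_clm_covOpInfty hU hB hη hα hd t
  obtain ⟨hi, he⟩ := hQi h
  obtain ⟨hc, hcv⟩ := integrableOn_decay (C := C) hη hα
  obtain ⟨hc', hcv'⟩ := integrableOn_comp_sub_left hc t
  rw [he, ← hcv, ← hcv', ← integral_mul_const, integral_Iic_eq_integral_Iio,
    integral_Iic_eq_integral_Iio]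
  refine setIntegral_mono_on (hi.mono_set Set.Iio_subset_Iic_self)
    ((hc'.mono_set Set.Iio_subset_Iic_self).mul_const _) measurableSet_Iio fun r hr => ?_
  rw [← mul_pow]
  exact pow_le_pow_left₀ (norm_nonneg _) (hd r t hr h) 2

/-- The evolution contracts the covariances `Q(t,-∞)` exponentially. -/
theorem exp_mul_inner_covOpInfty_le (hU : IsEvolutionOperator U) (hB : IsNoiseFamily B)
    (hη : 0 < η) (hα : α < 1 / 2) (hd : DecayBound U B C η α) {κ : ℝ} (hκ0 : 0 < κ)
    (hκ : κ = C ^ 2 * (2 * η) ^ (2 * α - 1) * Real.Gamma (1 - 2 * α)) {s t : ℝ} (hst : s ≤ t)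
    (h : X) :
    Real.exp ((t - s) / κ) * ⟪covOpInfty U B s (ContinuousLinearMap.adjoint (U t s) h),
      ContinuousLinearMap.adjoint (U t s) h⟫ ≤ ⟪covOpInfty U B t h, h⟫ := by
  have hG : ∀ r ≤ t, ⟪covOpInfty U B r (ContinuousLinearMap.adjoint (U t r) h),
      ContinuousLinearMap.adjoint (U t r) h⟫ =
        ∫ σ in Set.Iic r, ‖noiseAdj U B t σ h‖ ^ 2 := fun r hr => by
    obtain ⟨Q, -, -, hQi⟩ := exists_clm_covOpInfty hU hB hη hα hd r
    rw [(hQi _).2]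
    exact setIntegral_congr_fun measurableSet_Iic fun σ hσ => by
      simp only [noiseAdj_eq_of_le hU hσ hr h]
  obtain ⟨Q, -, -, hQi⟩ := exists_clm_covOpInfty hU hB hη hα hd t
  rw [hG s hst, (hQi h).2]
  refine exp_mul_setIntegral_Iic_le hκ0 hst (fun r => by positivity) (hQi h).1 fun r hr => ?_
  rw [← hG r hr, noiseAdj_eq_of_le hU le_rfl hr h, noiseAdj_self hU, hκ]
  exact inner_covOpInfty_le hU hB hη hα hd r _

/-- `Q(t,-∞) = Q(t,s) + U(t,s) Q(s,-∞) U(t,s)⋆`, as quadratic forms. -/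
theorem inner_covOpInfty_eq_add (hU : IsEvolutionOperator U) (hB : IsNoiseFamily B)
    (hη : 0 < η) (hα : α < 1 / 2) (hd : DecayBound U B C η α) {s t : ℝ} (hst : s ≤ t) (h : X) :
    ⟪covOpInfty U B t h, h⟫ = ⟪covOp U B t s h, h⟫ +
      ⟪covOpInfty U B s (ContinuousLinearMap.adjoint (U t s) h),
        ContinuousLinearMap.adjoint (U t s) h⟫ := by
  obtain ⟨Q, -, -, hQi⟩ := exists_clm_covOpInfty hU hB hη hα hd t
  obtain ⟨Q', -, -, hQi'⟩ := exists_clm_covOpInfty hU hB hη hα hd s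
  obtain ⟨Q'', -, -, hQi''⟩ := exists_clm_covOp hU hB hη hα hd hst
  rw [(hQi h).2, hQi'', (hQi' _).2, ← Set.Iic_union_Ioc_eq_Iic hst,
    setIntegral_union (Set.Iic_disjoint_Ioc le_rfl) measurableSet_Ioc
      ((hQi h).1.mono_set (Set.Iic_subset_Iic.2 hst)) ((hQi h).1.mono_set fun x hx => hx.2),
    add_comm]
  congr 1
  exact setIntegral_congr_fun measurableSet_Iic fun σ hσ => by
    simp only [noiseAdj_eq_of_le hU hσ hst h]

/-- Each diagonal entry of `Q(t,-∞)` is the limit of those of `Q(t,s)` as `s → -∞`, so that the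
traces of the `Q(t,s)` bound all finite partial sums of its trace. -/
theorem opTrace_covOpInfty_lt_top (hU : IsEvolutionOperator U) (hB : IsNoiseFamily B)
    (hη : 0 < η) (hα : α < 1 / 2) (hd : DecayBound U B C η α)
    (hsup : ∀ t, ∃ c : ℝ, ∀ s, s < t → opTrace (covOp U B t s) ≤ ENNReal.ofReal c) (t : ℝ) :
    opTrace (covOpInfty U B t) < ∞ := by
  obtain ⟨c, hc⟩ := hsup t
  obtain ⟨Q, -, -, hQi⟩ := exists_clm_covOpInfty hU hB hη hα hd t
  refine lt_of_le_of_lt ?_ (ENNReal.ofReal_lt_top (r := c))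
  rw [opTrace, ENNReal.tsum_eq_iSup_sum]
  refine iSup_le fun F => ?_
  have hlim : ∀ e : X, Tendsto (fun s => ⟪covOp U B t s e, e⟫) atBot
      (𝓝 ⟪covOpInfty U B t e, e⟫) := fun e => by
    rw [(hQi e).2]
    refine (intervalIntegral_tendsto_integral_Iic t (hQi e).1 tendsto_id).congr' ?_
    filter_upwards [eventually_lt_atBot t] with s hs
    obtain ⟨Q'', -, -, hQi''⟩ := exists_clm_covOp hU hB hη hα hd hs.le
    rw [hQi'', id, intervalIntegral.integral_of_le hs.le]
  refine le_of_tendsto (tendsto_finsetSum F fun e _ =>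
    (ENNReal.continuous_ofReal.tendsto _).comp (hlim e)) ?_
  filter_upwards [eventually_lt_atBot t] with s hs
  exact (ENNReal.sum_le_tsum F).trans (hc s hs)

end EvolutionCovariance

/-! ### Characteristic functions and second moments of centred Gaussian measures -/

section GaussianFacts

open ProbabilityTheory

variable {X : Type*} [NormedAddCommGroup X] [InnerProductSpace ℝ X] [CompleteSpace X]
  [MeasurableSpace X] [BorelSpace X] [SecondCountableTopology X]

omit [CompleteSpace X] [SecondCountableTopology X] in
theorem IsGaussianWith.map_inner {Q : X →L[ℝ] X} (hQ : Q.IsPositive) {μ : Measure X}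
    (h : IsGaussianWith 0 Q μ) (x : X) :
    μ.map (fun y => ⟪y, x⟫) = gaussianReal 0 (⟪Q x, x⟫).toNNReal := by
  have := h.1
  have hm : AEMeasurable (fun y : X => ⟪y, x⟫) μ :=
    (by fun_prop : Continuous fun y : X => ⟪y, x⟫).measurable.aemeasurable
  have : IsProbabilityMeasure (μ.map (fun y => ⟪y, x⟫)) := Measure.isProbabilityMeasure_map hm
  refine Measure.ext_of_charFun (funext fun r => ?_)
  rw [charFun_gaussianReal, charFun_apply, integral_map hm (by fun_prop)]
  have h1 := h.2 (r • x)
  rw [charFun_apply] at h1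
  have hpos : 0 ≤ ⟪Q x, x⟫ := hQ.inner_nonneg_left x
  rw [Real.coe_toNNReal _ hpos]
  simp only [inner_smul_right, map_smul, inner_smul_left, inner_zero_left, conj_trivial] at h1
  simp only [RCLike.inner_apply, conj_trivial]
  rw [h1]
  congr 1
  push_cast
  ring

omit [SecondCountableTopology X] in
theorem IsGaussianWith.isGaussian {Q : X →L[ℝ] X} (hQ : Q.IsPositive) {μ : Measure X}
    (h : IsGaussianWith 0 Q μ) : IsGaussian μ := by
  refine isGaussian_of_map_eq_gaussianReal fun L => ?_
  have hL : (L : X → ℝ) = fun y => ⟪y, (InnerProductSpace.toDual ℝ X).symm L⟫ := by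
    ext y
    rw [real_inner_comm, InnerProductSpace.toDual_symm_apply]
  rw [hL]
  exact ⟨0, _, h.map_inner hQ _⟩

omit [CompleteSpace X] [SecondCountableTopology X] in
theorem IsGaussianWith.integral_inner {Q : X →L[ℝ] X} (hQ : Q.IsPositive) {μ : Measure X}
    (h : IsGaussianWith 0 Q μ) (x : X) : ∫ y, ⟪y, x⟫ ∂μ = 0 := by
  have h1 := integral_map (μ := μ) (φ := fun y : X => ⟪y, x⟫) (f := fun r : ℝ => r)
    (by fun_prop : Continuous fun y : X => ⟪y, x⟫).measurable.aemeasurable (by fun_prop)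
  rw [← h1, h.map_inner hQ, integral_id_gaussianReal]

theorem IsGaussianWith.integral_id {Q : X →L[ℝ] X} (hQ : Q.IsPositive) {μ : Measure X}
    (h : IsGaussianWith 0 Q μ) : μ[id] = 0 := by
  have := h.isGaussian hQ
  refine ext_inner_right ℝ fun x => ?_
  rw [inner_zero_left, real_inner_comm, ← h.integral_inner hQ x,
    ← _root_.integral_inner IsGaussian.integrable_id]
  simp only [id, real_inner_comm]

omit [CompleteSpace X] [SecondCountableTopology X] in
theorem IsGaussianWith.integral_inner_sq {Q : X →L[ℝ] X} (hQ : Q.IsPositive) {μ : Measure X}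
    (h : IsGaussianWith 0 Q μ) (x : X) : ∫ y, ⟪y, x⟫ ^ 2 ∂μ = ⟪Q x, x⟫ := by
  have h1 := integral_map (μ := μ) (φ := fun y : X => ⟪y, x⟫) (f := fun r : ℝ => r ^ 2)
    (by fun_prop : Continuous fun y : X => ⟪y, x⟫).measurable.aemeasurable (by fun_prop)
  have h2 := variance_id_gaussianReal (μ := 0) (v := (⟪Q x, x⟫).toNNReal)
  rw [variance_of_integral_eq_zero aemeasurable_id (by simp)] at h2
  rw [← h1, h.map_inner hQ]
  rw [Real.coe_toNNReal _ (hQ.inner_nonneg_left x)] at h2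
  simpa using h2

omit [CompleteSpace X] [SecondCountableTopology X] in
theorem IsGaussianWith.map_const_add {Q : X → X} {μ : Measure X}
    (h : IsGaussianWith 0 Q μ) (m : X) : IsGaussianWith m Q (μ.map (m + ·)) := by
  have := h.1
  refine ⟨Measure.isProbabilityMeasure_map (by fun_prop), fun x => ?_⟩
  rw [charFun_map_const_add, h.2, ← Complex.exp_add]
  congr 1
  simp
  ring

/-- If the covariances satisfy `Q' = Q₁ + V Q V⋆`, the image of `γ ⊗ N` under
`(x, z) ↦ V x + z` is the Gaussian measure with covariance `Q'`. -/
theorem IsGaussianWith.map_add {Q Q₁ Q' : X → X} {γ N γ' : Measure X}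
    (hγ : IsGaussianWith 0 Q γ) (hN : IsGaussianWith 0 Q₁ N) (hγ' : IsGaussianWith 0 Q' γ')
    (V : X →L[ℝ] X) (hQ : ∀ h, ⟪Q' h, h⟫ = ⟪Q₁ h, h⟫ +
      ⟪Q (ContinuousLinearMap.adjoint V h), ContinuousLinearMap.adjoint V h⟫) :
    (γ.prod N).map (fun w => V w.1 + w.2) = γ' := by
  have := hγ.1
  have := hN.1
  have := hγ'.1
  have hm : Measurable fun w : X × X => V w.1 + w.2 :=
    (by fun_prop : Continuous fun w : X × X => V w.1 + w.2).measurable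
  have : IsProbabilityMeasure ((γ.prod N).map fun w => V w.1 + w.2) :=
    Measure.isProbabilityMeasure_map hm.aemeasurable
  refine Measure.ext_of_charFun (funext fun x => ?_)
  rw [charFun_apply, integral_map hm.aemeasurable (by fun_prop)]
  have h1 : ∀ w : X × X, Complex.exp ((⟪V w.1 + w.2, x⟫ : ℝ) * Complex.I) =
      Complex.exp ((⟪w.1, ContinuousLinearMap.adjoint V x⟫ : ℝ) * Complex.I) *
        Complex.exp ((⟪w.2, x⟫ : ℝ) * Complex.I) := fun w => by
    rw [← Complex.exp_add, inner_add_left, ContinuousLinearMap.adjoint_inner_right]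
    push_cast
    ring_nf
  simp_rw [h1]
  rw [integral_prod_mul (fun y : X =>
    Complex.exp ((⟪y, ContinuousLinearMap.adjoint V x⟫ : ℝ) * Complex.I))
    (fun z : X => Complex.exp ((⟪z, x⟫ : ℝ) * Complex.I)), ← charFun_apply, ← charFun_apply,
    hγ.2, hN.2, hγ'.2, hQ, ← Complex.exp_add]
  congr 1
  simp only [inner_zero_left]
  push_cast
  ring

end GaussianFacts

/-! ### Hypercontractivity for smooth functions bounded below -/

section SmoothHypercontractivity

open ProbabilityTheory

variable {X : Type*} [NormedAddCommGroup X] [NormedSpace ℝ X] [CompleteSpace X]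
  [MeasurableSpace X] [BorelSpace X] [SecondCountableTopology X] {γ γ' N : Measure X}
  [IsGaussian γ] [IsGaussian N]

/-- The quadratic form in the Gaussian Hölder inequality for the pair `(V x + z, x)` under
`γ ⊗ N` is negative once `V` contracts covariances by the factor `ρ` and
`a b ρ ≤ (1 - a) (1 - b)`. -/
theorem integral_quadratic_le (hN : N[id] = 0) (V : X →L[ℝ] X)
    (hinv : (γ.prod N).map (fun w => V w.1 + w.2) = γ') {ρ a b : ℝ}
    (hV : ∀ L : X →L[ℝ] ℝ, ∫ x, L (V x) ^ 2 ∂γ ≤ ρ * ∫ x, L x ^ 2 ∂γ')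
    (ha0 : 0 < a) (hb0 : 0 < b) (hb1 : b < 1) (hab : a * b * ρ ≤ (1 - a) * (1 - b))
    (L M : X →L[ℝ] ℝ) :
    ∫ w, (a * b * (L (V w.1 + w.2) * M w.1) - a * (1 - a) / 2 * L (V w.1 + w.2) ^ 2 -
      b * (1 - b) / 2 * M w.1 ^ 2) ∂(γ.prod N) ≤ 0 := by
  have hLV : MemLp (fun w : X × X => L (V w.1)) 2 (γ.prod N) := IsGaussian.memLp_dual (γ.prod N)
    ((L.comp V).comp (ContinuousLinearMap.fst ℝ X X)) 2 (by simp)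
  have hM : MemLp (fun w : X × X => M w.1) 2 (γ.prod N) := IsGaussian.memLp_dual (γ.prod N)
    (M.comp (ContinuousLinearMap.fst ℝ X X)) 2 (by simp)
  have hL2 : MemLp (fun w : X × X => L w.2) 2 (γ.prod N) := IsGaussian.memLp_dual (γ.prod N)
    (L.comp (ContinuousLinearMap.snd ℝ X X)) 2 (by simp)
  have hLs : MemLp (fun w : X × X => L (V w.1 + w.2)) 2 (γ.prod N) := by
    simp only [map_add]
    exact MemLp.add (f := fun w : X × X => L (V w.1)) (g := fun w : X × X => L w.2) hLV hL2
  have i1 : Integrable (fun w : X × X => L (V w.1) * M w.1) (γ.prod N) := hLV.integrable_mul hM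
  have i2 : Integrable (fun w : X × X => L w.2 * M w.1) (γ.prod N) := hL2.integrable_mul hM
  have i3 : Integrable (fun w : X × X => L (V w.1 + w.2) ^ 2) (γ.prod N) := hLs.integrable_sq
  have i4 : Integrable (fun w : X × X => M w.1 ^ 2) (γ.prod N) := hM.integrable_sq
  have i5 : Integrable (fun w : X × X => L (V w.1) ^ 2) (γ.prod N) := hLV.integrable_sq
  -- the noise is independent of `x` and centred, so only `L (V x) * M x` contributes
  have e0 : ∫ w, L w.2 * M w.1 ∂(γ.prod N) = 0 := by
    have h1 : ∫ z, L z ∂N = 0 := by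
      rw [IsGaussian.integral_dual L]
      simp only [id] at hN
      rw [hN, map_zero]
    have h2 := integral_prod_mul (μ := γ) (ν := N) (fun x => M x) (fun z => L z)
    rw [h1, mul_zero] at h2
    rw [← h2]
    simp only [mul_comm]
  have e1 : ∫ w, L (V w.1) ^ 2 ∂(γ.prod N) ≤ ρ * ∫ w, L (V w.1 + w.2) ^ 2 ∂(γ.prod N) := by
    have h1 := integral_fun_fst (μ := γ) (ν := N) (fun x => L (V x) ^ 2)
    have h2 : ∫ x, L x ^ 2 ∂γ' = ∫ w, L (V w.1 + w.2) ^ 2 ∂(γ.prod N) := by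
      rw [← hinv, integral_map]
      · exact (by fun_prop : Continuous fun w : X × X => V w.1 + w.2).measurable.aemeasurable
      · exact (by fun_prop : Continuous fun x : X => L x ^ 2).aestronglyMeasurable
    rw [h1, ← h2]
    simpa using hV L
  -- Young's inequality with the weight that balances the `M`-term
  have e2 : ∫ w, a * b * (L (V w.1) * M w.1) ∂(γ.prod N) ≤
      ∫ w, (b * (1 - b) / 2 * M w.1 ^ 2 + a ^ 2 * b / (2 * (1 - b)) * L (V w.1) ^ 2)
        ∂(γ.prod N) := by
    refine integral_mono (i1.const_mul _) ((i4.const_mul _).add (i5.const_mul _)) fun w => ?_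
    have hb : (1 - b) ≠ 0 := by linarith
    have h1 : b * (1 - b) / 2 * M w.1 ^ 2 + a ^ 2 * b / (2 * (1 - b)) * L (V w.1) ^ 2 -
        a * b * (L (V w.1) * M w.1) =
        b / (2 * (1 - b)) * ((1 - b) * M w.1 - a * L (V w.1)) ^ 2 := by
      field_simp
      ring
    have h2 : 0 ≤ b / (2 * (1 - b)) * ((1 - b) * M w.1 - a * L (V w.1)) ^ 2 :=
      mul_nonneg (div_nonneg hb0.le (by linarith)) (sq_nonneg _)
    linarith
  have e3 : ∫ w, (b * (1 - b) / 2 * M w.1 ^ 2 + a ^ 2 * b / (2 * (1 - b)) * L (V w.1) ^ 2)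
      ∂(γ.prod N) = b * (1 - b) / 2 * ∫ w, M w.1 ^ 2 ∂(γ.prod N) +
        a ^ 2 * b / (2 * (1 - b)) * ∫ w, L (V w.1) ^ 2 ∂(γ.prod N) := by
    rw [integral_add (i4.const_mul _) (i5.const_mul _), integral_const_mul, integral_const_mul]
  have e4 : ∀ w : X × X, a * b * (L (V w.1 + w.2) * M w.1) - a * (1 - a) / 2 *
      L (V w.1 + w.2) ^ 2 - b * (1 - b) / 2 * M w.1 ^ 2 =
      (a * b * (L (V w.1) * M w.1) + a * b * (L w.2 * M w.1)) -
      (a * (1 - a) / 2 * L (V w.1 + w.2) ^ 2 + b * (1 - b) / 2 * M w.1 ^ 2) := fun w => by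
    rw [map_add]; ring
  simp_rw [e4]
  have i12 : Integrable (fun w : X × X => a * b * (L (V w.1) * M w.1) + a * b * (L w.2 * M w.1))
      (γ.prod N) := (i1.const_mul _).add (i2.const_mul _)
  have i34 : Integrable (fun w : X × X => a * (1 - a) / 2 * L (V w.1 + w.2) ^ 2 +
      b * (1 - b) / 2 * M w.1 ^ 2) (γ.prod N) := (i3.const_mul _).add (i4.const_mul _)
  rw [integral_sub i12 i34, integral_add (i1.const_mul _) (i2.const_mul _),
    integral_add (i3.const_mul _) (i4.const_mul _),
    integral_const_mul (a * b) (fun w : X × X => L w.2 * M w.1), e0,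
    integral_const_mul (a * (1 - a) / 2),
    integral_const_mul (b * (1 - b) / 2)]
  have hS : 0 ≤ ∫ w, L (V w.1 + w.2) ^ 2 ∂(γ.prod N) := integral_nonneg fun _ => sq_nonneg _
  have h6 : a ^ 2 * b / (2 * (1 - b)) * ∫ w, L (V w.1) ^ 2 ∂(γ.prod N) ≤
      a * (1 - a) / 2 * ∫ w, L (V w.1 + w.2) ^ 2 ∂(γ.prod N) := by
    have hb : 0 < 1 - b := by linarith
    calc _ ≤ a ^ 2 * b / (2 * (1 - b)) * (ρ * ∫ w, L (V w.1 + w.2) ^ 2 ∂(γ.prod N)) :=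
          mul_le_mul_of_nonneg_left e1 (by positivity)
      _ = a / (2 * (1 - b)) * (a * b * ρ) * ∫ w, L (V w.1 + w.2) ^ 2 ∂(γ.prod N) := by ring
      _ ≤ a / (2 * (1 - b)) * ((1 - a) * (1 - b)) * ∫ w, L (V w.1 + w.2) ^ 2 ∂(γ.prod N) :=
          mul_le_mul_of_nonneg_right (mul_le_mul_of_nonneg_left hab (by positivity)) hS
      _ = _ := by field_simp
  linarith

/-- The transition operator `f ↦ ∫ f (V x + z) dN(z)` of one step of the evolution. -/
noncomputable def transition (V : X →L[ℝ] X) (N : Measure X) (f : X → ℝ) (x : X) : ℝ :=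
  ∫ z, f (V x + z) ∂N

omit [CompleteSpace X] [IsGaussian N] in
theorem IsC11.exists_transition [IsProbabilityMeasure N] (V : X →L[ℝ] X) {f : X → ℝ}
    {f' : X → X →L[ℝ] ℝ} {K : ℝ} (hf : IsC11 f f' K) :
    ∃ g' K', IsC11 (transition V N f) g' K' :=
  ⟨_, _, (hf.average (ν := N) (A := fun z : X => z) continuous_id).comp_clm V⟩

omit [CompleteSpace X] [SecondCountableTopology X] [IsGaussian N] in
theorem le_transition [IsProbabilityMeasure N] (V : X →L[ℝ] X) {f : X → ℝ} {f' : X → X →L[ℝ] ℝ}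
    {K ε : ℝ} (hf : IsC11 f f' K) (hfε : ∀ x, ε ≤ f x) (x : X) : ε ≤ transition V N f x := by
  have h := integral_mono (μ := N) (integrable_const ε)
    (hf.integrable_comp (A := fun z => V x + z) (by fun_prop)) fun z => hfε (V x + z)
  rw [integral_const, probReal_univ, one_smul] at h
  exact h

/-- The Gaussian Hölder inequality with exponents `1 / q` and `1 - 1 / p`, applied to `f ^ q` and
`(P f) ^ p`, bounds `∫ (P f) ^ p` by `(∫ f ^ q) ^ (1 / q) * (∫ (P f) ^ p) ^ (1 - 1 / p)`. -/
theorem integral_transition_rpow_le_of_isC11 (hγ : γ[id] = 0) (hN : N[id] = 0) (V : X →L[ℝ] X)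
    (hinv : (γ.prod N).map (fun w => V w.1 + w.2) = γ') {ρ p q : ℝ}
    (hV : ∀ L : X →L[ℝ] ℝ, ∫ x, L (V x) ^ 2 ∂γ ≤ ρ * ∫ x, L x ^ 2 ∂γ')
    (hp : 1 < p) (hq : 1 < q) (hpq : (p - 1) * ρ ≤ q - 1) {f : X → ℝ} {f' : X → X →L[ℝ] ℝ}
    {K ε : ℝ} (hε : 0 < ε) (hf : IsC11 f f' K) (hfε : ∀ x, ε ≤ f x) :
    ∫ x, transition V N f x ^ p ∂γ ≤ (∫ x, f x ^ q ∂γ') ^ (p / q) := by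
  have hp0 : 0 < p := by linarith
  have hq0 : 0 < q := by linarith
  have hfp : ∀ x, 0 < f x := fun x => hε.trans_le (hfε x)
  obtain ⟨g', K', hg⟩ := hf.exists_transition (N := N) V
  have hgε := le_transition (N := N) V hf hfε
  have hgp : ∀ x, 0 < transition V N f x := fun x => hε.trans_le (hgε x)
  obtain ⟨_, _, hfq⟩ := hf.rpow hε hfε q
  obtain ⟨_, _, hgq⟩ := hg.rpow hε hgε p
  -- the pair `(x, z)` is centred
  have hν : (γ.prod N)[id] = 0 := by
    have h1 : Integrable (fun w : X × X => w) (γ.prod N) := IsGaussian.integrable_id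
    have h2 := (ContinuousLinearMap.fst ℝ X X).integral_comp_comm h1
    have h3 := (ContinuousLinearMap.snd ℝ X X).integral_comp_comm h1
    have h4 := integral_fun_fst (μ := γ) (ν := N) (fun x : X => x)
    have h5 := integral_fun_snd (μ := γ) (ν := N) (fun x : X => x)
    simp only [id] at hγ hN ⊢
    simp only [ContinuousLinearMap.coe_fst', ContinuousLinearMap.coe_snd'] at h2 h3
    rw [h4, hγ, smul_zero] at h2
    rw [h5, hN, smul_zero] at h3
    exact Prod.ext h2.symm h3.symm
  have hcont : Continuous fun w : X × X => V w.1 + w.2 := by fun_prop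
  have hab : 1 / q * (1 - 1 / p) * ρ ≤ (1 - 1 / q) * (1 - (1 - 1 / p)) := by
    have e1 : 1 / q * (1 - 1 / p) * ρ = 1 / (p * q) * ((p - 1) * ρ) := by field_simp
    have e2 : (1 - 1 / q) * (1 - (1 - 1 / p)) = 1 / (p * q) * (q - 1) := by field_simp; ring
    rw [e1, e2]
    exact mul_le_mul_of_nonneg_left hpq (by positivity)
  have hp1 : 1 / p < 1 := by rw [div_lt_one hp0]; exact hp
  have hp1' : 0 < 1 / p := by positivity
  have main := integral_rpow_mul_rpow_le (ν := γ.prod N) hν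
    (V.comp (ContinuousLinearMap.fst ℝ X X) + ContinuousLinearMap.snd ℝ X X)
    (ContinuousLinearMap.fst ℝ X X) (1 / q) (1 - 1 / p)
    (fun L M => integral_quadratic_le hN V hinv hV (by positivity) (by linarith)
      (by linarith) hab L M)
    (lt_min (Real.rpow_pos_of_pos hε q) (Real.rpow_pos_of_pos hε p)) hfq
    (fun x => (min_le_left _ _).trans (Real.rpow_le_rpow hε.le (hfε x) hq0.le)) hgq
    (fun x => (min_le_right _ _).trans (Real.rpow_le_rpow hε.le (hgε x) hp0.le))
  have hL : ∀ w : X × X, (f ((V.comp (ContinuousLinearMap.fst ℝ X X) +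
      ContinuousLinearMap.snd ℝ X X) w) ^ q) ^ (1 / q) *
      (transition V N f ((ContinuousLinearMap.fst ℝ X X) w) ^ p) ^ (1 - 1 / p) =
      f (V w.1 + w.2) * transition V N f w.1 ^ (p - 1) := fun w => by
    have e1 : (V.comp (ContinuousLinearMap.fst ℝ X X) + ContinuousLinearMap.snd ℝ X X) w =
      V w.1 + w.2 := rfl
    have e2 : (ContinuousLinearMap.fst ℝ X X) w = w.1 := rfl
    rw [e1, e2, ← Real.rpow_mul (hfp _).le, ← Real.rpow_mul (hgp _).le]
    have e3 : q * (1 / q) = 1 := by field_simp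
    have e4 : p * (1 - 1 / p) = p - 1 := by field_simp
    rw [e3, e4, Real.rpow_one]
  obtain ⟨_, K₁, hg1⟩ := hg.rpow hε hgε (p - 1)
  have hint : Integrable (fun w : X × X => f (V w.1 + w.2) * transition V N f w.1 ^ (p - 1))
      (γ.prod N) := by
    refine Integrable.of_bound (C := K * K₁) (Continuous.aestronglyMeasurable
      ((hf.continuous.comp hcont).mul (hg1.continuous.comp continuous_fst)))
      (ae_of_all _ fun w => ?_)
    rw [norm_mul]
    exact mul_le_mul (hf.bound _) (hg1.bound _) (norm_nonneg _) hf.nonneg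
  have hLHS : ∫ w, f (V w.1 + w.2) * transition V N f w.1 ^ (p - 1) ∂(γ.prod N) =
      ∫ x, transition V N f x ^ p ∂γ := by
    rw [integral_prod _ hint]
    refine integral_congr_ae (ae_of_all _ fun x => ?_)
    simp only
    rw [integral_mul_const]
    calc transition V N f x * transition V N f x ^ (p - 1)
        = transition V N f x ^ (1 : ℝ) * transition V N f x ^ (p - 1) := by rw [Real.rpow_one]
      _ = transition V N f x ^ p := by rw [← Real.rpow_add (hgp x)]; congr 1; ring
  have hI : ∫ w, f ((V.comp (ContinuousLinearMap.fst ℝ X X) +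
      ContinuousLinearMap.snd ℝ X X) w) ^ q ∂(γ.prod N) = ∫ x, f x ^ q ∂γ' := by
    rw [← hinv, integral_map hcont.measurable.aemeasurable hfq.continuous.aestronglyMeasurable]
    rfl
  have hJ : ∫ w, transition V N f ((ContinuousLinearMap.fst ℝ X X) w) ^ p ∂(γ.prod N) =
      ∫ x, transition V N f x ^ p ∂γ := by
    have := integral_fun_fst (μ := γ) (ν := N) (fun x => transition V N f x ^ p)
    simpa using this
  simp_rw [hL] at main
  rw [hLHS, hI, hJ] at main
  have hJpos : 0 < ∫ x, transition V N f x ^ p ∂γ := by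
    have h := integral_mono (μ := γ) (integrable_const (ε ^ p))
      (hgq.integrable_comp (A := fun x => x) continuous_id)
      fun x => Real.rpow_le_rpow hε.le (hgε x) hp0.le
    have h' : ε ^ p ≤ ∫ x, transition V N f x ^ p ∂γ := by simpa using h
    exact (Real.rpow_pos_of_pos hε p).trans_le h'
  have hInn : 0 ≤ ∫ x, f x ^ q ∂γ' := integral_nonneg fun x => Real.rpow_nonneg (hfp x).le q
  set J := ∫ x, transition V N f x ^ p ∂γ
  set I := ∫ x, f x ^ q ∂γ'
  -- divide `J ≤ I ^ (1 / q) * J ^ (1 - 1 / p)` by the last factor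
  have h1 : J ^ (1 / p) ≤ I ^ (1 / q) := by
    have h2 : J ^ (1 / p) * J ^ (1 - 1 / p) = J := by
      rw [← Real.rpow_add hJpos]; simp
    refine le_of_mul_le_mul_right (?_ : _ * J ^ (1 - 1 / p) ≤ _ * J ^ (1 - 1 / p))
      (Real.rpow_pos_of_pos hJpos _)
    rw [h2]
    exact main
  calc J = (J ^ (1 / p)) ^ p := by rw [← Real.rpow_mul hJpos.le]; field_simp; simp
    _ ≤ (I ^ (1 / q)) ^ p := Real.rpow_le_rpow (Real.rpow_nonneg hJpos.le _) h1 hp0.le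
    _ = I ^ (p / q) := by rw [← Real.rpow_mul hInn]; congr 1; ring

end SmoothHypercontractivity

/-! ### Removal of smoothness by bounded pointwise limits -/

theorem tendsto_integral_rpow {Ω : Type*} [MeasurableSpace Ω] {μ : Measure Ω}
    [IsProbabilityMeasure μ] {F : ℕ → Ω → ℝ} {f : Ω → ℝ} {C p : ℝ} (hp : 0 < p)
    (hm : ∀ n, Measurable (F n)) (h0 : ∀ n x, 0 ≤ F n x)
    (hC : ∀ n x, F n x ≤ C) (hlim : ∀ x, Tendsto (fun n => F n x) atTop (𝓝 (f x))) :
    Tendsto (fun n => ∫ x, F n x ^ p ∂μ) atTop (𝓝 (∫ x, f x ^ p ∂μ)) := by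
  refine tendsto_integral_of_dominated_convergence (fun _ => C ^ p)
    (fun n => ((hm n).pow_const p).aestronglyMeasurable) (integrable_const _)
    (fun n => ae_of_all _ fun x => ?_) (ae_of_all _ fun x => (hlim x).rpow_const (Or.inr hp.le))
  rw [Real.norm_of_nonneg (Real.rpow_nonneg (h0 n x) p)]
  exact Real.rpow_le_rpow (h0 n x) (hC n x) hp.le

section BoundedLimits

variable {X : Type*} [NormedAddCommGroup X] [NormedSpace ℝ X]
  [MeasurableSpace X] [BorelSpace X] [SecondCountableTopology X] {γ γ' N : Measure X}
  [IsProbabilityMeasure γ] [IsProbabilityMeasure γ'] [IsProbabilityMeasure N]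

omit [IsProbabilityMeasure N] in
theorem measurable_transition [SFinite N] (V : X →L[ℝ] X) {f : X → ℝ} (hf : Measurable f) :
    Measurable (transition V N f) := by
  have h : Measurable fun w : X × X => f (V w.1 + w.2) := hf.comp (by fun_prop)
  exact h.stronglyMeasurable.integral_prod_right.measurable

omit [BorelSpace X] [SecondCountableTopology X] in
theorem abs_transition_le (V : X →L[ℝ] X) {f : X → ℝ} {C : ℝ} (hC : ∀ x, |f x| ≤ C) (x : X) :
    |transition V N f x| ≤ C := by
  have := norm_integral_le_of_norm_le_const (μ := N) (f := fun z => f (V x + z)) (C := C)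
    (ae_of_all _ fun z => hC _)
  simpa [transition] using this

/-- The inequality `‖P f‖ₚ ≤ ‖f‖_q` passes to uniformly bounded pointwise limits of nonnegative
functions. -/
theorem integral_transition_rpow_le_of_tendsto (V : X →L[ℝ] X) {p q : ℝ} (hp : 0 < p) (hq : 0 < q)
    {F : ℕ → X → ℝ} {f : X → ℝ} {C : ℝ} (hm : ∀ n, Measurable (F n)) (h0 : ∀ n x, 0 ≤ F n x)
    (hC : ∀ n x, F n x ≤ C) (hlim : ∀ x, Tendsto (fun n => F n x) atTop (𝓝 (f x)))
    (h : ∀ n, ∫ x, transition V N (F n) x ^ p ∂γ ≤ (∫ x, F n x ^ q ∂γ') ^ (p / q)) :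
    ∫ x, transition V N f x ^ p ∂γ ≤ (∫ x, f x ^ q ∂γ') ^ (p / q) := by
  have hP : ∀ x, Tendsto (fun n => transition V N (F n) x) atTop (𝓝 (transition V N f x)) := by
    intro x
    refine tendsto_integral_of_dominated_convergence (fun _ => C)
      (fun n => ((hm n).comp (by fun_prop)).aestronglyMeasurable) (integrable_const _)
      (fun n => ae_of_all _ fun z => ?_) (ae_of_all _ fun z => hlim _)
    rw [Real.norm_of_nonneg (h0 n _)]
    exact hC n _
  have h1 := tendsto_integral_rpow (μ := γ) (F := fun n => transition V N (F n)) hp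
    (fun n => measurable_transition V (hm n)) (fun n x => integral_nonneg fun z => h0 n _)
    (fun n x => (le_abs_self _).trans (abs_transition_le V
      (fun y => (abs_of_nonneg (h0 n y)).trans_le (hC n y)) x)) hP
  have h2 := tendsto_integral_rpow (μ := γ') hq hm h0 hC hlim
  exact le_of_tendsto_of_tendsto' h1 (h2.rpow_const (Or.inr (by positivity))) h

end BoundedLimits

section SmoothApproximation

variable {F : Type*} [NormedAddCommGroup F] [NormedSpace ℝ F] [FiniteDimensional ℝ F]

/-- A bounded nonnegative continuous function on a finite-dimensional space is, up to a
positive constant, uniformly close on a ball to a nonnegative function of class `IsC11`. -/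
theorem exists_isC11_approx {f : F → ℝ} (hf : Continuous f) {C : ℝ} (h0 : ∀ x, 0 ≤ f x)
    (hC : ∀ x, f x ≤ C) {ε : ℝ} (hε : 0 < ε) (R : ℝ) :
    ∃ g g' K, IsC11 (E := F) g g' K ∧ (∀ x, ε ≤ g x) ∧ (∀ x, g x ≤ C + 3 * ε) ∧
      ∀ x, ‖x‖ ≤ R → |g x - f x| ≤ 3 * ε := by
  set χ : F → ℝ := fun x => max 0 (min 1 (R + 1 - ‖x‖)) with hχ
  have hχ0 : ∀ x, 0 ≤ χ x := fun x => le_max_left _ _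
  have hχ1 : ∀ x, χ x ≤ 1 := fun x => max_le zero_le_one (min_le_left _ _)
  have hcont : Continuous fun x => f x * χ x := by fun_prop
  obtain ⟨g, hg, hgf, hsupp⟩ := hcont.exists_contDiff_approx 2 (ε := fun _ => ε)
    continuous_const fun _ => hε
  have hs : HasCompactSupport g := by
    refine HasCompactSupport.of_support_subset_isCompact (isCompact_closedBall (0 : F) (R + 1))
      (hsupp.trans fun x hx => ?_)
    rw [mem_closedBall_zero_iff]
    by_contra hlt
    push Not at hlt
    refine hx ?_
    have : χ x = 0 := max_eq_left ((min_le_right _ _).trans (by linarith))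
    simp [this]
  obtain ⟨K, hK⟩ := IsC11.of_contDiff_of_hasCompactSupport hg hs
  have habs : ∀ x, |g x - f x * χ x| ≤ ε := fun x => (hgf x).le
  refine ⟨_, _, _, hK.add_const (2 * ε), fun x => ?_, fun x => ?_, fun x hx => ?_⟩
  · have := abs_le.1 (habs x)
    have := mul_nonneg (h0 x) (hχ0 x)
    linarith
  · have := abs_le.1 (habs x)
    have := mul_le_of_le_one_right (h0 x) (hχ1 x)
    linarith [hC x]
  · have : χ x = 1 := by
      simp only [hχ]
      rw [min_eq_left (by linarith), max_eq_right zero_le_one]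
    have h2 := abs_le.1 (habs x)
    rw [this, mul_one] at h2
    rw [abs_le]
    constructor <;> linarith

end SmoothApproximation

/-! ### The norm inequality for bounded continuous functions -/

section Hypercontractivity

open ProbabilityTheory

variable {X : Type*} [NormedAddCommGroup X] [InnerProductSpace ℝ X] [CompleteSpace X]
  [MeasurableSpace X] [BorelSpace X] [SecondCountableTopology X] {γ γ' N : Measure X}

omit [CompleteSpace X] [MeasurableSpace X] [BorelSpace X] in
/-- In a separable Hilbert space the identity is the pointwise limit of orthogonal projections
of finite rank. -/
theorem exists_starProjection_tendsto :
    ∃ S : ℕ → Submodule ℝ X, ∃ _ : ∀ n, FiniteDimensional ℝ (S n), ∀ x,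
      Tendsto (fun n => (S n).starProjection x) atTop (𝓝 x) := by
  have hfd : ∀ n : ℕ, FiniteDimensional ℝ
      (Submodule.span ℝ (TopologicalSpace.denseSeq X '' Set.Iio n)) := fun n =>
    FiniteDimensional.span_of_finite ℝ ((Set.finite_Iio n).image _)
  refine ⟨fun n => Submodule.span ℝ (TopologicalSpace.denseSeq X '' Set.Iio n), hfd, fun x => ?_⟩
  refine Submodule.starProjection_tendsto_self _ (fun m n h => Submodule.span_mono
    (Set.image_mono (Set.Iio_subset_Iio h))) x fun y _ => ?_
  have h1 : Set.range (TopologicalSpace.denseSeq X) ⊆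
      ((⨆ n : ℕ, Submodule.span ℝ (TopologicalSpace.denseSeq X '' Set.Iio n) : Submodule ℝ X) :
        Set X) := by
    rintro _ ⟨k, rfl⟩
    exact Submodule.mem_iSup_of_mem (k + 1)
      (Submodule.subset_span ⟨k, Set.mem_Iio.2 (Nat.lt_succ_self k), rfl⟩)
  exact closure_mono h1 ((TopologicalSpace.denseRange_denseSeq X) y)

variable [IsGaussian γ] [IsGaussian N] [IsProbabilityMeasure γ']

/-- A bounded continuous `f` is the limit of the cylindrical functions `f ∘ πₙ`, and each of
these is the limit of functions of class `IsC11` bounded below by positive constants. -/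
theorem integral_transition_rpow_le (hγ : γ[id] = 0) (hN : N[id] = 0) (V : X →L[ℝ] X)
    (hinv : (γ.prod N).map (fun w => V w.1 + w.2) = γ') {ρ p q : ℝ}
    (hV : ∀ L : X →L[ℝ] ℝ, ∫ x, L (V x) ^ 2 ∂γ ≤ ρ * ∫ x, L x ^ 2 ∂γ')
    (hp : 1 < p) (hq : 1 < q) (hpq : (p - 1) * ρ ≤ q - 1) {f : X → ℝ} (hf : Continuous f) {C : ℝ}
    (h0 : ∀ x, 0 ≤ f x) (hC : ∀ x, f x ≤ C) :
    ∫ x, transition V N f x ^ p ∂γ ≤ (∫ x, f x ^ q ∂γ') ^ (p / q) := by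
  have hp0 : 0 < p := by linarith
  have hq0 : 0 < q := by linarith
  obtain ⟨S, hS, hlim⟩ := exists_starProjection_tendsto (X := X)
  refine integral_transition_rpow_le_of_tendsto V hp0 hq0
    (F := fun n x => f ((S n).starProjection x)) (C := C)
    (fun n => (hf.comp (by fun_prop)).measurable) (fun n x => h0 _) (fun n x => hC _)
    (fun x => (hf.tendsto x).comp (hlim x)) fun n => ?_
  have hg : ∀ k : ℕ, ∃ g g' K, IsC11 (E := S n) g g' K ∧ (∀ x, 1 / ((k : ℝ) + 1) ≤ g x) ∧
      (∀ x, g x ≤ C + 3 * (1 / ((k : ℝ) + 1))) ∧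
      ∀ x, ‖x‖ ≤ (k : ℝ) → |g x - f x| ≤ 3 * (1 / ((k : ℝ) + 1)) := fun k =>
    exists_isC11_approx (hf.comp continuous_subtype_val) (fun x => h0 _) (fun x => hC _)
      (by positivity) k
  choose g g' K hgC hgε hgle hgf using hg
  have hcomp : ∀ k, ∃ h' K', IsC11 (fun x => g k ((S n).orthogonalProjectionOnto x)) h' K' :=
    fun k => ⟨_, _, (hgC k).comp_clm ((S n).orthogonalProjectionOnto)⟩
  have hpos : ∀ k : ℕ, 0 < 1 / ((k : ℝ) + 1) := fun k => by positivity
  refine integral_transition_rpow_le_of_tendsto V hp0 hq0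
    (F := fun k x => g k ((S n).orthogonalProjectionOnto x)) (C := C + 3)
    (fun k => ?_) (fun k x => (hpos k).le.trans (hgε k _)) (fun k x => ?_) (fun x => ?_) fun k => ?_
  · obtain ⟨_, _, hk⟩ := hcomp k
    exact hk.continuous.measurable
  · have h1 : 1 / ((k : ℝ) + 1) ≤ 1 := by
      rw [div_le_one (by positivity)]
      linarith [(Nat.cast_nonneg k : (0 : ℝ) ≤ k)]
    linarith [hgle k ((S n).orthogonalProjectionOnto x)]
  · rw [tendsto_iff_dist_tendsto_zero]
    have hz : Tendsto (fun k : ℕ => 3 * (1 / ((k : ℝ) + 1))) atTop (𝓝 0) := by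
      simpa using (tendsto_one_div_add_atTop_nhds_zero_nat (𝕜 := ℝ)).const_mul 3
    refine squeeze_zero' (Eventually.of_forall fun k => dist_nonneg) ?_ hz
    obtain ⟨k₀, hk₀⟩ := exists_nat_ge ‖(S n).orthogonalProjectionOnto x‖
    filter_upwards [eventually_ge_atTop k₀] with k hk
    exact hgf k _ (hk₀.trans (by exact_mod_cast hk))
  · obtain ⟨_, _, hk⟩ := hcomp k
    exact integral_transition_rpow_le_of_isC11 hγ hN V hinv hV hp hq hpq (hpos k) hk
      fun x => hgε k _

theorem eLpNorm_transition_le (hγ : γ[id] = 0) (hN : N[id] = 0) (V : X →L[ℝ] X)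
    (hinv : (γ.prod N).map (fun w => V w.1 + w.2) = γ') {ρ p q : ℝ}
    (hV : ∀ L : X →L[ℝ] ℝ, ∫ x, L (V x) ^ 2 ∂γ ≤ ρ * ∫ x, L x ^ 2 ∂γ')
    (hp : 1 < p) (hq : 1 < q) (hpq : (p - 1) * ρ ≤ q - 1) (f : X →ᵇ ℝ) :
    eLpNorm (transition V N f) (ENNReal.ofReal p) γ ≤ eLpNorm f (ENNReal.ofReal q) γ' := by
  have hp0 : 0 < p := by linarith
  have hq0 : 0 < q := by linarith
  have hc : Continuous fun x => |f x| := f.continuous.abs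
  have hle := integral_transition_rpow_le hγ hN V hinv hV hp hq hpq hc (fun x => abs_nonneg _)
    (fun x => f.norm_coe_le_norm x)
  have h1 : eLpNorm (transition V N f) (ENNReal.ofReal p) γ ≤
      eLpNorm (transition V N fun x => |f x|) (ENNReal.ofReal p) γ :=
    eLpNorm_mono_real fun x => norm_integral_le_integral_norm _
  have hbd : ∀ x, ‖transition V N (fun x => |f x|) x‖ ≤ ‖f‖ :=
    abs_transition_le V (fun x => (abs_abs _).trans_le (f.norm_coe_le_norm x))
  have hmem : MemLp (transition V N fun x => |f x|) (ENNReal.ofReal p) γ :=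
    MemLp.of_bound (measurable_transition V hc.measurable).aestronglyMeasurable ‖f‖
      (ae_of_all _ hbd)
  have hmemf : MemLp f (ENNReal.ofReal q) γ' :=
    MemLp.of_bound f.continuous.aestronglyMeasurable ‖f‖ (ae_of_all _ f.norm_coe_le_norm)
  refine h1.trans ?_
  rw [hmem.eLpNorm_eq_integral_rpow_norm (by simpa using hp0) (by simp),
    hmemf.eLpNorm_eq_integral_rpow_norm (by simpa using hq0) (by simp),
    ENNReal.toReal_ofReal hp0.le, ENNReal.toReal_ofReal hq0.le]
  refine ENNReal.ofReal_le_ofReal ?_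
  have hnn : ∀ x, 0 ≤ transition V N (fun x => |f x|) x := fun x =>
    integral_nonneg fun z => abs_nonneg _
  have h2 : ∀ x, ‖transition V N (fun x => |f x|) x‖ = transition V N (fun x => |f x|) x :=
    fun x => Real.norm_of_nonneg (hnn x)
  simp_rw [h2]
  have hI : 0 ≤ ∫ x, |f x| ^ q ∂γ' := integral_nonneg fun x => by positivity
  calc _ ≤ ((∫ x, |f x| ^ q ∂γ') ^ (p / q)) ^ p⁻¹ := Real.rpow_le_rpow
        (integral_nonneg fun x => Real.rpow_nonneg (hnn x) p) hle (by positivity)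
    _ = (∫ x, |f x| ^ q ∂γ') ^ q⁻¹ := by
        rw [← Real.rpow_mul hI]
        congr 1
        field_simp

end Hypercontractivity

/-! ### Extension to `L^q` -/

section Extension

variable {X : Type*} [NormedAddCommGroup X] [NormedSpace ℝ X]
  [MeasurableSpace X] [BorelSpace X] [SecondCountableTopology X] {γ γ' N : Measure X}
  [IsProbabilityMeasure γ] [IsProbabilityMeasure γ'] [IsProbabilityMeasure N]

omit [IsProbabilityMeasure γ'] in
theorem memLp_transition (V : X →L[ℝ] X) (r : ℝ≥0∞) (f : X →ᵇ ℝ) : MemLp (transition V N f) r γ :=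
  MemLp.of_bound (measurable_transition V f.continuous.measurable).aestronglyMeasurable ‖f‖
    (ae_of_all _ (abs_transition_le V f.norm_coe_le_norm))

omit [SecondCountableTopology X] in
theorem integrable_transition (V : X →L[ℝ] X) (f : X →ᵇ ℝ) (x : X) :
    Integrable (fun z => f (V x + z)) N :=
  Integrable.of_bound (f.continuous.comp (by fun_prop)).aestronglyMeasurable ‖f‖
    (ae_of_all _ fun z => f.norm_coe_le_norm _)

/-- The transition operator on bounded continuous functions, with values in `L^r(γ)`. -/
noncomputable def transitionLp (γ N : Measure X) [IsProbabilityMeasure γ] [IsProbabilityMeasure N]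
    (V : X →L[ℝ] X) (r : ℝ≥0∞) : (X →ᵇ ℝ) →ₗ[ℝ] Lp ℝ r γ where
  toFun f := (memLp_transition (N := N) V r f).toLp _
  map_add' f g := by
    rw [← MemLp.toLp_add]
    refine MemLp.toLp_congr _ _ (ae_of_all _ fun x => ?_)
    exact integral_add (integrable_transition V f x) (integrable_transition V g x)
  map_smul' c f := by
    rw [RingHom.id_apply, ← MemLp.toLp_const_smul]
    refine MemLp.toLp_congr _ _ (ae_of_all _ fun x => ?_)
    exact integral_const_mul c _

/-- A transition operator which is a contraction from `L^q` to `L^q` and to `L^p` on bounded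
continuous functions extends uniquely to `L^q`, and the `L^p` bound persists by Fatou's lemma. -/
theorem exists_extension (V : X →L[ℝ] X) {p q : ℝ≥0∞} [Fact (1 ≤ q)] (hq : q ≠ ∞)
    (hqq : ∀ f : X →ᵇ ℝ, eLpNorm (transition V N f) q γ ≤ eLpNorm f q γ')
    (hpq : ∀ f : X →ᵇ ℝ, eLpNorm (transition V N f) p γ ≤ eLpNorm f q γ') :
    ∃ T : Lp ℝ q γ' →L[ℝ] Lp ℝ q γ,
      (∀ (φ : Lp ℝ q γ') (f : X →ᵇ ℝ), φ =ᵐ[γ'] f → T φ =ᵐ[γ] transition V N f) ∧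
      (∀ T' : Lp ℝ q γ' →L[ℝ] Lp ℝ q γ,
        (∀ (φ : Lp ℝ q γ') (f : X →ᵇ ℝ), φ =ᵐ[γ'] f → T' φ =ᵐ[γ] transition V N f) → T' = T) ∧
      ∀ φ : Lp ℝ q γ', eLpNorm (T φ) p γ ≤ eLpNorm φ q γ' := by
  set e := BoundedContinuousFunction.toLp (E := ℝ) q γ' ℝ with he
  have hdense : DenseRange e := BoundedContinuousFunction.toLp_denseRange ℝ γ' ℝ hq
  have hef : ∀ f : X →ᵇ ℝ, e f =ᵐ[γ'] f := BoundedContinuousFunction.coeFn_toLp q γ' ℝ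
  set P := transitionLp γ N V q with hP
  have hPf : ∀ f : X →ᵇ ℝ, P f =ᵐ[γ] transition V N f := fun f =>
    (memLp_transition (N := N) V q f).coeFn_toLp
  have hnorm : ∀ f, ‖P f‖ ≤ 1 * ‖(e : (X →ᵇ ℝ) →ₗ[ℝ] Lp ℝ q γ') f‖ := fun f => by
    rw [one_mul, ContinuousLinearMap.coe_coe, Lp.norm_def, Lp.norm_def, eLpNorm_congr_ae (hPf f),
      eLpNorm_congr_ae (hef f)]
    refine ENNReal.toReal_mono ?_ (hqq f)
    rw [← eLpNorm_congr_ae (hef f)]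
    exact Lp.eLpNorm_ne_top _
  set T : Lp ℝ q γ' →L[ℝ] Lp ℝ q γ := P.extendOfNorm (e : (X →ᵇ ℝ) →ₗ[ℝ] Lp ℝ q γ') with hT
  have hTe : ∀ f, T (e f) = P f := fun f =>
    LinearMap.extendOfNorm_eq (e := (e : (X →ᵇ ℝ) →ₗ[ℝ] Lp ℝ q γ')) hdense ⟨1, hnorm⟩ f
  have heq : ∀ (φ : Lp ℝ q γ') (f : X →ᵇ ℝ), φ =ᵐ[γ'] f → φ = e f := fun φ f h =>
    Lp.ext (h.trans (hef f).symm)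
  refine ⟨T, fun φ f h => ?_, fun T' hT' => ?_, fun φ => ?_⟩
  · rw [heq φ f h, hTe]
    exact hPf f
  · refine ContinuousLinearMap.coeFn_injective (hdense.equalizer T'.continuous T.continuous
      (funext fun f => ?_))
    exact Lp.ext ((hT' _ f (hef f)).trans
      (by simpa only [Function.comp_apply, hTe] using (hPf f).symm))
  · obtain ⟨u, hu, hulim⟩ := mem_closure_iff_seq_limit.1 (hdense φ)
    choose f hf using hu
    have h1 : Tendsto (fun n => T (u n)) atTop (𝓝 (T φ)) := (T.continuous.tendsto φ).comp hulim
    obtain ⟨ns, hns, hae⟩ := (tendstoInMeasure_of_tendsto_Lp h1).exists_seq_tendsto_ae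
    have h2 := Lp.eLpNorm_lim_le_liminf_eLpNorm (p := p)
      (fun n => (Lp.aestronglyMeasurable (T (u (ns n))))) (T φ) hae
    have h3 : Tendsto (fun n => eLpNorm (u (ns n)) q γ') atTop (𝓝 (eLpNorm φ q γ')) := by
      have h4 := ((continuous_enorm.tendsto φ).comp hulim).comp hns.tendsto_atTop
      simpa [Function.comp_def, Lp.enorm_def] using h4
    refine h2.trans ?_
    rw [← h3.liminf_eq]
    refine liminf_le_liminf (Eventually.of_forall fun n => ?_)
    rw [← hf (ns n), hTe, eLpNorm_congr_ae (hPf _), eLpNorm_congr_ae (hef _)]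
    exact hpq _

end Extension

/-! ### The evolution operator as a transition operator -/

section EvolutionMeasures

variable {X : Type*} [NormedAddCommGroup X] [InnerProductSpace ℝ X] [CompleteSpace X]
  [SecondCountableTopology X] [MeasurableSpace X] [BorelSpace X]
  {U : ℝ → ℝ → X →L[ℝ] X} {B : ℝ → X →L[ℝ] X} {C η α : ℝ}

theorem isGaussianWith_gaussianMeasure {Q : X →L[ℝ] X} (hQ : Q.IsPositive)
    (htr : opTrace Q < ∞) : IsGaussianWith 0 Q (gaussianMeasure 0 Q) := by
  obtain ⟨μ, hμ⟩ := exists_isGaussianWith hQ htr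
  rwa [gaussianMeasure_eq hμ]

theorem evolP_eq_transition {s t : ℝ}
    (h : IsGaussianWith 0 (covOp U B t s) (gaussianMeasure 0 (covOp U B t s))) (f : X →ᵇ ℝ) :
    evolP U B s t f = transition (U t s) (gaussianMeasure 0 (covOp U B t s)) f := by
  funext x
  rw [evolP, gaussianMeasure_eq (h.map_const_add (U t s x)),
    integral_map (by fun_prop) f.continuous.aestronglyMeasurable]
  rfl

end EvolutionMeasures

end NonautOU

open NonautOU in
theorem theorem6p5 {X : Type*} [NormedAddCommGroup X] [InnerProductSpace ℝ X] [CompleteSpace X]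
    [TopologicalSpace.SeparableSpace X] [MeasurableSpace X] [BorelSpace X]
    (U : ℝ → ℝ → X →L[ℝ] X) (B : ℝ → X →L[ℝ] X) (A : ℝ → X →ₗ.[ℝ] X)
    (hU : IsEvolutionOperator U) (hB : IsNoiseFamily B)
    (htrace : ∀ s t, s < t → opTrace (covOp U B t s) < ∞)
    (hA : IsGeneratingFamily U A)
    (hsup : ∀ t, ∃ c : ℝ, ∀ s, s < t → opTrace (covOp U B t s) ≤ ENNReal.ofReal c)
    (hdecay : ∀ (t : ℝ) (x : X), Tendsto (fun s => U t s x) atBot (𝓝 0))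
    (hrange : ∀ s t, s < t → ∀ y ∈ (sqrtMulAdjoint (B s)).range,
      U t s y ∈ (sqrtMulAdjoint (B t)).range)
    (C η α : ℝ) (hC : 0 < C) (hη : 0 < η) (hα : α ∈ Set.Ico (0 : ℝ) (1 / 2))
    (hbound : ∀ s t (h : s < t) (y : (sqrtMulAdjoint (B s)).range),
      rangeNorm (sqrtMulAdjoint (B t)) ⟨U t s y, hrange s t h y y.2⟩ ≤
        C * (Real.exp (-η * (t - s)) / (t - s) ^ α) * rangeNorm (sqrtMulAdjoint (B s)) y)
    (κ : ℝ) (hκ : κ = C ^ 2 * (2 * η) ^ (2 * α - 1) * Real.Gamma (1 - 2 * α))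
    (s t : ℝ) (hst : s < t) (q p : ℝ) (hq : 1 < q) [Fact (1 ≤ ENNReal.ofReal q)]
    (hp0 : 0 < p) (hp : p ≤ (q - 1) * Real.exp ((t - s) / (2 * κ)) + 1) :
    ∃ T : Lp ℝ (ENNReal.ofReal q) (gammaMeasure U B t) →L[ℝ]
        Lp ℝ (ENNReal.ofReal q) (gammaMeasure U B s),
      ExtendsEvolP U B s t (ENNReal.ofReal q) T ∧
      (∀ T', ExtendsEvolP U B s t (ENNReal.ofReal q) T' → T' = T) ∧
      ∀ φ : Lp ℝ (ENNReal.ofReal q) (gammaMeasure U B t),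
        eLpNorm (T φ) (ENNReal.ofReal p) (gammaMeasure U B s) ≤
          eLpNorm φ (ENNReal.ofReal q) (gammaMeasure U B t) := by
  have : SecondCountableTopology X := UniformSpace.secondCountable_of_separable X
  have hα' : α < 1 / 2 := hα.2
  have hd : DecayBound U B C η α := decayBound_of_rangeNorm_le hrange hC hbound
  have hκ0 : 0 < κ := by
    rw [hκ]
    have := Real.Gamma_pos_of_pos (show 0 < 1 - 2 * α by linarith)
    positivity
  obtain ⟨Qs, hQs, hQs', -⟩ := exists_clm_covOpInfty hU hB hη hα' hd s
  obtain ⟨Qt, hQt, hQt', -⟩ := exists_clm_covOpInfty hU hB hη hα' hd t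
  obtain ⟨Q, hQ, hQ', -⟩ := exists_clm_covOp hU hB hη hα' hd hst.le
  have hγs : IsGaussianWith 0 Qs (gammaMeasure U B s) := by
    rw [gammaMeasure, hQs']
    exact isGaussianWith_gaussianMeasure hQs
      (hQs' ▸ opTrace_covOpInfty_lt_top hU hB hη hα' hd hsup s)
  have hγt : IsGaussianWith 0 Qt (gammaMeasure U B t) := by
    rw [gammaMeasure, hQt']
    exact isGaussianWith_gaussianMeasure hQt
      (hQt' ▸ opTrace_covOpInfty_lt_top hU hB hη hα' hd hsup t)
  set N := gaussianMeasure 0 (covOp U B t s) with hN_def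
  have hN : IsGaussianWith 0 Q N := by
    rw [hN_def, hQ']
    exact isGaussianWith_gaussianMeasure hQ (hQ' ▸ htrace s t hst)
  have hP : ∀ f : X →ᵇ ℝ, evolP U B s t f = transition (U t s) N f :=
    evolP_eq_transition (by rw [← hN_def, hQ']; exact hN)
  have := hγs.1
  have := hγt.1
  have := hN.1
  have := hγs.isGaussian hQs
  have := hN.isGaussian hQ
  have hinv := hγs.map_add hN hγt (U t s) fun h => by
    rw [← hQs', ← hQt', ← hQ']
    exact inner_covOpInfty_eq_add hU hB hη hα' hd hst.le h
  have hV : ∀ L : X →L[ℝ] ℝ, ∫ x, L (U t s x) ^ 2 ∂(gammaMeasure U B s) ≤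
      Real.exp (-((t - s) / κ)) * ∫ x, L x ^ 2 ∂(gammaMeasure U B t) := fun L => by
    obtain ⟨h, rfl⟩ := (InnerProductSpace.toDual ℝ X).surjective L
    simp only [InnerProductSpace.toDual_apply_apply]
    simp_rw [real_inner_comm _ h, ← ContinuousLinearMap.adjoint_inner_right (U t s)]
    rw [hγs.integral_inner_sq hQs, hγt.integral_inner_sq hQt, Real.exp_neg,
      le_inv_mul_iff₀ (Real.exp_pos _), ← hQs', ← hQt']
    exact exp_mul_inner_covOpInfty_le hU hB hη hα' hd hκ0 hκ hst.le h
  have hts : 0 < t - s := sub_pos.2 hst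
  -- the contraction factor is `exp (-(t - s) / κ)`, half of whose exponent suffices
  have hnorm : ∀ r : ℝ, 1 < r → r ≤ (q - 1) * Real.exp ((t - s) / (2 * κ)) + 1 → ∀ f : X →ᵇ ℝ,
      eLpNorm (transition (U t s) N f) (ENNReal.ofReal r) (gammaMeasure U B s) ≤
        eLpNorm f (ENNReal.ofReal q) (gammaMeasure U B t) := fun r hr1 hr =>
    eLpNorm_transition_le (hγs.integral_id hQs) (hN.integral_id hQ) (U t s) hinv hV hr1 hq <| by
      calc (r - 1) * Real.exp (-((t - s) / κ))
          ≤ (q - 1) * Real.exp ((t - s) / (2 * κ)) * Real.exp (-((t - s) / κ)) :=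
            mul_le_mul_of_nonneg_right (by linarith) (Real.exp_pos _).le
        _ = (q - 1) * Real.exp (-((t - s) / (2 * κ))) := by
            rw [mul_assoc, ← Real.exp_add]
            congr 2
            field_simp
            ring
        _ ≤ (q - 1) * 1 := mul_le_mul_of_nonneg_left
            (Real.exp_le_one_iff.2 (neg_nonpos.2 (by positivity))) (by linarith)
        _ = q - 1 := mul_one _
  have hqle : q ≤ (q - 1) * Real.exp ((t - s) / (2 * κ)) + 1 := by
    have h1 : 1 ≤ Real.exp ((t - s) / (2 * κ)) := Real.one_le_exp (by positivity)
    nlinarith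
  -- exponents below `q`, in particular those below `1`, are reduced to larger ones because
  -- `γ_s` is a probability measure
  have hmax := hnorm (max p q) (lt_max_of_lt_right hq) (max_le hp hqle)
  obtain ⟨T, hT, huniq, hbd⟩ := exists_extension (γ := gammaMeasure U B s)
    (γ' := gammaMeasure U B t) (N := N) (U t s) ENNReal.ofReal_ne_top (hnorm q hq hqle) hmax
  refine ⟨T, fun φ f h => ?_, fun T' hT' => huniq T' fun φ f h => ?_, fun φ => ?_⟩
  · rw [hP]
    exact hT φ f h
  · rw [← hP]
    exact hT' φ f h
  · exact (eLpNorm_le_eLpNorm_of_exponent_le (ENNReal.ofReal_le_ofReal (le_max_left p q))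
      (Lp.aestronglyMeasurable _)).trans (hbd φ)
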